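/- Let $E=\{\zeta_1,\dots,\zeta_n\}$ and $F=\{\xi_1,\dots,\xi_m\}$ be two disjoint finite sets of distinct points on the unit circle, let $p\ge 0$, $r_j\ge 0$ ($1\le j\le n$), $q_k\ge 0$ ($1\le k\le m$), and let $\varepsilon>0$. Write $a_+=\max(a,0)$, and for $f$ analytic in the unit disk $\mathbb{D}=\{|z|<1\}$ let $Z(f)$ denote the zeros of $f$ in $\mathbb{D}$, counted with multiplicity. Then there is a constant $C>0$, depending only on $E$, $F$, $p$, $\{q_k\}$, $\{r_j\}$ and $\varepsilon$, such that for every $K>0$ and every analytic function $f$ on $\mathbb{D}$ with $|f(0)|=1$ and $$\log|f(z)|\le\frac{K}{(1-|z|)^p}\,\frac{\prod_{j=1}^n|z-\zeta_j|^{r_j}}{\prod_{k=1}^m|z-\xi_k|^{q_k}},\qquad z\in\mathbb{D},$$ one has $$\sum_{\zeta\in Z(f)}(1-|\zeta|)^{p+1+\varepsilon}\,\frac{\prod_{k=1}^m|\zeta-\xi_k|^{(q_k-1+\varepsilon)_+}}{\prod_{j=1}^n|\zeta-\zeta_j|^{\min(p,r_j)}}\le C\cdot K.$$ Moreover, if $p=0$,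 the same conclusion holds with the factor $(1-|\zeta|)^{p+1+\varepsilon}=(1-|\zeta|)^{1+\varepsilon}$ replaced by $1-|\zeta|$. -/

import Mathlib

open scoped ENNReal

/-- The sum of `w ζ` over the zeros `ζ` of `f` in the open unit disk, each zero being repeated
according to its multiplicity, as an element of `[0, ∞]` (the weight `w` is meant to be
nonnegative on the disk). -/
noncomputable def diskZeroSum (f : ℂ → ℂ) (w : ℂ → ℝ) : ℝ≥0∞ :=
  ∑' ζ : {z : ℂ // z ∈ Metric.ball (0 : ℂ) 1 ∧ f z = 0},
    ((analyticOrderAt f (ζ : ℂ) : ℕ∞) : ℝ≥0∞) * ENNReal.ofReal (w ζ)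

/-!
The theorem is proved by reducing it, through self-maps of the disc, to functions whose logarithm
is large only near the points `ξ k`, and by treating those with one well-chosen test function.

**Bounded radial growth.** Suppose `log ‖f‖ ≤ K ∏ ‖z - ξ k‖ ^ (-q k)`. For a nonnegative test
function `φ` of class `C²` with compact support in the disc, Jensen's inequality on small circles
and a passage to the limit give `∑ φ(ζ) ≤ ∫ log ‖f‖ Δφ`
(`sum_order_mul_le_integral_log_norm_mul_laplacian`). The test function is
`φ = Y(1 - ‖z‖²) ∏ ‖z - ξ k‖ ^ b k`, where `b k = (q k - 1 + ε)₊`, `ε ≤ 1`, and `Y(t)` is a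
smooth convex truncation of `exp (Λ t) - 1` at height `δ`. The product is the modulus of a
holomorphic function, so its Laplacian can be written down explicitly, and the exponential is convex enough for `Δφ` to
be nonnegative near the circle (`laplacian_testFun_nonneg`). There `log ‖f‖` may be replaced by
its upper bound; the resulting integral consists of a boundary layer of bounded total mass,
against `∏ ‖z - ξ k‖ ^ (-s k)` with `s k = q k - b k < 1`, and of a part which is integrable
because its exponents are less than `2`. Both are bounded uniformly in `δ`
(`exists_integral_laplacianMajorant_le`). Away from the circle only the integral of `log ‖f‖` over
a disc enters, which is nonnegative as `‖f 0‖ = 1`. Letting `δ → 0` gives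
`exists_sum_order_mul_one_sub_norm_le`, and with it the case `p = 0`.

**Radial growth.** Let `p > 0` and `κ j < 1`, with `p κ j` equal to `min p (r j)` up to an
arbitrarily small loss. For a small `a > 0` the map `ψ(w) = w exp (-a / S(w))`, where `S` is a
regularized `1 + ∑ (1 - w / x j) ^ (-κ j)`, sends the disc into itself, fixes `0`, and pushes
points inwards by about `a / |S|`. The values of `S` lie in a sector, so `|S|` is comparable to
its real part. The composition `f ∘ ψ` then has bounded radial growth with constant
`O(K a ^ (-p))` (`InwardData.growth_comp_inwardMap_le`): the factors `‖z - x j‖ ^ (p κ j)`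
compensate the growth of `|S| ^ p`. On the other hand `ψ` is close enough to the identity for
every zero `ζ` of `f` with `(1 - ‖ζ‖) (1 + ∑ ‖ζ - x j‖ ^ (-κ j))` at least a multiple of `a` to
have a preimage nearby (`InwardData.exists_inwardMap_eq`). This bounds the sum over these zeros by
`O(K a ^ (-p))` (`exists_sum_order_le_of_le_weightedDist`). Summing over dyadic values of `a`
costs an arbitrarily small power (`exists_sum_order_mul_weightedDist_le`), and comparing weights
finishes the proof.
-/

section BlaschkeCondition

open MeasureTheory Metric Set Filter Topology Real

/-! ### Jensen's inequality and integrability of `log ‖f‖` -/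

/-- Jensen's formula, keeping only finitely many zeros. -/
lemma log_norm_add_sum_posLog_le_circleAverage {f : ℂ → ℂ} {z : ℂ} {ρ : ℝ} (hρ : 0 < ρ)
    (hf : AnalyticOnNhd ℂ f (closedBall z ρ)) (hz : f z ≠ 0) (S : Finset ℂ) :
    Real.log ‖f z‖ + ∑ ζ ∈ S, (analyticOrderNatAt f ζ : ℝ) * log⁺ (ρ * ‖z - ζ‖⁻¹)
      ≤ circleAverage (fun w => Real.log ‖f w‖) z ρ := by
  have habs : |ρ| = ρ := abs_of_pos hρ
  have hJ := AnalyticOnNhd.circleAverage_log_norm hρ.ne' (by rwa [habs]) hz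
  rw [hJ, habs, add_comm, add_le_add_iff_right]
  set D := MeromorphicOn.divisor f (closedBall z ρ)
  have hfin := D.finiteSupport (isCompact_closedBall z ρ)
  have hDnn : ∀ u, 0 ≤ D u := by
    intro u
    exact MeromorphicOn.AnalyticOnNhd.divisor_nonneg hf u
  have hD0 : ∀ u, u ∉ closedBall z ρ → D u = 0 := fun u hu => D.apply_eq_zero_of_notMem hu
  have hval : ∀ u, u ∈ closedBall z ρ → (D u : ℝ) = (analyticOrderNatAt f u : ℝ) := by
    intro u hu
    have := MeromorphicOn.AnalyticOnNhd.divisor_apply hf hu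
    simp only [D, this, analyticOrderNatAt]
    cases h : analyticOrderAt f u <;> simp
  have hlog : ∀ u ∈ closedBall z ρ, Real.log (ρ * ‖z - u‖⁻¹) = log⁺ (ρ * ‖z - u‖⁻¹) := by
    intro u hu
    by_cases h0 : z = u
    · simp [h0]
    · rw [posLog_eq_log]
      have hp : 0 < ‖z - u‖ := norm_pos_iff.2 (sub_ne_zero.2 h0)
      have : ‖z - u‖ ≤ ρ := by rw [← dist_eq_norm, dist_comm]; exact hu
      rw [abs_of_pos (by positivity), ← div_eq_mul_inv, le_div_iff₀ hp]
      linarith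
  have hpos : ∀ u, 0 ≤ (D u : ℝ) * Real.log (ρ * ‖z - u‖⁻¹) := by
    intro u
    by_cases hu : u ∈ closedBall z ρ
    · rw [hlog u hu]
      exact mul_nonneg (by exact_mod_cast hDnn u) posLog_nonneg
    · simp [hD0 u hu]
  rw [finsum_eq_sum_of_support_subset (s := hfin.toFinset ∪ S) _ (by
    intro u hu
    have : D u ≠ 0 := by
      intro h; simp [h] at hu
    simp [this])]
  calc ∑ ζ ∈ S, (analyticOrderNatAt f ζ : ℝ) * log⁺ (ρ * ‖z - ζ‖⁻¹)
      ≤ ∑ ζ ∈ S, (D ζ : ℝ) * Real.log (ρ * ‖z - ζ‖⁻¹) := by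
        refine Finset.sum_le_sum fun u _ => ?_
        by_cases hu : u ∈ closedBall z ρ
        · rw [hlog u hu, hval u hu]
        · have : log⁺ (ρ * ‖z - u‖⁻¹) = 0 := by
            rw [posLog_eq_zero_iff]
            have h1 : ρ < ‖z - u‖ := by
              rw [← dist_eq_norm, dist_comm]; simpa using hu
            rw [abs_of_nonneg (by positivity), ← div_eq_mul_inv, div_le_one (by linarith)]
            exact h1.le
          rw [this, mul_zero]
          exact hpos u
    _ ≤ _ := Finset.sum_le_sum_of_subset_of_nonneg Finset.subset_union_right
        fun u _ _ => hpos u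

lemma lintegral_ball_eq_polar (F : ℂ → ℝ≥0∞) (hF : Measurable F) (R : ℝ) :
    ∫⁻ z in ball (0 : ℂ) R, F z
      = ∫⁻ r in Ioo 0 R, ENNReal.ofReal r * ∫⁻ θ in Ioo (-π) π, F (circleMap 0 r θ) := by
  rw [← lintegral_indicator measurableSet_ball, ← Complex.lintegral_comp_polarCoord_symm,
    polarCoord_target, Measure.volume_eq_prod, ← Measure.prod_restrict, lintegral_prod]
  · rw [← lintegral_indicator measurableSet_Ioi, ← lintegral_indicator measurableSet_Ioo]
    congr 1 with r
    by_cases hr : 0 < r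
    · have hsymm : ∀ θ : ℝ, Complex.polarCoord.symm (r, θ) = circleMap 0 r θ := by
        intro θ
        simp [circleMap, Complex.exp_mul_I]
      rw [indicator_of_mem (by exact hr)]
      by_cases hR : r < R
      · rw [indicator_of_mem (by exact ⟨hr, hR⟩), ← lintegral_const_mul]
        · refine lintegral_congr fun θ => ?_
          rw [hsymm θ, indicator_of_mem, smul_eq_mul]
          simp [abs_of_pos hr, hR]
        · fun_prop
      · rw [indicator_of_notMem (by simp [hR])]
        rw [← lintegral_zero (μ := volume.restrict (Ioo (-π) π))]
        refine lintegral_congr fun θ => ?_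
        rw [hsymm θ, indicator_of_notMem, smul_zero]
        simpa [abs_of_pos hr] using hR
    · rw [indicator_of_notMem (by exact hr), indicator_of_notMem (by simp [hr])]
  · refine Measurable.aemeasurable ?_
    have h1 : Measurable fun p : ℝ × ℝ => Complex.polarCoord.symm p := by
      simp only [Complex.polarCoord_symm_apply]
      fun_prop
    have h2 : Measurable fun p : ℝ × ℝ => ENNReal.ofReal p.1 := by fun_prop
    exact h2.smul ((hF.indicator measurableSet_ball).comp h1)

lemma integral_Ioo_circleMap_eq (u : ℂ → ℝ) (c : ℂ) (r : ℝ) :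
    ∫ θ in Ioo (-π) π, u (circleMap c r θ) = 2 * π * circleAverage u c r := by
  have h2 : (2 * π) ≠ 0 := by positivity
  rw [circleAverage_def, smul_eq_mul, mul_inv_cancel_left₀ h2, ← integral_Ioc_eq_integral_Ioo,
    ← intervalIntegral.integral_of_le (by linarith [pi_pos])]
  have t₀ : (fun θ ↦ u (circleMap c r θ)).Periodic (2 * π) :=
    fun x ↦ by simp [periodic_circleMap c r x]
  have := t₀.intervalIntegral_add_eq (-π) 0
  rw [zero_add] at this
  rw [← this]
  congr 1
  ring

lemma integrableOn_Ioo_circleMap {u : ℂ → ℝ} {c : ℂ} {r : ℝ} (h : CircleIntegrable u c r) :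
    IntegrableOn (fun θ => u (circleMap c r θ)) (Ioo (-π) π) := by
  have t₀ : (fun θ ↦ u (circleMap c r θ)).Periodic (2 * π) :=
    fun x ↦ by simp [periodic_circleMap c r x]
  have h1 : IntervalIntegrable (fun θ => u (circleMap c r θ)) volume (-π) π :=
    t₀.intervalIntegrable₀ (by positivity) h (-π) π
  rw [← integrableOn_Ioc_iff_integrableOn_Ioo]
  exact (intervalIntegrable_iff_integrableOn_Ioc_of_le (by linarith [pi_pos])).1 h1

open Classical in
/-- Restricting to a ball makes `log ‖f ·‖` measurable on the whole plane. -/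
lemma measurable_indicator_log_norm {f : ℂ → ℂ} {R : ℝ} (hf : ContinuousOn f (ball 0 R)) :
    Measurable ((ball (0 : ℂ) R).indicator fun z => Real.log ‖f z‖) := by
  have h1 : Measurable ((ball (0 : ℂ) R).piecewise f 1) :=
    hf.measurable_piecewise continuousOn_const measurableSet_ball
  have h2 := (Real.measurable_log.comp h1.norm)
  convert h2 using 1
  ext z
  by_cases hz : z ∈ ball (0 : ℂ) R
  · rw [indicator_of_mem hz, Function.comp_apply, piecewise_eq_of_mem _ _ _ hz]
  · rw [indicator_of_notMem hz, Function.comp_apply, piecewise_eq_of_notMem _ _ _ hz]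
    simp

/-- The mean of `M - log ‖f‖` over a disc about `0` is at most `M`, by Jensen's inequality on each
circle. -/
lemma lintegral_sub_log_norm_le {f : ℂ → ℂ} (hf : AnalyticOnNhd ℂ f (ball 0 1)) (h0 : ‖f 0‖ = 1)
    {R M : ℝ} (hR1 : R < 1) (hM : ∀ z ∈ ball (0 : ℂ) R, Real.log ‖f z‖ ≤ M) :
    ∫⁻ z in ball (0 : ℂ) R, ENNReal.ofReal (M - Real.log ‖f z‖)
      ≤ ∫⁻ _ in ball (0 : ℂ) R, ENNReal.ofReal M := by
  have hmeas := measurable_indicator_log_norm (R := R)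
    (hf.continuousOn.mono (ball_subset_ball hR1.le))
  set u := (ball (0 : ℂ) R).indicator fun z => Real.log ‖f z‖ with hu
  have e1 : ∫⁻ z in ball (0 : ℂ) R, ENNReal.ofReal (M - Real.log ‖f z‖)
      = ∫⁻ z in ball (0 : ℂ) R, ENNReal.ofReal (M - u z) := by
    refine setLIntegral_congr_fun measurableSet_ball fun z hz => ?_
    simp only [hu]
    rw [indicator_of_mem hz]
  rw [e1, lintegral_ball_eq_polar _ (by fun_prop), lintegral_ball_eq_polar _ (by fun_prop)]
  refine setLIntegral_mono' measurableSet_Ioo fun r hr => ?_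
  refine mul_le_mul_right ?_ _
  have hsub : closedBall (0 : ℂ) r ⊆ ball 0 1 := closedBall_subset_ball (hr.2.trans hR1)
  have hci : CircleIntegrable (fun z => Real.log ‖f z‖) 0 r := by
    refine MeromorphicOn.circleIntegrable_log_norm (f := f) ?_
    intro x hx
    refine (hf x (hsub ?_)).meromorphicAt
    rw [abs_of_pos hr.1] at hx
    exact sphere_subset_closedBall hx
  have hcirc : ∀ θ, circleMap 0 r θ ∈ ball (0 : ℂ) R := by
    intro θ; simp [abs_of_pos hr.1, hr.2]
  have huc : ∀ θ, u (circleMap 0 r θ) = Real.log ‖f (circleMap 0 r θ)‖ := fun θ => by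
    simp only [hu]
    rw [indicator_of_mem (hcirc θ)]
  simp only [huc]
  have hint := integrableOn_Ioo_circleMap hci
  have hJ := log_norm_add_sum_posLog_le_circleAverage hr.1 (hf.mono hsub)
    (by rw [← norm_pos_iff, h0]; norm_num) ∅
  rw [h0, Real.log_one, Finset.sum_empty, add_zero] at hJ
  have hiM : Integrable (fun _ : ℝ => M) (volume.restrict (Ioo (-π) π)) := by simp
  rw [← ofReal_integral_eq_lintegral_ofReal (f := fun θ => M - Real.log ‖f (circleMap 0 r θ)‖)
    (hiM.sub hint)]
  · have hMnn : 0 ≤ M := by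
      have : (0 : ℂ) ∈ ball (0 : ℂ) R := by simp; linarith [hr.1, hr.2]
      simpa [h0] using hM 0 this
    rw [← ofReal_integral_eq_lintegral_ofReal hiM (Eventually.of_forall fun _ => hMnn)]
    refine ENNReal.ofReal_le_ofReal ?_
    rw [integral_sub hiM hint,
      integral_Ioo_circleMap_eq (fun z => Real.log ‖f z‖)]
    have := mul_nonneg (by positivity : 0 ≤ 2 * π) hJ
    linarith
  · exact Eventually.of_forall fun θ => sub_nonneg.2 (hM _ (hcirc θ))

lemma exists_log_norm_le {f : ℂ → ℂ} (hf : AnalyticOnNhd ℂ f (ball 0 1)) {R : ℝ} (hR1 : R < 1) :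
    ∃ M, 0 ≤ M ∧ ∀ z ∈ ball (0 : ℂ) R, Real.log ‖f z‖ ≤ M := by
  obtain ⟨B, hB⟩ := (isCompact_closedBall (0 : ℂ) R).exists_bound_of_continuousOn
    (hf.continuousOn.mono (closedBall_subset_ball hR1))
  refine ⟨log⁺ B, posLog_nonneg, fun z hz => ?_⟩
  refine (le_max_right 0 _ : Real.log ‖f z‖ ≤ log⁺ ‖f z‖).trans ?_
  exact posLog_le_posLog (norm_nonneg _) (hB z (ball_subset_closedBall hz))

lemma integrableOn_log_norm {f : ℂ → ℂ} (hf : AnalyticOnNhd ℂ f (ball 0 1)) (h0 : ‖f 0‖ = 1)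
    {R : ℝ} (hR1 : R < 1) : IntegrableOn (fun z => Real.log ‖f z‖) (ball 0 R) := by
  obtain ⟨M, hM0, hM⟩ := exists_log_norm_le hf hR1
  have h1 := lintegral_sub_log_norm_le hf h0 hR1 hM
  have hm := measurable_indicator_log_norm (R := R)
    (hf.continuousOn.mono (ball_subset_ball hR1.le))
  have hm' : AEStronglyMeasurable (fun z => Real.log ‖f z‖) (volume.restrict (ball (0 : ℂ) R)) :=
    ((aemeasurable_indicator_iff measurableSet_ball).1 hm.aemeasurable).aestronglyMeasurable
  have hiM : IntegrableOn (fun _ : ℂ => M) (ball 0 R) :=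
    integrableOn_const measure_ball_lt_top.ne
  have h2 : IntegrableOn (fun z => M - Real.log ‖f z‖) (ball 0 R) := by
    refine ⟨aestronglyMeasurable_const.sub hm', ?_⟩
    rw [hasFiniteIntegral_iff_ofReal]
    · refine h1.trans_lt ?_
      rw [setLIntegral_const]
      exact ENNReal.mul_lt_top ENNReal.ofReal_lt_top measure_ball_lt_top
    · exact (ae_restrict_iff' measurableSet_ball).2 (Eventually.of_forall fun z hz =>
        sub_nonneg.2 (hM z hz))
  refine (hiM.sub h2).congr (Eventually.of_forall fun z => ?_)
  simp

lemma setIntegral_log_norm_nonneg {f : ℂ → ℂ} (hf : AnalyticOnNhd ℂ f (ball 0 1))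
    (h0 : ‖f 0‖ = 1) {R : ℝ} (hR1 : R < 1) : 0 ≤ ∫ z in ball (0 : ℂ) R, Real.log ‖f z‖ := by
  obtain ⟨M, hM0, hM⟩ := exists_log_norm_le hf hR1
  have h1 := lintegral_sub_log_norm_le hf h0 hR1 hM
  have hiM : IntegrableOn (fun _ : ℂ => M) (ball 0 R) :=
    integrableOn_const measure_ball_lt_top.ne
  have hu := integrableOn_log_norm hf h0 hR1
  rw [← ofReal_integral_eq_lintegral_ofReal (f := fun z => M - Real.log ‖f z‖) (hiM.sub hu)
      ((ae_restrict_iff' measurableSet_ball).2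
      (Eventually.of_forall fun z hz => sub_nonneg.2 (hM z hz))),
    ← ofReal_integral_eq_lintegral_ofReal hiM (Eventually.of_forall fun _ => hM0),
    ENNReal.ofReal_le_ofReal_iff (integral_nonneg fun _ => hM0), integral_sub hiM hu] at h1
  linarith

/-! ### Green's inequality for `log ‖f‖` -/

lemma laplacian_eq_fderiv_fderiv (φ : ℂ → ℝ) (z : ℂ) :
    Laplacian.laplacian φ z = fderiv ℝ (fderiv ℝ φ) z 1 1
      + fderiv ℝ (fderiv ℝ φ) z Complex.I Complex.I := by
  rw [InnerProductSpace.laplacian_eq_iteratedFDeriv_complexPlane]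
  simp [iteratedFDeriv_two_apply]

lemma exists_forall_norm_sub_lt {E : Type*} [NormedAddCommGroup E] {F : ℂ → E}
    (hF : Continuous F) (hs : HasCompactSupport F) {η : ℝ} (hη : 0 < η) :
    ∃ δ > 0, ∀ a b : ℂ, dist a b < δ → ‖F a - F b‖ < η := by
  have huc : UniformContinuous F := hF.uniformContinuous_of_tendsto_cocompact hs.is_zero_at_infty
  obtain ⟨δ, hδ, h⟩ := Metric.uniformContinuous_iff.1 huc η hη
  exact ⟨δ, hδ, fun a b hab => by simpa [dist_eq_norm] using h hab⟩

/-- Second order Taylor expansion with a remainder controlled by the oscillation of the second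
derivative. -/
lemma abs_taylor_two_le {φ : ℂ → ℝ} {A : ℂ → ℂ →L[ℝ] ℝ} {H : ℂ → ℂ →L[ℝ] ℂ →L[ℝ] ℝ}
    (hd1 : ∀ x, HasFDerivAt φ (A x) x) (hd2 : ∀ x, HasFDerivAt A (H x) x) {η δ : ℝ}
    (hη : 0 ≤ η) (hδ : 0 < δ)
    {z : ℂ} (hb : ∀ x ∈ ball z δ, ‖H x - H z‖ ≤ η) {v : ℂ} (hv : ‖v‖ < δ) :
    |φ (z + v) - φ z - A z v - H z v v / 2| ≤ η * ‖v‖ ^ 2 := by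
  have hline : ∀ t : ℝ, HasDerivAt (fun t : ℝ => z + t • v) v t := by
    intro t
    simpa using ((hasDerivAt_id t).smul_const v).const_add z
  have hfd : ∀ t ∈ Icc (0 : ℝ) 1, ‖A (z + t • v) - A z - H z (t • v)‖ ≤ η * (t * ‖v‖) := by
    intro t ht
    have hmem : z + t • v ∈ ball z δ := by
      simp only [mem_ball, dist_self_add_left, norm_smul, norm_eq_abs, abs_of_nonneg ht.1]
      nlinarith [ht.2, norm_nonneg v]
    have := Convex.norm_image_sub_le_of_norm_hasFDerivWithin_le' (f := A) (φ := H z)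
      (fun x _ => (hd2 x).hasFDerivWithinAt) hb (convex_ball z δ)
      (mem_ball_self hδ) hmem
    simpa [norm_smul, abs_of_nonneg ht.1] using this
  have hq : ∀ t ∈ Icc (0 : ℝ) 1, HasDerivWithinAt
      (fun t : ℝ => φ (z + t • v) - φ z - t * A z v - t ^ 2 * (H z v v / 2))
      (A (z + t • v) v - A z v - t * H z v v) (Icc 0 1) t := by
    intro t _
    have h1 : HasDerivAt (fun t : ℝ => φ (z + t • v)) (A (z + t • v) v) t :=
      (hd1 _).comp_hasDerivAt t (hline t)
    have h2 : HasDerivAt (fun t : ℝ => t * A z v) (A z v) t := by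
      simpa using (hasDerivAt_id t).mul_const (A z v)
    have h3 : HasDerivAt (fun t : ℝ => t ^ 2 * (H z v v / 2)) (t * H z v v) t := by
      have := (hasDerivAt_pow 2 t).mul_const (H z v v / 2)
      refine this.congr_deriv ?_
      push_cast
      ring
    exact (((h1.sub_const _).sub h2).sub h3).hasDerivWithinAt
  have hbound : ∀ t ∈ Ico (0 : ℝ) 1, ‖A (z + t • v) v - A z v - t * H z v v‖
      ≤ η * ‖v‖ ^ 2 := by
    intro t ht
    have h1 := hfd t ⟨ht.1, ht.2.le⟩
    have h2 : A (z + t • v) v - A z v - t * H z v v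
        = (A (z + t • v) - A z - H z (t • v)) v := by
      rw [map_smul]
      rfl
    rw [h2]
    refine (ContinuousLinearMap.le_opNorm _ _).trans ?_
    have h3 : t * ‖v‖ ≤ 1 * ‖v‖ := mul_le_mul_of_nonneg_right ht.2.le (norm_nonneg v)
    calc _ ≤ (η * (t * ‖v‖)) * ‖v‖ := mul_le_mul_of_nonneg_right h1 (norm_nonneg v)
      _ ≤ (η * (1 * ‖v‖)) * ‖v‖ := by gcongr
      _ = η * ‖v‖ ^ 2 := by ring
  have := norm_image_sub_le_of_norm_deriv_le_segment' hq hbound 1 (right_mem_Icc.2 zero_le_one)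
  simpa using this

/-- Second order Taylor expansion, uniform in the base point. -/
lemma exists_forall_taylor_two_le {φ : ℂ → ℝ} (hφ : ContDiff ℝ 2 φ) (hs : HasCompactSupport φ)
    {η : ℝ} (hη : 0 < η) :
    ∃ δ > 0, ∀ z v : ℂ, ‖v‖ < δ →
      |φ (z + v) - φ z - fderiv ℝ φ z v - fderiv ℝ (fderiv ℝ φ) z v v / 2| ≤ η * ‖v‖ ^ 2 := by
  have hφ1 : ContDiff ℝ 1 (fderiv ℝ φ) := hφ.fderiv_right (by norm_num)
  obtain ⟨δ, hδ, hδ'⟩ := exists_forall_norm_sub_lt (hφ1.continuous_fderiv (by norm_num))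
    ((hs.fderiv ℝ).fderiv ℝ) hη
  exact ⟨δ, hδ, fun z v hv => abs_taylor_two_le
    (fun x => (hφ.differentiable (by norm_num) x).hasFDerivAt)
    (fun x => (hφ1.differentiable (by norm_num) x).hasFDerivAt) hη.le hδ
    (fun x hx => (hδ' x z hx).le) hv⟩

lemma circleMap_zero_eq_re_im (ρ θ : ℝ) :
    circleMap 0 ρ θ = (ρ * Real.cos θ) • (1 : ℂ) + (ρ * Real.sin θ) • Complex.I := by
  rw [circleMap, Complex.exp_mul_I, ← Complex.ofReal_cos, ← Complex.ofReal_sin,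
    Complex.real_smul, Complex.real_smul]
  push_cast
  ring

/-- The circle mean of a quadratic polynomial. -/
lemma integral_circleMap_quadratic (c : ℝ) (A : ℂ →L[ℝ] ℝ) (H : ℂ →L[ℝ] ℂ →L[ℝ] ℝ) (ρ : ℝ) :
    ∫ θ in 0..2 * π, (c + A (circleMap 0 ρ θ) + H (circleMap 0 ρ θ) (circleMap 0 ρ θ) / 2)
      = 2 * π * (c + ρ ^ 2 / 4 * (H 1 1 + H Complex.I Complex.I)) := by
  have e : ∀ θ : ℝ, c + A (circleMap 0 ρ θ) + H (circleMap 0 ρ θ) (circleMap 0 ρ θ) / 2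
      = c + ρ * A 1 * Real.cos θ + ρ * A Complex.I * Real.sin θ
        + ρ ^ 2 / 2 * H 1 1 * Real.cos θ ^ 2
        + ρ ^ 2 / 2 * (H 1 Complex.I + H Complex.I 1) * (Real.sin θ * Real.cos θ)
        + ρ ^ 2 / 2 * H Complex.I Complex.I * Real.sin θ ^ 2 := by
    intro θ
    rw [circleMap_zero_eq_re_im]
    simp only [map_add, map_smul, _root_.add_apply, _root_.smul_apply,
      smul_eq_mul]
    ring
  simp only [e]
  rw [intervalIntegral.integral_add, intervalIntegral.integral_add, intervalIntegral.integral_add,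
    intervalIntegral.integral_add, intervalIntegral.integral_add]
  · simp only [intervalIntegral.integral_const_mul, intervalIntegral.integral_const,
      integral_cos, integral_sin, integral_cos_sq, integral_sin_sq, integral_sin_mul_cos₁]
    simp
    ring
  all_goals exact Continuous.intervalIntegrable (by fun_prop) _ _

/-- Circle means of a `C²` function measure its Laplacian, uniformly in the centre. -/
lemma exists_forall_circleAverage_sub_le {φ : ℂ → ℝ} (hφ : ContDiff ℝ 2 φ)
    (hs : HasCompactSupport φ) {η : ℝ} (hη : 0 < η) :
    ∃ δ > 0, ∀ ρ, 0 < ρ → ρ < δ → ∀ z,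
      |circleAverage φ z ρ - φ z - ρ ^ 2 / 4 * Laplacian.laplacian φ z| ≤ η * ρ ^ 2 := by
  obtain ⟨δ, hδ, h⟩ := exists_forall_taylor_two_le hφ hs hη
  refine ⟨δ, hδ, fun ρ hρ hρδ z => ?_⟩
  have hq := integral_circleMap_quadratic (φ z) (fderiv ℝ φ z) (fderiv ℝ (fderiv ℝ φ) z) ρ
  rw [← laplacian_eq_fderiv_fderiv] at hq
  set A := fderiv ℝ φ z
  set H := fderiv ℝ (fderiv ℝ φ) z
  have hi1 : IntervalIntegrable (fun θ => φ (circleMap z ρ θ)) volume 0 (2 * π) := by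
    have := hφ.continuous
    exact Continuous.intervalIntegrable (by fun_prop) _ _
  have hi2 : IntervalIntegrable (fun θ => φ z + A (circleMap 0 ρ θ)
      + H (circleMap 0 ρ θ) (circleMap 0 ρ θ) / 2) volume 0 (2 * π) :=
    Continuous.intervalIntegrable (by fun_prop) _ _
  have hb : ‖∫ θ in 0..2 * π, (φ (circleMap z ρ θ) - (φ z + A (circleMap 0 ρ θ)
      + H (circleMap 0 ρ θ) (circleMap 0 ρ θ) / 2))‖ ≤ η * ρ ^ 2 * |2 * π - 0| := by
    refine intervalIntegral.norm_integral_le_of_norm_le_const fun θ _ => ?_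
    have := h z (circleMap 0 ρ θ) (by simpa [abs_of_pos hρ] using hρδ)
    rw [norm_circleMap_zero, abs_of_pos hρ, show z + circleMap 0 ρ θ = circleMap z ρ θ by
      simp [circleMap]] at this
    rw [norm_eq_abs]
    convert this using 2
    ring
  rw [intervalIntegral.integral_sub hi1 hi2, hq, norm_eq_abs, sub_zero,
    abs_of_pos (by positivity : 0 < 2 * π)] at hb
  have h2 : ∫ θ in 0..2 * π, φ (circleMap z ρ θ) = 2 * π * circleAverage φ z ρ := by
    rw [circleAverage_def, smul_eq_mul, mul_inv_cancel_left₀ (by positivity)]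
  rw [h2, ← mul_sub, abs_mul, abs_of_pos (by positivity : 0 < 2 * π), mul_comm,
    mul_le_mul_iff_left₀ (by positivity)] at hb
  rwa [sub_sub]

/-- Circle means are self-adjoint. -/
lemma integral_mul_circleAverage_comm {φ u : ℂ → ℝ} (hφ : Continuous φ)
    (hs : HasCompactSupport φ) (hum : Measurable u) (hu : Integrable u) (ρ : ℝ) :
    Integrable (fun z => φ z * circleAverage u z ρ) ∧
    Integrable (fun z => circleAverage φ z ρ * u z) ∧
    ∫ z, φ z * circleAverage u z ρ = ∫ z, circleAverage φ z ρ * u z := by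
  obtain ⟨B, hB⟩ := hs.exists_bound_of_continuous hφ
  set ν : Measure ℝ := volume.restrict (Ioc 0 (2 * π)) with hν
  have hnorm : ∀ (w : ℂ → ℝ) z r, circleAverage w z r
      = (2 * π)⁻¹ * ∫ θ, w (z + circleMap 0 r θ) ∂ν := by
    intro w z r
    rw [circleAverage_def, smul_eq_mul, intervalIntegral.integral_of_le (by positivity)]
    simp [circleMap, hν]
  have hcm : Continuous fun p : ℂ × ℝ => circleMap 0 ρ p.2 := by fun_prop
  have hI1 : Integrable (fun p : ℂ × ℝ => φ p.1 * u (p.1 + circleMap 0 ρ p.2))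
      (volume.prod ν) := by
    have hmeas : AEStronglyMeasurable (fun p : ℂ × ℝ => φ p.1 * u (p.1 + circleMap 0 ρ p.2))
        (volume.prod ν) := by
      have h1 : Measurable fun p : ℂ × ℝ => φ p.1 := hφ.measurable.comp measurable_fst
      have h2 : Measurable fun p : ℂ × ℝ => u (p.1 + circleMap 0 ρ p.2) :=
        hum.comp (measurable_fst.add hcm.measurable)
      exact (h1.mul h2).aestronglyMeasurable
    have hz : ∀ θ : ℝ, Integrable fun z => φ z * u (z + circleMap 0 ρ θ) := fun θ =>
      (hu.comp_add_right _).bdd_mul hφ.aestronglyMeasurable (Eventually.of_forall hB)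
    rw [integrable_prod_iff' hmeas]
    refine ⟨Eventually.of_forall hz, ?_⟩
    have hconst : Integrable (fun _ : ℝ => B * ∫ z, ‖u z‖) ν := integrable_const _
    refine hconst.mono' ?_ (Eventually.of_forall fun θ => ?_)
    · exact (hmeas.norm.prod_swap.integral_prod_right' :)
    · rw [norm_of_nonneg (integral_nonneg fun _ => norm_nonneg _), ← integral_const_mul,
        ← integral_add_right_eq_self (fun z => B * ‖u z‖) (circleMap 0 ρ θ)]
      refine integral_mono (hz θ).norm ((hu.comp_add_right _).norm.const_mul _) fun z => ?_
      simp only [norm_mul]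
      exact mul_le_mul_of_nonneg_right (hB z) (norm_nonneg _)
  have hI2 : Integrable (fun p : ℂ × ℝ => φ (p.1 + circleMap 0 (-ρ) p.2) * u p.1)
      (volume.prod ν) := by
    have h1 : Integrable (fun p : ℂ × ℝ => u p.1) (volume.prod ν) := hu.comp_fst ν
    refine h1.bdd_mul (c := B) ?_ (Eventually.of_forall fun p => hB _)
    have : Continuous fun p : ℂ × ℝ => φ (p.1 + circleMap 0 (-ρ) p.2) := by fun_prop
    exact this.aestronglyMeasurable
  have e1 : ∀ z, φ z * circleAverage u z ρ
      = (2 * π)⁻¹ * ∫ θ, φ z * u (z + circleMap 0 ρ θ) ∂ν := by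
    intro z; rw [hnorm, integral_const_mul]; ring
  have e2 : ∀ z, circleAverage φ z ρ * u z
      = (2 * π)⁻¹ * ∫ θ, φ (z + circleMap 0 (-ρ) θ) * u z ∂ν := by
    intro z; rw [← circleAverage_neg_radius, hnorm, integral_mul_const]; ring
  simp only [e1, e2]
  refine ⟨hI1.integral_prod_left.const_mul _, hI2.integral_prod_left.const_mul _, ?_⟩
  rw [integral_const_mul, integral_const_mul,
    integral_integral_swap (f := fun z θ => φ z * u (z + circleMap 0 ρ θ)) hI1,
    integral_integral_swap (f := fun z θ => φ (z + circleMap 0 (-ρ) θ) * u z) hI2]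
  congr 1
  refine integral_congr_ae (Eventually.of_forall fun θ => ?_)
  simp only
  rw [← integral_add_right_eq_self (fun z => φ (z + circleMap 0 (-ρ) θ) * u z) (circleMap 0 ρ θ)]
  refine integral_congr_ae (Eventually.of_forall fun z => ?_)
  simp [circleMap]

lemma ae_ne_zero_of_analyticOnNhd {f : ℂ → ℂ} (hf : AnalyticOnNhd ℂ f (ball 0 1))
    (h0 : ‖f 0‖ = 1) : ∀ᵐ z, z ∈ ball (0 : ℂ) 1 → f z ≠ 0 := by
  have h := AnalyticOnNhd.preimage_zero_mem_codiscreteWithin (x := 0) hf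
    (by rw [← norm_pos_iff, h0]; norm_num) (mem_ball_self one_pos)
    ⟨⟨0, mem_ball_self one_pos⟩, (convex_ball (0 : ℂ) 1).isPreconnected⟩
  have := ae_restrict_le_codiscreteWithin (μ := (volume : Measure ℂ)) measurableSet_ball h
  rw [← ae_restrict_iff' measurableSet_ball]
  exact this

lemma continuous_laplacian {φ : ℂ → ℝ} (hφ : ContDiff ℝ 2 φ) :
    Continuous (Laplacian.laplacian φ) := by
  have h2 := (hφ.fderiv_right (m := 1) (by norm_num)).continuous_fderiv (by norm_num)
  rw [show Laplacian.laplacian φ = fun z => fderiv ℝ (fderiv ℝ φ) z 1 1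
    + fderiv ℝ (fderiv ℝ φ) z Complex.I Complex.I from funext (laplacian_eq_fderiv_fderiv φ)]
  fun_prop

/-- Green's inequality with an error term: the finite-scale form obtained from Jensen's inequality
on all circles of a small radius `ρ`. -/
lemma sum_mul_sub_le_integral_add {f : ℂ → ℂ} (hf : AnalyticOnNhd ℂ f (ball 0 1))
    (h0 : ‖f 0‖ = 1) {R R' : ℝ} (hRR' : R < R') (hR' : R' < 1) {φ : ℂ → ℝ} (hφ : ContDiff ℝ 2 φ)
    (hφ0 : ∀ z, 0 ≤ φ z) (hs : HasCompactSupport φ) (hφs : ∀ z, z ∉ ball (0 : ℂ) R → φ z = 0)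
    (S : Finset ℂ) (hS : ∀ ζ ∈ S, f ζ = 0) {η : ℝ} (hη : 0 < η) :
    π * Real.log 2 * ∑ ζ ∈ S, (analyticOrderNatAt f ζ : ℝ) * (φ ζ - η)
      ≤ (∫ z in ball (0 : ℂ) R', Real.log ‖f z‖ * Laplacian.laplacian φ z)
        + 4 * η * ∫ z in ball (0 : ℂ) R', |Real.log ‖f z‖| := by
  have hcont := hφ.continuous
  obtain ⟨δ₁, hδ₁, hL⟩ := exists_forall_circleAverage_sub_le hφ hs hη
  obtain ⟨δ₂, hδ₂, hU⟩ := exists_forall_norm_sub_lt hcont hs hη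
  obtain ⟨ρ, hρ, hρ'⟩ := exists_between (lt_min (lt_min hδ₁ hδ₂) (sub_pos.2 hRR'))
  have hρ1 : ρ < δ₁ := hρ'.trans_le ((min_le_left _ _).trans (min_le_left _ _))
  have hρ2 : ρ < δ₂ := hρ'.trans_le ((min_le_left _ _).trans (min_le_right _ _))
  have hρ3 : ρ < R' - R := hρ'.trans_le (min_le_right _ _)
  set u := (ball (0 : ℂ) R').indicator fun z => Real.log ‖f z‖ with hu
  have hum : Measurable u := measurable_indicator_log_norm
    (hf.continuousOn.mono (ball_subset_ball hR'.le))
  have hui : Integrable u :=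
    (integrable_indicator_iff measurableSet_ball).2 (integrableOn_log_norm hf h0 hR')
  have hu_eq : ∀ z ∈ ball (0 : ℂ) R', u z = Real.log ‖f z‖ := fun z hz => by
    simp only [hu]; rw [indicator_of_mem hz]
  obtain ⟨hi1, hi2, hcomm⟩ := integral_mul_circleAverage_comm hcont hs hum hui ρ
  obtain ⟨B, hB⟩ := hs.exists_bound_of_continuous hcont
  have hi3 : Integrable fun z => φ z * u z :=
    hui.bdd_mul hcont.aestronglyMeasurable (Eventually.of_forall hB)
  have hΔc : Continuous (Laplacian.laplacian φ) := continuous_laplacian hφ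
  have hΔs : HasCompactSupport (Laplacian.laplacian φ) := by
    refine hs.mono' fun z hz => ?_
    by_contra h
    refine hz ?_
    have h1 : φ =ᶠ[𝓝 z] fun _ => 0 := notMem_tsupport_iff_eventuallyEq.1 h
    rw [(InnerProductSpace.laplacian_congr_nhds h1).eq_of_nhds]
    simp
  obtain ⟨B', hB'⟩ := hΔs.exists_bound_of_continuous hΔc
  have hi4 : Integrable fun z => u z * Laplacian.laplacian φ z :=
    hui.mul_bdd hΔc.aestronglyMeasurable (Eventually.of_forall hB')
  -- the circle mean of `φ` exceeds `φ` by about `ρ² Δφ / 4`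
  have hupper : ∫ z, (circleAverage φ z ρ - φ z) * u z
      ≤ ρ ^ 2 / 4 * ((∫ z, u z * Laplacian.laplacian φ z) + 4 * η * ∫ z, |u z|) := by
    have : ρ ^ 2 / 4 * ((∫ z, u z * Laplacian.laplacian φ z) + 4 * η * ∫ z, |u z|)
        = ∫ z, (ρ ^ 2 / 4 * (u z * Laplacian.laplacian φ z) + η * ρ ^ 2 * |u z|) := by
      rw [integral_add (hi4.const_mul _) (hui.abs.const_mul _), integral_const_mul,
        integral_const_mul]
      ring
    rw [this]
    refine integral_mono ?_ ((hi4.const_mul _).add (hui.abs.const_mul _)) fun z => ?_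
    · refine (hi2.sub hi3).congr (Eventually.of_forall fun z => ?_)
      simp only [Pi.sub_apply, sub_mul]
    · have h1 := hL ρ hρ hρ1 z
      have h2 : |(circleAverage φ z ρ - φ z - ρ ^ 2 / 4 * Laplacian.laplacian φ z) * u z|
          ≤ η * ρ ^ 2 * |u z| := by
        rw [abs_mul]; exact mul_le_mul_of_nonneg_right h1 (abs_nonneg _)
      have h3 := (le_abs_self _).trans h2
      simp only
      linarith
  -- moving the circle mean to `u`, Jensen's formula gives each zero at distance less than `ρ / 2`
  -- a contribution of at least `log 2`
  set m : ℂ → ℝ := fun ζ => (analyticOrderNatAt f ζ : ℝ) with hm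
  have hpt : ∀ᵐ z, ∑ ζ ∈ S, m ζ * (Real.log 2 * ((ball ζ (ρ / 2)).indicator φ z))
      ≤ φ z * circleAverage u z ρ - φ z * u z := by
    filter_upwards [ae_ne_zero_of_analyticOnNhd hf h0] with z hz
    by_cases hzR : z ∈ ball (0 : ℂ) R
    · have hsub : closedBall z ρ ⊆ ball 0 R' := by
        refine closedBall_subset_ball' ?_
        simp at hzR ⊢; linarith
      have hz1 : z ∈ ball (0 : ℂ) 1 := ball_subset_ball (hRR'.le.trans hR'.le) hzR
      have hJ := log_norm_add_sum_posLog_le_circleAverage hρ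
        (hf.mono (hsub.trans (ball_subset_ball hR'.le))) (hz hz1) S
      have hca : circleAverage (fun w => Real.log ‖f w‖) z ρ = circleAverage u z ρ := by
        refine circleAverage_congr_sphere fun w hw => ?_
        rw [abs_of_pos hρ] at hw
        exact (hu_eq w (hsub (sphere_subset_closedBall hw))).symm
      rw [hca, ← hu_eq z (ball_subset_ball hRR'.le hzR)] at hJ
      have hJ' := mul_le_mul_of_nonneg_left hJ (hφ0 z)
      rw [mul_add, Finset.mul_sum] at hJ'
      have : ∑ ζ ∈ S, m ζ * (Real.log 2 * ((ball ζ (ρ / 2)).indicator φ z))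
          ≤ ∑ ζ ∈ S, φ z * (m ζ * log⁺ (ρ * ‖z - ζ‖⁻¹)) := by
        refine Finset.sum_le_sum fun ζ hζ => ?_
        by_cases hzζ : z ∈ ball ζ (ρ / 2)
        · rw [indicator_of_mem hzζ]
          have hne : z ≠ ζ := by
            rintro rfl; exact hz hz1 (hS z hζ)
          have hp : 0 < ‖z - ζ‖ := norm_pos_iff.2 (sub_ne_zero.2 hne)
          have h2 : Real.log 2 ≤ log⁺ (ρ * ‖z - ζ‖⁻¹) := by
            refine le_trans ?_ (le_max_right 0 _ : Real.log (ρ * ‖z - ζ‖⁻¹) ≤ _)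
            refine Real.log_le_log two_pos ?_
            rw [← div_eq_mul_inv, le_div_iff₀ hp]
            rw [mem_ball, dist_eq_norm] at hzζ
            linarith
          have := mul_le_mul_of_nonneg_left h2
            (mul_nonneg (hφ0 z) (Nat.cast_nonneg (analyticOrderNatAt f ζ) : (0 : ℝ) ≤ _))
          simp only [hm]
          linarith
        · rw [indicator_of_notMem hzζ, mul_zero, mul_zero]
          exact mul_nonneg (hφ0 z) (mul_nonneg (Nat.cast_nonneg _) posLog_nonneg)
      linarith
    · have h1 : φ z = 0 := hφs z hzR
      have h2 : ∀ ζ, (ball ζ (ρ / 2)).indicator φ z = 0 := fun ζ => by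
        by_cases h : z ∈ ball ζ (ρ / 2)
        · rw [indicator_of_mem h, h1]
        · rw [indicator_of_notMem h]
      simp [h1, h2]
  have hφi : Integrable φ := hcont.integrable_of_hasCompactSupport hs
  have hlower : ρ ^ 2 / 4 * (π * Real.log 2 * ∑ ζ ∈ S, m ζ * (φ ζ - η))
      ≤ ∫ z, (circleAverage φ z ρ - φ z) * u z := by
    have h1 : ∫ z, (circleAverage φ z ρ - φ z) * u z
        = ∫ z, (φ z * circleAverage u z ρ - φ z * u z) := by
      rw [integral_sub hi1 hi3, hcomm, ← integral_sub hi2 hi3]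
      simp only [sub_mul]
    have h2 := integral_mono_ae (integrable_finsetSum S fun ζ _ =>
      (((hφi.indicator (measurableSet_ball (x := ζ) (ε := ρ / 2))).const_mul
        (Real.log 2)).const_mul (m ζ))) (hi1.sub hi3) hpt
    rw [h1]
    refine le_trans ?_ h2
    rw [integral_finsetSum S fun ζ _ =>
      (((hφi.indicator (measurableSet_ball (x := ζ) (ε := ρ / 2))).const_mul
        (Real.log 2)).const_mul (m ζ)), Finset.mul_sum, Finset.mul_sum]
    refine Finset.sum_le_sum fun ζ _ => ?_
    rw [integral_const_mul, integral_const_mul, integral_indicator measurableSet_ball]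
    have h3 : (φ ζ - η) * (π * (ρ / 2) ^ 2) ≤ ∫ z in ball ζ (ρ / 2), φ z := by
      have hc : ∫ _ in ball ζ (ρ / 2), (φ ζ - η) = (φ ζ - η) * (π * (ρ / 2) ^ 2) := by
        rw [setIntegral_const, smul_eq_mul, mul_comm, measureReal_def, Complex.volume_ball]
        rw [ENNReal.toReal_mul, ENNReal.toReal_pow, ENNReal.toReal_ofReal (by positivity)]
        simp [mul_comm]
      rw [← hc]
      refine setIntegral_mono_on (integrableOn_const measure_ball_lt_top.ne) hφi.integrableOn
        measurableSet_ball fun z hz => ?_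
      have := hU z ζ (by rw [mem_ball] at hz; linarith)
      rw [norm_eq_abs, abs_lt] at this
      linarith
    have h4 := mul_le_mul_of_nonneg_left h3
      (mul_nonneg (Nat.cast_nonneg (analyticOrderNatAt f ζ) : (0 : ℝ) ≤ _)
        (Real.log_nonneg one_le_two))
    simp only [hm]
    linarith
  have hfin := hlower.trans hupper
  rw [mul_le_mul_iff_right₀ (by positivity)] at hfin
  have e1 : ∫ z in ball (0 : ℂ) R', Real.log ‖f z‖ * Laplacian.laplacian φ z
      = ∫ z, u z * Laplacian.laplacian φ z := by
    rw [← integral_indicator measurableSet_ball]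
    refine integral_congr_ae (Eventually.of_forall fun z => ?_)
    simp only [hu]
    by_cases h : z ∈ ball (0 : ℂ) R'
    · rw [indicator_of_mem h, indicator_of_mem h]
    · rw [indicator_of_notMem h, indicator_of_notMem h, zero_mul]
  have e2 : ∫ z in ball (0 : ℂ) R', |Real.log ‖f z‖| = ∫ z, |u z| := by
    rw [← integral_indicator measurableSet_ball]
    refine integral_congr_ae (Eventually.of_forall fun z => ?_)
    simp only [hu]
    by_cases h : z ∈ ball (0 : ℂ) R'
    · rw [indicator_of_mem h, indicator_of_mem h]
    · rw [indicator_of_notMem h, indicator_of_notMem h, abs_zero]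
  rw [e1, e2]
  exact hfin

/-- **Green's inequality**: `∑ φ(ζ) ≤ ∫ log ‖f‖ Δφ` over any finite set of zeros of `f`, for a
nonnegative test function `φ`. (The sharp constant on the left would be `2π`.) -/
theorem sum_order_mul_le_integral_log_norm_mul_laplacian {f : ℂ → ℂ}
    (hf : AnalyticOnNhd ℂ f (ball 0 1))
    (h0 : ‖f 0‖ = 1) {R R' : ℝ} (hRR' : R < R') (hR' : R' < 1) {φ : ℂ → ℝ} (hφ : ContDiff ℝ 2 φ)
    (hφ0 : ∀ z, 0 ≤ φ z) (hφs : ∀ z, z ∉ ball (0 : ℂ) R → φ z = 0)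
    (S : Finset ℂ) (hS : ∀ ζ ∈ S, f ζ = 0) :
    ∑ ζ ∈ S, (analyticOrderNatAt f ζ : ℝ) * φ ζ
      ≤ ∫ z in ball (0 : ℂ) R', Real.log ‖f z‖ * Laplacian.laplacian φ z := by
  have hs : HasCompactSupport φ := HasCompactSupport.intro (isCompact_closedBall (0 : ℂ) R)
    fun z hz => hφs z fun h => hz (ball_subset_closedBall h)
  have hlim : π * Real.log 2 * ∑ ζ ∈ S, (analyticOrderNatAt f ζ : ℝ) * φ ζ
      ≤ ∫ z in ball (0 : ℂ) R', Real.log ‖f z‖ * Laplacian.laplacian φ z := by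
    have t1 : Tendsto (fun η : ℝ => π * Real.log 2 *
        ∑ ζ ∈ S, (analyticOrderNatAt f ζ : ℝ) * (φ ζ - η)) (𝓝[>] 0)
        (𝓝 (π * Real.log 2 * ∑ ζ ∈ S, (analyticOrderNatAt f ζ : ℝ) * (φ ζ - 0))) :=
      (Continuous.tendsto (by fun_prop) (0 : ℝ)).mono_left nhdsWithin_le_nhds
    have t2 : Tendsto (fun η : ℝ =>
        (∫ z in ball (0 : ℂ) R', Real.log ‖f z‖ * Laplacian.laplacian φ z)
        + 4 * η * ∫ z in ball (0 : ℂ) R', |Real.log ‖f z‖|) (𝓝[>] 0)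
        (𝓝 ((∫ z in ball (0 : ℂ) R', Real.log ‖f z‖ * Laplacian.laplacian φ z)
        + 4 * 0 * ∫ z in ball (0 : ℂ) R', |Real.log ‖f z‖|)) :=
      (Continuous.tendsto (by fun_prop) (0 : ℝ)).mono_left nhdsWithin_le_nhds
    have := le_of_tendsto_of_tendsto t1 t2 (eventually_nhdsWithin_of_forall fun η hη =>
      sum_mul_sub_le_integral_add hf h0 hRR' hR' hφ hφ0 hs hφs S hS hη)
    simpa using this
  refine le_trans ?_ hlim
  refine le_mul_of_one_le_left (Finset.sum_nonneg fun ζ _ =>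
    mul_nonneg (Nat.cast_nonneg _) (hφ0 ζ)) ?_
  nlinarith [Real.log_two_gt_d9, Real.pi_gt_three]

/-! ### Laplacian of a radial function times the modulus of a holomorphic function -/

section Laplacian

variable {L ℓ ℓ₂ : ℂ → ℂ} {W W₁ W₂ : ℝ → ℝ}

lemma hasDerivAt_line (z v : ℂ) (t : ℝ) : HasDerivAt (fun t : ℝ => z + t * v) v t := by
  have h : HasDerivAt (fun t : ℝ => (t : ℂ)) 1 t := Complex.ofRealCLM.hasDerivAt
  simpa using (h.mul_const v).const_add z

lemma hasDerivAt_line_normSq (z v : ℂ) (t : ℝ) :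
    HasDerivAt (fun t : ℝ => 1 - ((z + t * v).re ^ 2 + (z + t * v).im ^ 2))
      (-2 * ((z + t * v).re * v.re + (z + t * v).im * v.im)) t := by
  have h1 : HasDerivAt (fun t : ℝ => (z + t * v).re) v.re t :=
    Complex.reCLM.hasFDerivAt.comp_hasDerivAt t (hasDerivAt_line z v t)
  have h2 : HasDerivAt (fun t : ℝ => (z + t * v).im) v.im t :=
    Complex.imCLM.hasFDerivAt.comp_hasDerivAt t (hasDerivAt_line z v t)
  refine (((h1.pow 2).add (h2.pow 2)).const_sub 1).congr_deriv ?_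
  norm_num
  ring

lemma hasDerivAt_line_re_mul {F : ℂ → ℂ} {F' c : ℂ} (z v : ℂ) (t : ℝ)
    (hF : HasDerivAt F F' (z + t * v)) :
    HasDerivAt (fun t : ℝ => (F (z + t * v) * c).re) (F' * v * c).re t := by
  have h1 : HasDerivAt (fun t : ℝ => F (z + t * v)) (F' * v) t :=
    hF.comp t (hasDerivAt_line z v t)
  exact Complex.reCLM.hasFDerivAt.comp_hasDerivAt t (h1.mul_const c)

/-- Second directional derivative of `W (1 - |z|²) |exp (L z)|`. -/
lemma fderiv_fderiv_radial_mul_exp {φ : ℂ → ℝ} (hφ : ContDiff ℝ 2 φ)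
    (hL : ∀ w ∈ ball (0 : ℂ) 1, HasDerivAt L (ℓ w) w)
    (hℓ : ∀ w ∈ ball (0 : ℂ) 1, HasDerivAt ℓ (ℓ₂ w) w)
    (hW : ∀ t, HasDerivAt W (W₁ t) t) (hW₁ : ∀ t, HasDerivAt W₁ (W₂ t) t)
    (heq : ∀ w ∈ ball (0 : ℂ) 1, φ w = W (1 - (w.re ^ 2 + w.im ^ 2)) * Real.exp (L w).re)
    {z : ℂ} (hz : z ∈ ball (0 : ℂ) 1) (v : ℂ) :
    fderiv ℝ (fderiv ℝ φ) z v v = Real.exp (L z).re *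
      (W (1 - (z.re ^ 2 + z.im ^ 2)) * ((ℓ z * v).re ^ 2 + (ℓ₂ z * v * v).re)
        - 4 * W₁ (1 - (z.re ^ 2 + z.im ^ 2)) * ((z.re * v.re + z.im * v.im) * (ℓ z * v).re)
        - 2 * W₁ (1 - (z.re ^ 2 + z.im ^ 2)) * (v.re ^ 2 + v.im ^ 2)
        + 4 * W₂ (1 - (z.re ^ 2 + z.im ^ 2)) * (z.re * v.re + z.im * v.im) ^ 2) := by
  have hline : Continuous fun t : ℝ => z + t * v := by fun_prop
  have hev : ∀ᶠ t : ℝ in 𝓝 0, z + t * v ∈ ball (0 : ℂ) 1 :=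
    hline.continuousAt.eventually_mem (isOpen_ball.mem_nhds (by simpa using hz))
  have hexp : ∀ t : ℝ, z + t * v ∈ ball (0 : ℂ) 1 →
      HasDerivAt (fun t : ℝ => Real.exp (L (z + t * v)).re)
        (Real.exp (L (z + t * v)).re * (ℓ (z + t * v) * v).re) t := by
    intro t ht
    have := (hasDerivAt_line_re_mul (c := 1) z v t (hL _ ht)).exp
    simpa using this
  -- valid near `t = 0` only, which suffices for differentiating once more at `0`
  have h1 : ∀ᶠ t : ℝ in 𝓝 0, fderiv ℝ φ (z + t * v) v
      = Real.exp (L (z + t * v)).re * (W (1 - ((z + t * v).re ^ 2 + (z + t * v).im ^ 2))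
          * (ℓ (z + t * v) * v).re
        - 2 * W₁ (1 - ((z + t * v).re ^ 2 + (z + t * v).im ^ 2))
          * ((z + t * v).re * v.re + (z + t * v).im * v.im)) := by
    filter_upwards [hev.eventually_nhds] with t ht
    have ha : HasDerivAt (fun t : ℝ => φ (z + t * v)) (fderiv ℝ φ (z + t * v) v) t :=
      (hφ.differentiable (by norm_num) _).hasFDerivAt.comp_hasDerivAt t (hasDerivAt_line z v t)
    have hb := ((hW _).comp t (hasDerivAt_line_normSq z v t)).mul (hexp t ht.self_of_nhds)
    have hc := hb.congr_of_eventuallyEq (f₁ := fun t : ℝ => φ (z + t * v)) (by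
      filter_upwards [ht] with s hs
      exact heq _ hs)
    rw [ha.unique hc]
    simp only [Function.comp_apply]
    ring
  have hd : HasDerivAt (fun t : ℝ => fderiv ℝ φ (z + t * v) v)
      (fderiv ℝ (fderiv ℝ φ) z v v) 0 := by
    have hdf : HasFDerivAt (fderiv ℝ φ) (fderiv ℝ (fderiv ℝ φ) z) (z + ((0 : ℝ) : ℂ) * v) := by
      have := ((hφ.fderiv_right (m := 1) (by norm_num)).differentiable (by norm_num) z).hasFDerivAt
      simpa using this
    have := hdf.comp_hasDerivAt 0 (hasDerivAt_line z v 0)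
    exact this.clm_apply (hasDerivAt_const 0 v) |>.congr_deriv (by simp)
  have hz0 : z + ((0 : ℝ) : ℂ) * v ∈ ball (0 : ℂ) 1 := by simpa using hz
  have h2 := (hexp 0 hz0).mul
    ((((hW _).comp 0 (hasDerivAt_line_normSq z v 0)).mul
      (hasDerivAt_line_re_mul (c := v) z v 0 (hℓ _ hz0))).sub
    ((((hW₁ _).comp 0 (hasDerivAt_line_normSq z v 0)).const_mul 2).mul
      (((Complex.reCLM.hasFDerivAt.comp_hasDerivAt 0 (hasDerivAt_line z v 0)).mul_const v.re).add
        ((Complex.imCLM.hasFDerivAt.comp_hasDerivAt 0 (hasDerivAt_line z v 0)).mul_const v.im))))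
  have h3 := h2.congr_of_eventuallyEq (f₁ := fun t : ℝ => fderiv ℝ φ (z + t * v) v) h1
  rw [hd.unique h3]
  simp only [Function.comp_apply, Complex.ofReal_zero, zero_mul, add_zero, Pi.mul_apply,
    Complex.reCLM_apply, Complex.imCLM_apply, Pi.sub_apply, Pi.add_apply]
  ring

/-- The Laplacian of `W (1 - |z|²) |exp (L z)|` for holomorphic `L`; the second derivative of `L`
drops out because `Re L` is harmonic. -/
lemma laplacian_radial_mul_exp {φ : ℂ → ℝ} (hφ : ContDiff ℝ 2 φ)
    (hL : ∀ w ∈ ball (0 : ℂ) 1, HasDerivAt L (ℓ w) w)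
    (hℓ : ∀ w ∈ ball (0 : ℂ) 1, HasDerivAt ℓ (ℓ₂ w) w)
    (hW : ∀ t, HasDerivAt W (W₁ t) t) (hW₁ : ∀ t, HasDerivAt W₁ (W₂ t) t)
    (heq : ∀ w ∈ ball (0 : ℂ) 1, φ w = W (1 - (w.re ^ 2 + w.im ^ 2)) * Real.exp (L w).re)
    {z : ℂ} (hz : z ∈ ball (0 : ℂ) 1) :
    Laplacian.laplacian φ z = Real.exp (L z).re *
      (4 * ‖z‖ ^ 2 * W₂ (1 - ‖z‖ ^ 2) - 4 * W₁ (1 - ‖z‖ ^ 2)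
        - 4 * W₁ (1 - ‖z‖ ^ 2) * (z * ℓ z).re + W (1 - ‖z‖ ^ 2) * ‖ℓ z‖ ^ 2) := by
  rw [laplacian_eq_fderiv_fderiv, fderiv_fderiv_radial_mul_exp hφ hL hℓ hW hW₁ heq hz,
    fderiv_fderiv_radial_mul_exp hφ hL hℓ hW hW₁ heq hz, Complex.sq_norm, Complex.sq_norm,
    Complex.normSq_apply, Complex.normSq_apply]
  simp only [← pow_two]
  simp
  ring

end Laplacian

/-! ### A smooth convex truncation of the identity -/

/-- A smooth convex function which vanishes on `(-∞, δ]` and has slope one on `[2δ, ∞)`. -/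
noncomputable def smoothRamp (δ s : ℝ) : ℝ := ∫ x in 0..s, smoothTransition ((x - δ) / δ)

section smoothRamp

variable {δ : ℝ}

lemma continuous_smoothTransition_div : Continuous fun x : ℝ => smoothTransition ((x - δ) / δ) :=
  smoothTransition.continuous.comp (by fun_prop)

lemma hasDerivAt_smoothRamp (s : ℝ) :
    HasDerivAt (smoothRamp δ) (smoothTransition ((s - δ) / δ)) s :=
  intervalIntegral.integral_hasDerivAt_right
    (continuous_smoothTransition_div.intervalIntegrable _ _)
    (continuous_smoothTransition_div.stronglyMeasurableAtFilter _ _)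
    continuous_smoothTransition_div.continuousAt

lemma contDiff_smoothTransition_div :
    ContDiff ℝ 1 fun x : ℝ => smoothTransition ((x - δ) / δ) :=
  smoothTransition.contDiff.comp (by fun_prop)

lemma contDiff_smoothRamp : ContDiff ℝ 2 (smoothRamp δ) := by
  have hd : deriv (smoothRamp δ) = fun s => smoothTransition ((s - δ) / δ) :=
    funext fun s => (hasDerivAt_smoothRamp s).deriv
  rw [show (2 : WithTop ℕ∞) = 1 + 1 by norm_num, contDiff_succ_iff_deriv]
  refine ⟨fun s => (hasDerivAt_smoothRamp s).differentiableAt, by simp, ?_⟩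
  rw [hd]
  exact contDiff_smoothTransition_div

lemma monotone_smoothTransition_div (hδ : 0 < δ) :
    Monotone fun x : ℝ => smoothTransition ((x - δ) / δ) :=
  smoothTransition.monotone.comp fun _ _ h => by gcongr

lemma smoothRamp_of_le (hδ : 0 < δ) {s : ℝ} (hs : s ≤ δ) : smoothRamp δ s = 0 := by
  rw [smoothRamp]
  refine intervalIntegral.integral_zero_ae (Eventually.of_forall fun x hx => ?_)
  refine smoothTransition.zero_of_nonpos (div_nonpos_of_nonpos_of_nonneg ?_ hδ.le)
  have := hx.2
  rcases max_cases 0 s with h | h <;> linarith [h.1]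

lemma smoothRamp_nonneg (hδ : 0 < δ) (s : ℝ) : 0 ≤ smoothRamp δ s := by
  rcases le_total s 0 with hs | hs
  · rw [smoothRamp_of_le hδ (hs.trans hδ.le)]
  · exact intervalIntegral.integral_nonneg hs fun x _ => smoothTransition.nonneg _

lemma smoothRamp_le {s : ℝ} (hs : 0 ≤ s) : smoothRamp δ s ≤ s := by
  have : ∫ _ in (0 : ℝ)..s, (1 : ℝ) = s := by simp
  conv_rhs => rw [← this]
  exact intervalIntegral.integral_mono_on hs
    (continuous_smoothTransition_div.intervalIntegrable _ _) (by simp)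
    fun x _ => smoothTransition.le_one _

lemma sub_le_smoothRamp (hδ : 0 < δ) (s : ℝ) : s - 2 * δ ≤ smoothRamp δ s := by
  rcases le_total s (2 * δ) with hs | hs
  · linarith [smoothRamp_nonneg hδ s]
  · rw [smoothRamp, ← intervalIntegral.integral_add_adjacent_intervals (b := 2 * δ)
      (continuous_smoothTransition_div.intervalIntegrable _ _)
      (continuous_smoothTransition_div.intervalIntegrable _ _)]
    have h1 : 0 ≤ ∫ x in (0 : ℝ)..(2 * δ), smoothTransition ((x - δ) / δ) :=
      intervalIntegral.integral_nonneg (by positivity) fun x _ => smoothTransition.nonneg _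
    have h2 : ∫ x in (2 * δ)..s, smoothTransition ((x - δ) / δ) = s - 2 * δ := by
      rw [intervalIntegral.integral_congr (g := fun _ => (1 : ℝ))]
      · simp
      · intro x hx
        rw [uIcc_of_le hs] at hx
        refine smoothTransition.one_of_one_le ?_
        rw [le_div_iff₀ hδ]
        linarith [hx.1]
    linarith

end smoothRamp

/-! ### The test function -/

section TestFunction

variable {m : ℕ}

/-- A holomorphic logarithm on the unit disc with real part `log ∏ ‖z - ξ k‖ ^ b k`, for `ξ k` on
the unit circle. -/
noncomputable def logProd (ξ : Fin m → ℂ) (b : Fin m → ℝ) (z : ℂ) : ℂ :=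
  ∑ k, (b k : ℂ) * Complex.log (1 - z * (starRingEnd ℂ) (ξ k))

/-- The derivative of `logProd`. -/
noncomputable def logProdDeriv (ξ : Fin m → ℂ) (b : Fin m → ℝ) (z : ℂ) : ℂ :=
  ∑ k, (b k : ℂ) * (-(starRingEnd ℂ) (ξ k) / (1 - z * (starRingEnd ℂ) (ξ k)))

variable {ξ : Fin m → ℂ} {b : Fin m → ℝ}

lemma norm_one_sub_mul_conj {x : ℂ} (hx : ‖x‖ = 1) (z : ℂ) :
    ‖1 - z * (starRingEnd ℂ) x‖ = ‖z - x‖ := by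
  have h : x * (starRingEnd ℂ) x = 1 := by
    rw [Complex.mul_conj, Complex.normSq_eq_norm_sq, hx]; simp
  have : 1 - z * (starRingEnd ℂ) x = (x - z) * (starRingEnd ℂ) x := by
    rw [sub_mul, h]
  rw [this, norm_mul, RCLike.norm_conj, hx, mul_one, norm_sub_rev]

lemma re_one_sub_mul_conj_pos {x z : ℂ} (hx : ‖x‖ = 1) (hz : ‖z‖ < 1) :
    0 < (1 - z * (starRingEnd ℂ) x).re := by
  have : (z * (starRingEnd ℂ) x).re ≤ ‖z‖ := by
    refine (Complex.re_le_norm _).trans ?_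
    rw [norm_mul, RCLike.norm_conj, hx, mul_one]
  simp only [Complex.sub_re, Complex.one_re]
  linarith

lemma one_sub_mul_conj_ne_zero {x z : ℂ} (hx : ‖x‖ = 1) (hz : ‖z‖ < 1) :
    1 - z * (starRingEnd ℂ) x ≠ 0 := fun h => by
  have := re_one_sub_mul_conj_pos hx hz
  simp [h] at this

lemma one_sub_norm_le_norm_sub {x : ℂ} (hx : ‖x‖ = 1) (z : ℂ) : 1 - ‖z‖ ≤ ‖z - x‖ := by
  have := norm_sub_norm_le x z
  rwa [hx, norm_sub_rev] at this

lemma norm_sub_pos_of_norm_lt {x z : ℂ} (hx : ‖x‖ = 1) (hz : ‖z‖ < 1) : 0 < ‖z - x‖ := by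
  linarith [one_sub_norm_le_norm_sub hx z]

lemma norm_sub_le_two {x z : ℂ} (hx : ‖x‖ = 1) (hz : ‖z‖ < 1) : ‖z - x‖ ≤ 2 := by
  linarith [norm_sub_le z x]

lemma exp_re_logProd (hξ : ∀ k, ‖ξ k‖ = 1) {z : ℂ} (hz : ‖z‖ < 1) :
    Real.exp (logProd ξ b z).re = ∏ k, ‖z - ξ k‖ ^ b k := by
  rw [logProd, Complex.re_sum, Real.exp_sum]
  refine Finset.prod_congr rfl fun k _ => ?_
  rw [Complex.re_ofReal_mul, Complex.log_re, norm_one_sub_mul_conj (hξ k),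
    Real.rpow_def_of_pos (norm_sub_pos_of_norm_lt (hξ k) hz), mul_comm]

lemma hasDerivAt_one_sub_mul_conj (x z : ℂ) :
    HasDerivAt (fun z => 1 - z * (starRingEnd ℂ) x) (-(starRingEnd ℂ) x) z := by
  simpa using ((hasDerivAt_id z).mul_const ((starRingEnd ℂ) x)).const_sub 1

lemma hasDerivAt_logProd (hξ : ∀ k, ‖ξ k‖ = 1) {z : ℂ} (hz : ‖z‖ < 1) :
    HasDerivAt (logProd ξ b) (logProdDeriv ξ b z) z := by
  unfold logProd logProdDeriv
  refine HasDerivAt.fun_sum fun k _ => ?_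
  exact ((hasDerivAt_one_sub_mul_conj (ξ k) z).clog
    (Or.inl (re_one_sub_mul_conj_pos (hξ k) hz))).const_mul _

lemma differentiableAt_logProdDeriv (hξ : ∀ k, ‖ξ k‖ = 1) {z : ℂ} (hz : ‖z‖ < 1) :
    DifferentiableAt ℂ (logProdDeriv ξ b) z := by
  unfold logProdDeriv
  refine DifferentiableAt.fun_sum fun k _ => ?_
  exact (((differentiableAt_const _).div (hasDerivAt_one_sub_mul_conj (ξ k) z).differentiableAt
    (one_sub_mul_conj_ne_zero (hξ k) hz))).const_mul _

lemma norm_logProdDeriv_le (hξ : ∀ k, ‖ξ k‖ = 1) (hb : ∀ k, 0 ≤ b k) (z : ℂ) :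
    ‖logProdDeriv ξ b z‖ ≤ ∑ k, b k / ‖z - ξ k‖ := by
  refine (norm_sum_le _ _).trans (Finset.sum_le_sum fun k _ => le_of_eq ?_)
  rw [norm_mul, norm_div, norm_neg, RCLike.norm_conj, hξ, norm_one_sub_mul_conj (hξ k),
    Complex.norm_real, norm_of_nonneg (hb k)]
  ring

/-- `Re (z L'(z)) ≤ ½ ∑ b k`, because `w ↦ w / (w - 1)` maps the disc into `{Re < 1/2}`. -/
lemma re_mul_logProdDeriv_le (hξ : ∀ k, ‖ξ k‖ = 1) (hb : ∀ k, 0 ≤ b k) {z : ℂ} (hz : ‖z‖ < 1) :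
    (z * logProdDeriv ξ b z).re ≤ (∑ k, b k) / 2 := by
  rw [logProdDeriv, Finset.mul_sum, Complex.re_sum, Finset.sum_div]
  refine Finset.sum_le_sum fun k _ => ?_
  set w := z * (starRingEnd ℂ) (ξ k) with hw
  have hw1 : ‖w‖ < 1 := by rw [hw, norm_mul, RCLike.norm_conj, hξ, mul_one]; exact hz
  have hne : 1 - w ≠ 0 := one_sub_mul_conj_ne_zero (hξ k) hz
  have e : z * ((b k : ℂ) * (-(starRingEnd ℂ) (ξ k) / (1 - w))) = (b k : ℂ) * (-w / (1 - w)) := by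
    rw [hw]; ring
  rw [e, Complex.re_ofReal_mul, div_eq_mul_inv (b k)]
  refine mul_le_mul_of_nonneg_left ?_ (hb k)
  have hn : 0 < Complex.normSq (1 - w) := Complex.normSq_pos.2 hne
  have h2 : Complex.normSq w < 1 := by
    rw [Complex.normSq_eq_norm_sq]; nlinarith [norm_nonneg w]
  rw [Complex.div_re, ← add_div, div_le_iff₀ hn]
  rw [Complex.normSq_apply] at h2 ⊢
  simp only [Complex.neg_re, Complex.neg_im, Complex.sub_re, Complex.sub_im, Complex.one_re,
    Complex.one_im]
  nlinarith

/-- The radial profile `t ↦ smoothRamp δ (exp (Λ t) - 1)`, to be evaluated at `t = 1 - ‖z‖²`. -/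
noncomputable def profile (Λ δ t : ℝ) : ℝ := smoothRamp δ (Real.exp (Λ * t) - 1)

/-- The slope of the truncation `smoothRamp δ`. -/
noncomputable def rampSlope (δ s : ℝ) : ℝ := smoothTransition ((s - δ) / δ)

/-- The first derivative of `profile`. -/
noncomputable def profileDeriv (Λ δ t : ℝ) : ℝ :=
  rampSlope δ (Real.exp (Λ * t) - 1) * (Λ * Real.exp (Λ * t))

/-- The second derivative of `profile`. -/
noncomputable def profileDeriv₂ (Λ δ t : ℝ) : ℝ :=
  deriv (rampSlope δ) (Real.exp (Λ * t) - 1) * (Λ * Real.exp (Λ * t)) ^ 2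
    + rampSlope δ (Real.exp (Λ * t) - 1) * (Λ ^ 2 * Real.exp (Λ * t))

variable {Λ δ : ℝ}

lemma hasDerivAt_exp_mul_sub_one (t : ℝ) :
    HasDerivAt (fun t => Real.exp (Λ * t) - 1) (Λ * Real.exp (Λ * t)) t := by
  have := (((hasDerivAt_id t).const_mul Λ).exp).sub_const 1
  refine this.congr_deriv ?_
  simp; ring

lemma hasDerivAt_profile (t : ℝ) : HasDerivAt (profile Λ δ) (profileDeriv Λ δ t) t :=
  (hasDerivAt_smoothRamp (δ := δ) _).comp t (hasDerivAt_exp_mul_sub_one t)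

lemma contDiff_rampSlope : ContDiff ℝ 1 (rampSlope δ) := contDiff_smoothTransition_div

lemma hasDerivAt_profileDeriv (t : ℝ) :
    HasDerivAt (profileDeriv Λ δ) (profileDeriv₂ Λ δ t) t := by
  have h1 := ((contDiff_rampSlope (δ := δ)).differentiable (by norm_num)
    (Real.exp (Λ * t) - 1)).hasDerivAt.comp t (hasDerivAt_exp_mul_sub_one (Λ := Λ) t)
  have h2 : HasDerivAt (fun t => Λ * Real.exp (Λ * t)) (Λ * (Λ * Real.exp (Λ * t))) t := by
    have := (hasDerivAt_exp_mul_sub_one (Λ := Λ) t).add_const 1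
    simpa using this.const_mul Λ
  refine (h1.mul h2).congr_deriv ?_
  simp only [profileDeriv₂, Function.comp_apply]
  ring

lemma deriv_rampSlope_nonneg (hδ : 0 < δ) (s : ℝ) : 0 ≤ deriv (rampSlope δ) s :=
  (monotone_smoothTransition_div hδ).deriv_nonneg

lemma rampSlope_nonneg (s : ℝ) : 0 ≤ rampSlope δ s := smoothTransition.nonneg _

lemma rampSlope_le_one (s : ℝ) : rampSlope δ s ≤ 1 := smoothTransition.le_one _

/-- The test function `smoothRamp δ (exp (Λ (1 - ‖z‖²)) - 1) ∏ ‖z - ξ k‖ ^ b k`, extended by zero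
outside the unit disc. -/
noncomputable def testFun (ξ : Fin m → ℂ) (b : Fin m → ℝ) (Λ δ : ℝ) (z : ℂ) : ℝ :=
  (ball (0 : ℂ) 1).indicator
    (fun z => profile Λ δ (1 - (z.re ^ 2 + z.im ^ 2)) * Real.exp (logProd ξ b z).re) z

lemma re_sq_add_im_sq (z : ℂ) : z.re ^ 2 + z.im ^ 2 = ‖z‖ ^ 2 := by
  rw [Complex.sq_norm, Complex.normSq_apply]; ring

lemma profile_of_le (hδ : 0 < δ) (hΛ : 0 < Λ) {t : ℝ} (ht : t ≤ Real.log (1 + δ) / Λ) :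
    profile Λ δ t = 0 := by
  refine smoothRamp_of_le hδ ?_
  rw [le_div_iff₀ hΛ, mul_comm] at ht
  have := Real.exp_le_exp.2 ht
  rw [Real.exp_log (by linarith)] at this
  linarith

lemma testFun_eq_zero (hδ : 0 < δ) (hΛ : 0 < Λ) {z : ℂ}
    (hz : 1 - ‖z‖ ^ 2 ≤ Real.log (1 + δ) / Λ) : testFun ξ b Λ δ z = 0 := by
  by_cases h : z ∈ ball (0 : ℂ) 1
  · rw [testFun, indicator_of_mem h, re_sq_add_im_sq, profile_of_le hδ hΛ hz, zero_mul]
  · rw [testFun, indicator_of_notMem h]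

lemma testFun_nonneg (hδ : 0 < δ) (z : ℂ) : 0 ≤ testFun ξ b Λ δ z :=
  indicator_nonneg (fun _ _ => mul_nonneg (smoothRamp_nonneg hδ _) (Real.exp_pos _).le) z

lemma contDiff_testFun (hξ : ∀ k, ‖ξ k‖ = 1) (hδ : 0 < δ) (hΛ : 0 < Λ) :
    ContDiff ℝ 2 (testFun ξ b Λ δ) := by
  rw [contDiff_iff_contDiffAt]
  intro z
  by_cases hz : z ∈ ball (0 : ℂ) 1
  · have h1 : testFun ξ b Λ δ =ᶠ[𝓝 z]
        fun z => profile Λ δ (1 - (z.re ^ 2 + z.im ^ 2)) * Real.exp (logProd ξ b z).re := by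
      filter_upwards [isOpen_ball.mem_nhds hz] with w hw
      rw [testFun, indicator_of_mem hw]
    refine ContDiffAt.congr_of_eventuallyEq ?_ h1
    have hL : ContDiffAt ℝ 2 (logProd ξ b) z := by
      have hd : DifferentiableOn ℂ (logProd ξ b) (ball 0 1) := fun w hw =>
        (hasDerivAt_logProd hξ (by simpa using hw)).differentiableAt.differentiableWithinAt
      exact ((hd.analyticAt (isOpen_ball.mem_nhds hz)).contDiffAt).restrict_scalars ℝ
    have hre : ContDiff ℝ 2 (fun z : ℂ => z.re) := Complex.reCLM.contDiff
    have him : ContDiff ℝ 2 (fun z : ℂ => z.im) := Complex.imCLM.contDiff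
    have hp : ContDiff ℝ 2 (profile Λ δ) :=
      contDiff_smoothRamp.comp (((contDiff_const.mul contDiff_id).exp).sub contDiff_const)
    have hn : ContDiff ℝ 2 fun z : ℂ => 1 - (z.re ^ 2 + z.im ^ 2) :=
      contDiff_const.sub ((hre.pow 2).add (him.pow 2))
    exact ((hp.comp hn).contDiffAt).mul ((hre.contDiffAt.comp z hL).exp)
  · have h1 : testFun ξ b Λ δ =ᶠ[𝓝 z] fun _ => 0 := by
      have hpos : 0 < Real.log (1 + δ) / Λ := div_pos (Real.log_pos (by linarith)) hΛ
      have hc : Continuous fun w : ℂ => 1 - ‖w‖ ^ 2 := by fun_prop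
      have : 1 - ‖z‖ ^ 2 < Real.log (1 + δ) / Λ := by
        have : 1 ≤ ‖z‖ := by simpa using hz
        nlinarith
      filter_upwards [hc.continuousAt.eventually_lt continuousAt_const this] with w hw
      exact testFun_eq_zero hδ hΛ hw.le
    exact contDiffAt_const.congr_of_eventuallyEq h1

lemma laplacian_testFun (hξ : ∀ k, ‖ξ k‖ = 1) (hδ : 0 < δ) (hΛ : 0 < Λ) {z : ℂ} (hz : ‖z‖ < 1) :
    Laplacian.laplacian (testFun ξ b Λ δ) z = (∏ k, ‖z - ξ k‖ ^ b k) *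
      (4 * ‖z‖ ^ 2 * profileDeriv₂ Λ δ (1 - ‖z‖ ^ 2) - 4 * profileDeriv Λ δ (1 - ‖z‖ ^ 2)
        - 4 * profileDeriv Λ δ (1 - ‖z‖ ^ 2) * (z * logProdDeriv ξ b z).re
        + profile Λ δ (1 - ‖z‖ ^ 2) * ‖logProdDeriv ξ b z‖ ^ 2) := by
  rw [← exp_re_logProd hξ hz]
  exact laplacian_radial_mul_exp (contDiff_testFun hξ hδ hΛ)
    (fun w hw => hasDerivAt_logProd hξ (by simpa using hw))
    (fun w hw => (differentiableAt_logProdDeriv hξ (by simpa using hw)).hasDerivAt)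
    hasDerivAt_profile hasDerivAt_profileDeriv
    (fun w hw => by rw [testFun, indicator_of_mem hw]) (by simpa using hz)

lemma profileDeriv_nonneg (hΛ : 0 < Λ) (t : ℝ) : 0 ≤ profileDeriv Λ δ t :=
  mul_nonneg (rampSlope_nonneg _) (by positivity)

lemma profileDeriv_le (hΛ : 0 < Λ) {t : ℝ} (ht : t ≤ 1) :
    profileDeriv Λ δ t ≤ Λ * Real.exp Λ := by
  have h1 : Λ * Real.exp (Λ * t) ≤ Λ * Real.exp Λ := by
    gcongr; nlinarith
  exact (mul_le_of_le_one_left (by positivity) (rampSlope_le_one _)).trans h1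

/-- The exponential makes the profile convex enough to absorb the first order terms. -/
lemma mul_profileDeriv_le_profileDeriv₂ (hδ : 0 < δ) (t : ℝ) :
    Λ * profileDeriv Λ δ t ≤ profileDeriv₂ Λ δ t := by
  have := mul_nonneg (deriv_rampSlope_nonneg hδ (Real.exp (Λ * t) - 1))
    (sq_nonneg (Λ * Real.exp (Λ * t)))
  rw [profileDeriv, profileDeriv₂]
  nlinarith

lemma prod_rpow_nonneg (z : ℂ) : 0 ≤ ∏ k, ‖z - ξ k‖ ^ b k :=
  Finset.prod_nonneg fun _ _ => by positivity

lemma prod_rpow_le (hξ : ∀ k, ‖ξ k‖ = 1) (hb : ∀ k, 0 ≤ b k) {z : ℂ} (hz : ‖z‖ < 1) :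
    ∏ k, ‖z - ξ k‖ ^ b k ≤ ∏ k, (2 : ℝ) ^ b k :=
  Finset.prod_le_prod (fun _ _ => by positivity) fun k _ =>
    Real.rpow_le_rpow (norm_nonneg _) (norm_sub_le_two (hξ k) hz) (hb k)

lemma laplacian_testFun_nonneg (hξ : ∀ k, ‖ξ k‖ = 1) (hb : ∀ k, 0 ≤ b k) (hδ : 0 < δ)
    (hΛ : Λ = 2 + ∑ k, b k) {z : ℂ} (hz : ‖z‖ < 1) (hz2 : 1 / 2 ≤ ‖z‖ ^ 2) :
    0 ≤ Laplacian.laplacian (testFun ξ b Λ δ) z := by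
  have hS : 0 ≤ ∑ k, b k := Finset.sum_nonneg fun k _ => hb k
  have hΛ0 : 0 < Λ := by rw [hΛ]; linarith
  rw [laplacian_testFun hξ hδ hΛ0 hz]
  refine mul_nonneg (prod_rpow_nonneg z) ?_
  have h1 := mul_profileDeriv_le_profileDeriv₂ (Λ := Λ) hδ (1 - ‖z‖ ^ 2)
  have h2 := profileDeriv_nonneg (δ := δ) hΛ0 (1 - ‖z‖ ^ 2)
  have h3 := re_mul_logProdDeriv_le hξ hb hz
  have h4 : 0 ≤ profile Λ δ (1 - ‖z‖ ^ 2) * ‖logProdDeriv ξ b z‖ ^ 2 :=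
    mul_nonneg (smoothRamp_nonneg hδ _) (sq_nonneg _)
  have h5 : profileDeriv Λ δ (1 - ‖z‖ ^ 2) * (z * logProdDeriv ξ b z).re
      ≤ profileDeriv Λ δ (1 - ‖z‖ ^ 2) * ((∑ k, b k) / 2) := mul_le_mul_of_nonneg_left h3 h2
  have h6 : 0 ≤ profileDeriv₂ Λ δ (1 - ‖z‖ ^ 2) := (mul_nonneg hΛ0.le h2).trans h1
  have h7 : (1 / 2) * profileDeriv₂ Λ δ (1 - ‖z‖ ^ 2)
      ≤ ‖z‖ ^ 2 * profileDeriv₂ Λ δ (1 - ‖z‖ ^ 2) := mul_le_mul_of_nonneg_right hz2 h6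
  rw [hΛ] at h1 h2 h4 h5 h6 h7 ⊢
  linarith

/-- A crude lower bound, used only on a compact part of the disc. -/
lemma neg_le_laplacian_testFun (hξ : ∀ k, ‖ξ k‖ = 1) (hb : ∀ k, 0 ≤ b k) (hδ : 0 < δ)
    (hΛ : Λ = 2 + ∑ k, b k) {z : ℂ} (hz : ‖z‖ < 1) :
    -((∏ k, (2 : ℝ) ^ b k) * (2 * Λ * (Λ * Real.exp Λ)))
      ≤ Laplacian.laplacian (testFun ξ b Λ δ) z := by
  have hS : 0 ≤ ∑ k, b k := Finset.sum_nonneg fun k _ => hb k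
  have hΛ0 : 0 < Λ := by rw [hΛ]; linarith
  rw [laplacian_testFun hξ hδ hΛ0 hz]
  have h1 := mul_profileDeriv_le_profileDeriv₂ (Λ := Λ) hδ (1 - ‖z‖ ^ 2)
  have h2 := profileDeriv_nonneg (δ := δ) hΛ0 (1 - ‖z‖ ^ 2)
  have h2' := profileDeriv_le (δ := δ) hΛ0 (t := 1 - ‖z‖ ^ 2) (by linarith [sq_nonneg ‖z‖])
  have h3 := re_mul_logProdDeriv_le hξ hb hz
  have h4 : 0 ≤ profile Λ δ (1 - ‖z‖ ^ 2) * ‖logProdDeriv ξ b z‖ ^ 2 :=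
    mul_nonneg (smoothRamp_nonneg hδ _) (sq_nonneg _)
  have h5 : profileDeriv Λ δ (1 - ‖z‖ ^ 2) * (z * logProdDeriv ξ b z).re
      ≤ profileDeriv Λ δ (1 - ‖z‖ ^ 2) * ((∑ k, b k) / 2) := mul_le_mul_of_nonneg_left h3 h2
  have h6 : 0 ≤ ‖z‖ ^ 2 * profileDeriv₂ Λ δ (1 - ‖z‖ ^ 2) :=
    mul_nonneg (sq_nonneg _) ((mul_nonneg hΛ0.le h2).trans h1)
  have h8 : Λ * profileDeriv Λ δ (1 - ‖z‖ ^ 2) ≤ Λ * (Λ * Real.exp Λ) :=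
    mul_le_mul_of_nonneg_left h2' hΛ0.le
  have hP := prod_rpow_le hξ hb hz
  have hP0 := prod_rpow_nonneg (ξ := ξ) (b := b) z
  have h9 : -(2 * Λ * (Λ * Real.exp Λ)) ≤
      4 * ‖z‖ ^ 2 * profileDeriv₂ Λ δ (1 - ‖z‖ ^ 2) - 4 * profileDeriv Λ δ (1 - ‖z‖ ^ 2)
        - 4 * profileDeriv Λ δ (1 - ‖z‖ ^ 2) * (z * logProdDeriv ξ b z).re
        + profile Λ δ (1 - ‖z‖ ^ 2) * ‖logProdDeriv ξ b z‖ ^ 2 := by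
    have h10 : ∀ x : ℝ, Λ * x = 2 * x + (∑ k, b k) * x := fun x => by rw [hΛ]; ring
    have h10' := h10 (profileDeriv Λ δ (1 - ‖z‖ ^ 2))
    linarith
  have h11 : 0 ≤ 2 * Λ * (Λ * Real.exp Λ) := by positivity
  have h12 := mul_le_mul_of_nonneg_left h9 hP0
  have h13 := mul_le_mul_of_nonneg_right hP h11
  linarith

/-- The upper bound for the Laplacian of the test function. The term with `deriv (rampSlope δ)`
carries the boundary mass as `δ → 0`. -/
lemma laplacian_testFun_le (hξ : ∀ k, ‖ξ k‖ = 1) (hb : ∀ k, 0 ≤ b k) (hδ : 0 < δ)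
    (hΛ : Λ = 2 + ∑ k, b k) {z : ℂ} (hz : ‖z‖ < 1) :
    Laplacian.laplacian (testFun ξ b Λ δ) z ≤ 4 * Λ ^ 2 * Real.exp Λ ^ 2 *
      (∏ k, ‖z - ξ k‖ ^ b k) *
        (deriv (rampSlope δ) (Real.exp (Λ * (1 - ‖z‖ ^ 2)) - 1) + 1 + ∑ k, b k / ‖z - ξ k‖) := by
  have hS : 0 ≤ ∑ k, b k := Finset.sum_nonneg fun k _ => hb k
  have hΛ0 : 0 < Λ := by rw [hΛ]; linarith
  have hΛ2 : 2 ≤ Λ := by rw [hΛ]; linarith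
  rw [laplacian_testFun hξ hδ hΛ0 hz]
  set t := 1 - ‖z‖ ^ 2 with ht
  set X := deriv (rampSlope δ) (Real.exp (Λ * t) - 1) with hX
  set D := ∑ k, b k / ‖z - ξ k‖ with hD
  set e := Real.exp Λ with he
  have he1 : 1 ≤ e := Real.one_le_exp hΛ0.le
  have hX0 : 0 ≤ X := deriv_rampSlope_nonneg hδ _
  have hD0 : 0 ≤ D := Finset.sum_nonneg fun k _ => div_nonneg (hb k) (norm_nonneg _)
  have ht1 : t ≤ 1 := by rw [ht]; linarith [sq_nonneg ‖z‖]
  have ht0 : 0 ≤ t := by rw [ht]; nlinarith [norm_nonneg z]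
  have hexp : Real.exp (Λ * t) ≤ e := Real.exp_le_exp.2 (by nlinarith)
  have hexp0 : 0 < Real.exp (Λ * t) := Real.exp_pos _
  have hz2 : ‖z‖ ^ 2 ≤ 1 := by rw [ht] at ht0; linarith
  have hℓ := norm_logProdDeriv_le hξ hb z
  rw [← hD] at hℓ
  have h1 : 4 * ‖z‖ ^ 2 * profileDeriv₂ Λ δ t ≤ 4 * (X * (Λ ^ 2 * e ^ 2) + Λ ^ 2 * e ^ 2) := by
    have ha : profileDeriv₂ Λ δ t ≤ X * (Λ ^ 2 * e ^ 2) + Λ ^ 2 * e ^ 2 := by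
      rw [profileDeriv₂]
      refine add_le_add (mul_le_mul_of_nonneg_left ?_ hX0) ?_
      · rw [mul_pow]; gcongr
      · refine (mul_le_of_le_one_left (by positivity) (rampSlope_le_one _)).trans ?_
        have : e ≤ e ^ 2 := by nlinarith
        gcongr
        exact hexp.trans this
    have hb' : 0 ≤ profileDeriv₂ Λ δ t :=
      (mul_nonneg hΛ0.le (profileDeriv_nonneg hΛ0 t)).trans (mul_profileDeriv_le_profileDeriv₂ hδ t)
    nlinarith
  have h2 := profileDeriv_nonneg (δ := δ) hΛ0 t
  have h2' := profileDeriv_le (δ := δ) hΛ0 ht1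
  have h3 : -(profileDeriv Λ δ t * (z * logProdDeriv ξ b z).re) ≤ Λ * e * D := by
    have hr : -(z * logProdDeriv ξ b z).re ≤ D := by
      refine (neg_le_abs _).trans ((Complex.abs_re_le_norm _).trans ?_)
      rw [norm_mul]
      calc ‖z‖ * ‖logProdDeriv ξ b z‖ ≤ 1 * D := by gcongr
        _ = D := one_mul _
    calc -(profileDeriv Λ δ t * (z * logProdDeriv ξ b z).re)
        = profileDeriv Λ δ t * (-(z * logProdDeriv ξ b z).re) := by ring
      _ ≤ profileDeriv Λ δ t * D := by gcongr
      _ ≤ Λ * e * D := by gcongr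
  have h4 : profile Λ δ t * ‖logProdDeriv ξ b z‖ ^ 2 ≤ 2 * Λ ^ 2 * e * D := by
    have hp1 : profile Λ δ t ≤ Λ * e * t := by
      have hs0 : 0 ≤ Real.exp (Λ * t) - 1 := by
        have := Real.one_le_exp (mul_nonneg hΛ0.le ht0); linarith
      refine (smoothRamp_le hs0).trans ?_
      have h := Real.one_sub_le_exp_neg (Λ * t)
      have hmul : Real.exp (Λ * t) * Real.exp (-(Λ * t)) = 1 := by rw [← Real.exp_add]; simp
      have : Real.exp (Λ * t) * (1 - Λ * t) ≤ 1 := by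
        exact (mul_le_mul_of_nonneg_left h hexp0.le).trans_eq hmul
      have h5 : Real.exp (Λ * t) * (Λ * t) ≤ e * (Λ * t) := by gcongr
      linarith
    have ht2 : t ≤ 2 * (1 - ‖z‖) := by rw [ht]; nlinarith [norm_nonneg z]
    have hDt : (1 - ‖z‖) * D ≤ Λ := by
      rw [hD, Finset.mul_sum]
      calc ∑ k, (1 - ‖z‖) * (b k / ‖z - ξ k‖) ≤ ∑ k, b k := by
            refine Finset.sum_le_sum fun k _ => ?_
            rw [← mul_div_assoc, div_le_iff₀ (norm_sub_pos_of_norm_lt (hξ k) hz), mul_comm]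
            exact mul_le_mul_of_nonneg_left (one_sub_norm_le_norm_sub (hξ k) z) (hb k)
        _ ≤ Λ := by rw [hΛ]; linarith
    have hsq : ‖logProdDeriv ξ b z‖ ^ 2 ≤ D ^ 2 := by gcongr
    calc profile Λ δ t * ‖logProdDeriv ξ b z‖ ^ 2 ≤ (Λ * e * t) * D ^ 2 :=
          mul_le_mul hp1 hsq (sq_nonneg _) (by positivity)
      _ ≤ (Λ * e * (2 * (1 - ‖z‖))) * D ^ 2 := by gcongr
      _ = (2 * Λ * e * D) * ((1 - ‖z‖) * D) := by ring
      _ ≤ (2 * Λ * e * D) * Λ := by gcongr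
      _ = 2 * Λ ^ 2 * e * D := by ring
  have hfin : 4 * ‖z‖ ^ 2 * profileDeriv₂ Λ δ t - 4 * profileDeriv Λ δ t
        - 4 * profileDeriv Λ δ t * (z * logProdDeriv ξ b z).re
        + profile Λ δ t * ‖logProdDeriv ξ b z‖ ^ 2 ≤ 4 * Λ ^ 2 * e ^ 2 * (X + 1 + D) := by
    have h5 : Λ * e * D ≤ Λ ^ 2 / 2 * e ^ 2 * D := by
      have : Λ * e ≤ Λ ^ 2 / 2 * e ^ 2 := by
        have h6 : Λ ≤ Λ ^ 2 / 2 := by nlinarith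
        have h7 : e ≤ e ^ 2 := by nlinarith
        exact mul_le_mul h6 h7 (by positivity) (by positivity)
      gcongr
    have h6 : 2 * Λ ^ 2 * e * D ≤ 2 * Λ ^ 2 * e ^ 2 * D := by
      have h7 : e ≤ e ^ 2 := by nlinarith
      gcongr
    nlinarith
  have := mul_le_mul_of_nonneg_left hfin (prod_rpow_nonneg (ξ := ξ) (b := b) z)
  linarith

end TestFunction

/-! ### Products of powers of distances to points of the circle -/

section Products

variable {m : ℕ} {ξ : Fin m → ℂ}

/-- Of two factors with distinct poles at most one is large. -/
lemma rpow_neg_mul_rpow_neg_le {x y z : ℂ} (hxy : x ≠ y) {s t : ℝ} (hs : 0 ≤ s) (ht : 0 ≤ t)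
    (hx : 0 < ‖z - x‖) (hy : 0 < ‖z - y‖) :
    ‖z - x‖ ^ (-s) * ‖z - y‖ ^ (-t)
      ≤ ((‖x - y‖ / 2) ^ (-s) + (‖x - y‖ / 2) ^ (-t)) * (‖z - x‖ ^ (-s) + ‖z - y‖ ^ (-t)) := by
  have he : 0 < ‖x - y‖ / 2 := by
    have := norm_pos_iff.2 (sub_ne_zero.2 hxy); linarith
  set A := (‖x - y‖ / 2) ^ (-s)
  set B := (‖x - y‖ / 2) ^ (-t)
  have hA : 0 ≤ A := by positivity
  have hB : 0 ≤ B := by positivity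
  have hX : 0 ≤ ‖z - x‖ ^ (-s) := by positivity
  have hY : 0 ≤ ‖z - y‖ ^ (-t) := by positivity
  have htri : ‖x - y‖ ≤ ‖z - x‖ + ‖z - y‖ := by
    have := norm_sub_le (z - y) (z - x)
    rw [sub_sub_sub_cancel_left] at this
    linarith
  rcases le_total (‖x - y‖ / 2) ‖z - x‖ with h | h
  · have h1 : ‖z - x‖ ^ (-s) ≤ A := Real.rpow_le_rpow_of_nonpos he h (by linarith)
    nlinarith [mul_le_mul_of_nonneg_right h1 hY, mul_nonneg hA hX, mul_nonneg hB hX,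
      mul_nonneg hB hY]
  · have h1 : ‖z - y‖ ^ (-t) ≤ B :=
      Real.rpow_le_rpow_of_nonpos he (by linarith) (by linarith)
    nlinarith [mul_le_mul_of_nonneg_left h1 hX, mul_nonneg hA hX, mul_nonneg hA hY,
      mul_nonneg hB hY]

/-- A product of negative powers with distinct poles is dominated by the sum of its factors. -/
lemma exists_prod_rpow_neg_le (hξ : ∀ k, ‖ξ k‖ = 1) (hinj : Function.Injective ξ)
    {s : Fin m → ℝ} (hs : ∀ k, 0 ≤ s k) :
    ∃ C : ℝ, 0 < C ∧ ∀ z : ℂ, ‖z‖ < 1 →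
      ∏ k, ‖z - ξ k‖ ^ (-s k) ≤ C * (1 + ∑ k, ‖z - ξ k‖ ^ (-s k)) := by
  suffices h : ∀ S : Finset (Fin m), ∃ C : ℝ, 0 < C ∧ ∀ z : ℂ, ‖z‖ < 1 →
      ∏ k ∈ S, ‖z - ξ k‖ ^ (-s k) ≤ C * (1 + ∑ k ∈ S, ‖z - ξ k‖ ^ (-s k)) from h Finset.univ
  intro S
  induction S using Finset.induction_on with
  | empty => exact ⟨1, one_pos, fun z _ => by simp⟩
  | insert a S ha ih =>
    obtain ⟨C, hC, h⟩ := ih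
    set M : ℝ := ∑ k ∈ S, ((‖ξ a - ξ k‖ / 2) ^ (-s a) + (‖ξ a - ξ k‖ / 2) ^ (-s k)) with hM
    have hM0 : 0 ≤ M := Finset.sum_nonneg fun k _ => by positivity
    refine ⟨C * (1 + (S.card + 1) * M), by positivity, fun z hz => ?_⟩
    rw [Finset.prod_insert ha, Finset.sum_insert ha]
    set X := ‖z - ξ a‖ ^ (-s a) with hX
    have hX0 : 0 ≤ X := by positivity
    set T := ∑ k ∈ S, ‖z - ξ k‖ ^ (-s k) with hT
    have hT0 : 0 ≤ T := Finset.sum_nonneg fun k _ => by positivity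
    have h1 : X * T ≤ (S.card + 1) * M * (X + T) := by
      rw [hT, Finset.mul_sum]
      calc ∑ k ∈ S, X * ‖z - ξ k‖ ^ (-s k) ≤ ∑ _k ∈ S, M * (X + T) := by
            refine Finset.sum_le_sum fun k hk => ?_
            have hne : ξ a ≠ ξ k := fun h => ha (hinj h ▸ hk)
            refine (rpow_neg_mul_rpow_neg_le hne (hs a) (hs k)
              (norm_sub_pos_of_norm_lt (hξ a) hz) (norm_sub_pos_of_norm_lt (hξ k) hz)).trans ?_
            refine mul_le_mul ?_ ?_ (by positivity) hM0
            · exact Finset.single_le_sum (f := fun k =>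
                (‖ξ a - ξ k‖ / 2) ^ (-s a) + (‖ξ a - ξ k‖ / 2) ^ (-s k))
                (fun k _ => by positivity) hk
            · refine add_le_add le_rfl ?_
              exact Finset.single_le_sum (f := fun k => ‖z - ξ k‖ ^ (-s k))
                (fun k _ => by positivity) hk
        _ = S.card * M * (X + T) := by rw [Finset.sum_const, nsmul_eq_mul]; ring
        _ ≤ (S.card + 1) * M * (X + T) := by gcongr; linarith
    have h2 := mul_le_mul_of_nonneg_left (h z hz) hX0
    have h3 := mul_le_mul_of_nonneg_left h1 hC.le
    have h4 : 0 ≤ C * ((S.card + 1) * M) := by positivity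
    nlinarith

lemma measurable_norm_sub_rpow (x : ℂ) (a : ℝ) : Measurable fun z : ℂ => ‖z - x‖ ^ a := by
  fun_prop

/-! ### Integrals of powers of distances -/

lemma lintegral_ball_norm_rpow_lt_top {a : ℝ} (ha : a < 2) :
    ∫⁻ z in ball (0 : ℂ) 2, ENNReal.ofReal (‖z‖ ^ (-a)) < ∞ := by
  rw [lintegral_ball_eq_polar _ (by fun_prop)]
  have h1 : ∫⁻ r in Ioo (0 : ℝ) 2, ENNReal.ofReal r *
      ∫⁻ θ in Ioo (-π) π, ENNReal.ofReal (‖circleMap 0 r θ‖ ^ (-a))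
      = ∫⁻ r in Ioo (0 : ℝ) 2, ENNReal.ofReal (r ^ (1 - a)) * ENNReal.ofReal (2 * π) := by
    refine setLIntegral_congr_fun measurableSet_Ioo fun r hr => ?_
    simp only [norm_circleMap_zero, abs_of_pos hr.1]
    rw [setLIntegral_const, Real.volume_Ioo, ← mul_assoc, ← ENNReal.ofReal_mul hr.1.le]
    congr 2
    · rw [sub_eq_add_neg 1 a, Real.rpow_add hr.1, Real.rpow_one]
    · ring
  rw [h1, lintegral_mul_const _ (by fun_prop)]
  refine ENNReal.mul_lt_top ?_ ENNReal.ofReal_lt_top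
  have h2 : IntervalIntegrable (fun r : ℝ => r ^ (1 - a)) volume 0 2 :=
    intervalIntegral.intervalIntegrable_rpow' (by linarith)
  have h3 : IntegrableOn (fun r : ℝ => r ^ (1 - a)) (Ioo 0 2) :=
    ((intervalIntegrable_iff_integrableOn_Ioc_of_le two_pos.le).1 h2).mono_set Ioo_subset_Ioc_self
  exact h3.lintegral_lt_top

lemma integrableOn_norm_sub_rpow {x : ℂ} (hx : ‖x‖ = 1) {a : ℝ} (ha : a < 2) :
    IntegrableOn (fun z => ‖z - x‖ ^ (-a)) (ball (0 : ℂ) 1) := by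
  refine ⟨(measurable_norm_sub_rpow x _).aestronglyMeasurable, ?_⟩
  rw [hasFiniteIntegral_iff_ofReal (Eventually.of_forall fun z => by positivity)]
  refine lt_of_le_of_lt ?_ (lintegral_ball_norm_rpow_lt_top ha)
  rw [← lintegral_indicator measurableSet_ball, ← lintegral_indicator measurableSet_ball,
    ← lintegral_sub_right_eq_self
      ((ball (0 : ℂ) 2).indicator fun z => ENNReal.ofReal (‖z‖ ^ (-a))) x]
  refine lintegral_mono fun z => ?_
  by_cases hz : z ∈ ball (0 : ℂ) 1
  · rw [indicator_of_mem hz, indicator_of_mem]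
    rw [mem_ball_zero_iff] at hz ⊢
    linarith [norm_sub_le z x]
  · rw [indicator_of_notMem hz]; exact zero_le

lemma integrableOn_prod_rpow_neg (hξ : ∀ k, ‖ξ k‖ = 1) (hinj : Function.Injective ξ)
    {s : Fin m → ℝ} (hs : ∀ k, 0 ≤ s k) (hs2 : ∀ k, s k < 2) :
    IntegrableOn (fun z => ∏ k, ‖z - ξ k‖ ^ (-s k)) (ball (0 : ℂ) 1) := by
  obtain ⟨C, hC, h⟩ := exists_prod_rpow_neg_le hξ hinj hs
  have hi : IntegrableOn (fun z => C * (1 + ∑ k, ‖z - ξ k‖ ^ (-s k))) (ball (0 : ℂ) 1) :=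
    ((integrableOn_const measure_ball_lt_top.ne).add
      (integrable_finsetSum _ fun k _ => integrableOn_norm_sub_rpow (hξ k) (hs2 k))).const_mul C
  refine hi.mono' ?_ ?_
  · exact (Finset.measurable_fun_prod _ fun k _ =>
      measurable_norm_sub_rpow (ξ k) _).aestronglyMeasurable
  · refine (ae_restrict_iff' measurableSet_ball).2 (Eventually.of_forall fun z hz => ?_)
    rw [norm_of_nonneg (prod_rpow_nonneg z)]
    exact h z (by simpa using hz)

/-- Distance from a point near the circle to the point `1`. -/
lemma abs_le_norm_circleMap_sub_one {r θ : ℝ} (hr : r ∈ Ioo (0 : ℝ) 1) (hθ : θ ∈ Ioo (-π) π) :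
    |θ| / π ≤ ‖circleMap 0 r θ - 1‖ := by
  have h1 : 2 / π * |θ| ≤ ‖circleMap 0 1 θ - 1‖ := by
    have : circleMap 0 1 θ = Complex.exp (Complex.I * θ) := by simp [circleMap, mul_comm]
    rw [this, Complex.norm_exp_I_mul_ofReal_sub_one]
    have h2 := Real.mul_abs_le_abs_sin (x := θ / 2) (by
      rw [abs_div, abs_two]; have := abs_lt.2 hθ; linarith)
    rw [abs_div, abs_two] at h2
    rw [norm_mul, norm_eq_abs, norm_eq_abs, abs_two]
    have h3 : 2 / π * (|θ| / 2) = 2 / π * |θ| / 2 := by ring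
    rw [h3] at h2
    linarith
  have h2 : ‖circleMap 0 1 θ - circleMap 0 r θ‖ = 1 - r := by
    have : circleMap 0 1 θ - circleMap 0 r θ = ((1 - r : ℝ) : ℂ) * Complex.exp (θ * Complex.I) := by
      simp [circleMap]; ring
    rw [this, norm_mul, Complex.norm_exp_ofReal_mul_I, mul_one, Complex.norm_real,
      norm_of_nonneg (by linarith [hr.2])]
  have h3 : 1 - r ≤ ‖circleMap 0 r θ - 1‖ := by
    have := one_sub_norm_le_norm_sub (x := 1) (by simp) (circleMap 0 r θ)
    rwa [norm_circleMap_zero, abs_of_pos hr.1] at this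
  have h4 : ‖circleMap 0 1 θ - 1‖ ≤ (1 - r) + ‖circleMap 0 r θ - 1‖ := by
    rw [← h2]; exact norm_sub_le_norm_sub_add_norm_sub _ _ _
  have h5 : 2 / π * |θ| = 2 * (|θ| / π) := by ring
  linarith

/-- The circle integrals of `‖z - 1‖ ^ (-s)`, `s < 1`, are bounded uniformly in the radius. -/
lemma exists_lintegral_circle_le {s : ℝ} (hs0 : 0 ≤ s) (hs : s < 1) :
    ∃ C : ℝ, 0 ≤ C ∧ ∀ r ∈ Ioo (0 : ℝ) 1,
      ∫⁻ θ in Ioo (-π) π, ENNReal.ofReal (‖circleMap 0 r θ - 1‖ ^ (-s)) ≤ ENNReal.ofReal C := by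
  have hi : IntegrableOn (fun θ : ℝ => (|θ| / π) ^ (-s)) (Ioo (-π) π) := by
    have h1 : IntegrableOn (fun θ : ℝ => (|θ| / π) ^ (-s)) (Ioc 0 π) := by
      have h2 : IntervalIntegrable (fun r : ℝ => r ^ (-s)) volume 0 π :=
        intervalIntegral.intervalIntegrable_rpow' (by linarith)
      have h3 := (intervalIntegrable_iff_integrableOn_Ioc_of_le pi_pos.le).1 h2
      refine IntegrableOn.congr_fun (h3.mul_const (π ^ (-s))⁻¹) (fun x hx => ?_) measurableSet_Ioc
      rw [abs_of_pos hx.1, Real.div_rpow hx.1.le pi_pos.le, div_eq_mul_inv]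
    have h2 : IntegrableOn (fun θ : ℝ => (|θ| / π) ^ (-s)) (Ico (-π) 0) := by
      have := h1.comp_neg
      simpa using this
    refine (h2.union (h1.union (integrableOn_singleton (x := 0) (by simp) (by simp)))).mono_set ?_
    intro x hx
    rcases lt_trichotomy x 0 with h | h | h
    · exact Or.inl ⟨hx.1.le, h⟩
    · exact Or.inr (Or.inr h)
    · exact Or.inr (Or.inl ⟨h, hx.2.le⟩)
  refine ⟨∫ θ in Ioo (-π) π, (|θ| / π) ^ (-s), integral_nonneg fun θ => by positivity,
    fun r hr => ?_⟩
  rw [ofReal_integral_eq_lintegral_ofReal hi (Eventually.of_forall fun θ => by positivity)]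
  refine lintegral_mono_ae ?_
  have h0 : ∀ᵐ θ : ℝ ∂volume.restrict (Ioo (-π) π), θ ≠ 0 := by
    refine ae_restrict_of_ae ?_
    exact Measure.ae_ne volume 0
  filter_upwards [h0, ae_restrict_mem measurableSet_Ioo] with θ hθ0 hθ
  refine ENNReal.ofReal_le_ofReal ?_
  exact Real.rpow_le_rpow_of_nonpos (by positivity) (abs_le_norm_circleMap_sub_one hr hθ)
    (by linarith)

/-- The total mass of the boundary layer is bounded uniformly in its width `δ`. -/
lemma lintegral_deriv_rampSlope_le {Λ δ : ℝ} (hΛ : 1 ≤ Λ) (hδ : 0 < δ) :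
    ∫⁻ r in Ioo (0 : ℝ) 1, ENNReal.ofReal (r * deriv (rampSlope δ) (Real.exp (Λ * (1 - r ^ 2)) - 1))
      ≤ 1 := by
  have hd : ∀ r : ℝ, HasDerivAt (fun r => -rampSlope δ (Real.exp (Λ * (1 - r ^ 2)) - 1))
      (deriv (rampSlope δ) (Real.exp (Λ * (1 - r ^ 2)) - 1) *
        (2 * Λ * r * Real.exp (Λ * (1 - r ^ 2)))) r := by
    intro r
    have h1 : HasDerivAt (fun r : ℝ => 1 - r ^ 2) (-(2 * r)) r := by
      simpa using (hasDerivAt_pow 2 r).const_sub 1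
    have h2 := ((contDiff_rampSlope (δ := δ)).differentiable (by norm_num)
      (Real.exp (Λ * (1 - r ^ 2)) - 1)).hasDerivAt.comp r
      ((hasDerivAt_exp_mul_sub_one (Λ := Λ) (1 - r ^ 2)).comp r h1)
    refine h2.neg.congr_deriv ?_
    ring
  have hcd : Continuous (deriv (rampSlope δ)) :=
    (contDiff_rampSlope (δ := δ)).continuous_deriv (by norm_num)
  have hcont : Continuous fun r : ℝ => deriv (rampSlope δ) (Real.exp (Λ * (1 - r ^ 2)) - 1) *
        (2 * Λ * r * Real.exp (Λ * (1 - r ^ 2))) := by fun_prop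
  have hint := intervalIntegral.integral_eq_sub_of_hasDerivAt (a := 0) (b := 1)
    (fun r _ => hd r) (hcont.intervalIntegrable _ _)
  have hle : ∫ r in (0 : ℝ)..1, deriv (rampSlope δ) (Real.exp (Λ * (1 - r ^ 2)) - 1) *
        (2 * Λ * r * Real.exp (Λ * (1 - r ^ 2))) ≤ 1 := by
    rw [hint]
    linarith [rampSlope_nonneg (δ := δ) (Real.exp (Λ * (1 - 1 ^ 2)) - 1),
      rampSlope_le_one (δ := δ) (Real.exp (Λ * (1 - 0 ^ 2)) - 1)]
  rw [intervalIntegral.integral_of_le zero_le_one, integral_Ioc_eq_integral_Ioo] at hle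
  have hio : IntegrableOn (fun r : ℝ => deriv (rampSlope δ) (Real.exp (Λ * (1 - r ^ 2)) - 1) *
        (2 * Λ * r * Real.exp (Λ * (1 - r ^ 2)))) (Ioo 0 1) :=
    (hcont.integrableOn_Icc (a := 0) (b := 1)).mono_set Ioo_subset_Icc_self
  have hpt : ∀ r ∈ Ioo (0 : ℝ) 1, r * deriv (rampSlope δ) (Real.exp (Λ * (1 - r ^ 2)) - 1)
      ≤ deriv (rampSlope δ) (Real.exp (Λ * (1 - r ^ 2)) - 1) *
        (2 * Λ * r * Real.exp (Λ * (1 - r ^ 2))) := by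
    intro r hr
    have h1 : 1 ≤ Real.exp (Λ * (1 - r ^ 2)) :=
      Real.one_le_exp (mul_nonneg (by linarith) (by nlinarith [hr.1, hr.2]))
    have h2 := deriv_rampSlope_nonneg hδ (Real.exp (Λ * (1 - r ^ 2)) - 1)
    rw [mul_comm]
    refine mul_le_mul_of_nonneg_left ?_ h2
    have h3 : r * 1 ≤ r * Real.exp (Λ * (1 - r ^ 2)) := mul_le_mul_of_nonneg_left h1 hr.1.le
    have h4 : 0 ≤ r * Real.exp (Λ * (1 - r ^ 2)) := by linarith [hr.1]
    nlinarith
  calc _ ≤ ∫⁻ r in Ioo (0 : ℝ) 1, ENNReal.ofReal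
        (deriv (rampSlope δ) (Real.exp (Λ * (1 - r ^ 2)) - 1) *
        (2 * Λ * r * Real.exp (Λ * (1 - r ^ 2)))) :=
        setLIntegral_mono' measurableSet_Ioo fun r hr => ENNReal.ofReal_le_ofReal (hpt r hr)
    _ = ENNReal.ofReal (∫ r in Ioo (0 : ℝ) 1, deriv (rampSlope δ)
        (Real.exp (Λ * (1 - r ^ 2)) - 1) * (2 * Λ * r * Real.exp (Λ * (1 - r ^ 2)))) := by
        rw [ofReal_integral_eq_lintegral_ofReal hio]
        refine (ae_restrict_iff' measurableSet_Ioo).2 (Eventually.of_forall fun r hr => ?_)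
        exact (mul_nonneg hr.1.le (deriv_rampSlope_nonneg hδ _)).trans (hpt r hr)
    _ ≤ 1 := by rw [← ENNReal.ofReal_one]; exact ENNReal.ofReal_le_ofReal hle

end Products

/-! ### The boundary layer -/

section BoundaryLayer

variable {m : ℕ} {ξ : Fin m → ℂ}

lemma continuous_deriv_rampSlope {δ : ℝ} : Continuous (deriv (rampSlope δ)) :=
  contDiff_rampSlope.continuous_deriv (by norm_num)

lemma continuous_deriv_rampSlope_comp (Λ δ : ℝ) :
    Continuous fun z : ℂ => deriv (rampSlope δ) (Real.exp (Λ * (1 - ‖z‖ ^ 2)) - 1) :=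
  continuous_deriv_rampSlope.comp (by fun_prop)

/-- Integrals over the boundary layer are controlled by circle integrals, uniformly in its width. -/
lemma exists_lintegral_layer_le {x : ℂ} (hx : ‖x‖ = 1) {s : ℝ} (hs0 : 0 ≤ s) (hs : s < 1) :
    ∃ C : ℝ, 0 ≤ C ∧ ∀ Λ δ : ℝ, 1 ≤ Λ → 0 < δ →
      ∫⁻ z in ball (0 : ℂ) 1, ENNReal.ofReal
        (deriv (rampSlope δ) (Real.exp (Λ * (1 - ‖z‖ ^ 2)) - 1) * ‖z - x‖ ^ (-s))
        ≤ ENNReal.ofReal C := by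
  obtain ⟨C, hC, h⟩ := exists_lintegral_circle_le hs0 hs
  refine ⟨C, hC, fun Λ δ hΛ hδ => ?_⟩
  have hX := (continuous_deriv_rampSlope_comp Λ δ).measurable
  set X : ℂ → ℝ := fun z => deriv (rampSlope δ) (Real.exp (Λ * (1 - ‖z‖ ^ 2)) - 1) with hXdef
  have hFm : ∀ y : ℂ, Measurable fun z => ENNReal.ofReal (X z * ‖z - y‖ ^ (-s)) := fun y =>
    (hX.mul (measurable_norm_sub_rpow y _)).ennreal_ofReal
  -- rotate the pole to the point `1`
  have hrot : ∫⁻ z in ball (0 : ℂ) 1, ENNReal.ofReal (X z * ‖z - x‖ ^ (-s))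
      = ∫⁻ z in ball (0 : ℂ) 1, ENNReal.ofReal (X z * ‖z - 1‖ ^ (-s)) := by
    rw [← lintegral_indicator measurableSet_ball, ← lintegral_indicator measurableSet_ball]
    obtain ⟨c, rfl⟩ : ∃ c : Circle, (c : ℂ) = x :=
      ⟨⟨x, by simp [Submonoid.unitSphere, hx]⟩, rfl⟩
    have hm := (rotation c).measurePreserving
    rw [← hm.lintegral_comp ((hFm c).indicator measurableSet_ball)]
    refine lintegral_congr fun z => ?_
    have hn : ‖(c : ℂ) * z‖ = ‖z‖ := by rw [norm_mul, hx, one_mul]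
    have hn2 : ‖(c : ℂ) * z - c‖ = ‖z - 1‖ := by
      rw [show (c : ℂ) * z - c = c * (z - 1) by ring, norm_mul, hx, one_mul]
    simp only [rotation_apply, indicator, mem_ball_zero_iff, hn, hn2, hXdef]
  rw [hrot, lintegral_ball_eq_polar _ (hFm 1)]
  calc _ ≤ ∫⁻ r in Ioo (0 : ℝ) 1, ENNReal.ofReal
        (r * deriv (rampSlope δ) (Real.exp (Λ * (1 - r ^ 2)) - 1)) * ENNReal.ofReal C := by
        refine setLIntegral_mono' measurableSet_Ioo fun r hr => ?_
        have hXr : ∀ θ, X (circleMap 0 r θ)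
            = deriv (rampSlope δ) (Real.exp (Λ * (1 - r ^ 2)) - 1) := fun θ => by
          simp only [hXdef, norm_circleMap_zero, abs_of_pos hr.1]
        have hnn := deriv_rampSlope_nonneg hδ (Real.exp (Λ * (1 - r ^ 2)) - 1)
        simp only [hXr, ENNReal.ofReal_mul hnn]
        rw [lintegral_const_mul _ (by fun_prop), ENNReal.ofReal_mul hr.1.le, mul_assoc]
        gcongr
        exact h r hr
    _ ≤ 1 * ENNReal.ofReal C := by
        rw [lintegral_mul_const _ (by
          refine Measurable.ennreal_ofReal (measurable_id.mul ?_)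
          exact (continuous_deriv_rampSlope.comp (by fun_prop)).measurable)]
        gcongr
        exact lintegral_deriv_rampSlope_le hΛ hδ
    _ = _ := one_mul _

lemma integrableOn_layer_mul {Λ δ : ℝ} {F : ℂ → ℝ} (hF : IntegrableOn F (ball (0 : ℂ) 1)) :
    IntegrableOn (fun z => deriv (rampSlope δ) (Real.exp (Λ * (1 - ‖z‖ ^ 2)) - 1) * F z)
      (ball (0 : ℂ) 1) := by
  obtain ⟨B, hB⟩ := (isCompact_closedBall (0 : ℂ) 1).exists_bound_of_continuousOn
    (continuous_deriv_rampSlope_comp Λ δ).continuousOn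
  refine Integrable.bdd_mul (c := B) hF
    (continuous_deriv_rampSlope_comp Λ δ).aestronglyMeasurable ?_
  exact (ae_restrict_iff' measurableSet_ball).2 (Eventually.of_forall fun z hz =>
    hB z (ball_subset_closedBall hz))

lemma exists_integral_layer_le {x : ℂ} (hx : ‖x‖ = 1) {s : ℝ} (hs0 : 0 ≤ s) (hs : s < 1) :
    ∃ C : ℝ, 0 ≤ C ∧ ∀ Λ δ : ℝ, 1 ≤ Λ → 0 < δ →
      ∫ z in ball (0 : ℂ) 1,
        deriv (rampSlope δ) (Real.exp (Λ * (1 - ‖z‖ ^ 2)) - 1) * ‖z - x‖ ^ (-s) ≤ C := by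
  obtain ⟨C, hC, h⟩ := exists_lintegral_layer_le hx hs0 hs
  refine ⟨C, hC, fun Λ δ hΛ hδ => ?_⟩
  have := h Λ δ hΛ hδ
  rw [← ofReal_integral_eq_lintegral_ofReal] at this
  · exact (ENNReal.ofReal_le_ofReal_iff hC).1 this
  · exact integrableOn_layer_mul (integrableOn_norm_sub_rpow hx (by linarith))
  · exact Eventually.of_forall fun z => mul_nonneg (deriv_rampSlope_nonneg hδ _) (by positivity)

lemma exists_integral_layer_prod_le (hξ : ∀ k, ‖ξ k‖ = 1) (hinj : Function.Injective ξ)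
    {s : Fin m → ℝ} (hs : ∀ k, 0 ≤ s k) (hs1 : ∀ k, s k < 1) :
    ∃ C : ℝ, 0 ≤ C ∧ ∀ Λ δ : ℝ, 1 ≤ Λ → 0 < δ →
      ∫ z in ball (0 : ℂ) 1,
        deriv (rampSlope δ) (Real.exp (Λ * (1 - ‖z‖ ^ 2)) - 1) * ∏ k, ‖z - ξ k‖ ^ (-s k) ≤ C := by
  obtain ⟨A, hA, hAle⟩ := exists_prod_rpow_neg_le hξ hinj hs
  obtain ⟨C₀, hC₀, h₀⟩ := exists_integral_layer_le (x := 1) (by simp) le_rfl one_pos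
  choose C hC h using fun k => exists_integral_layer_le (hξ k) (hs k) (hs1 k)
  refine ⟨A * (C₀ + ∑ k, C k),
    mul_nonneg hA.le (add_nonneg hC₀ (Finset.sum_nonneg fun k _ => hC k)),
    fun Λ δ hΛ hδ => ?_⟩
  set X : ℂ → ℝ := fun z => deriv (rampSlope δ) (Real.exp (Λ * (1 - ‖z‖ ^ 2)) - 1) with hX
  have hX0 : ∀ z, 0 ≤ X z := fun z => deriv_rampSlope_nonneg hδ _
  have hi0 : IntegrableOn (fun z => X z * ‖z - 1‖ ^ (-(0 : ℝ))) (ball (0 : ℂ) 1) :=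
    integrableOn_layer_mul (integrableOn_norm_sub_rpow (x := 1) (by simp) (by norm_num))
  have hi : ∀ k, IntegrableOn (fun z => X z * ‖z - ξ k‖ ^ (-s k)) (ball (0 : ℂ) 1) := fun k =>
    integrableOn_layer_mul (integrableOn_norm_sub_rpow (hξ k) (by linarith [hs1 k]))
  calc ∫ z in ball (0 : ℂ) 1, X z * ∏ k, ‖z - ξ k‖ ^ (-s k)
      ≤ ∫ z in ball (0 : ℂ) 1, A * (X z * ‖z - 1‖ ^ (-(0 : ℝ))
          + ∑ k, X z * ‖z - ξ k‖ ^ (-s k)) := by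
        refine setIntegral_mono_on ?_ ?_ measurableSet_ball fun z hz => ?_
        · exact integrableOn_layer_mul (integrableOn_prod_rpow_neg hξ hinj hs
            fun k => by linarith [hs1 k])
        · exact (hi0.add (integrable_finsetSum _ fun k _ => hi k)).const_mul A
        · have h1 := mul_le_mul_of_nonneg_left (hAle z (by simpa using hz)) (hX0 z)
          refine h1.trans_eq ?_
          rw [← Finset.mul_sum, neg_zero, Real.rpow_zero]
          ring
    _ = A * ((∫ z in ball (0 : ℂ) 1, X z * ‖z - 1‖ ^ (-(0 : ℝ)))
          + ∑ k, ∫ z in ball (0 : ℂ) 1, X z * ‖z - ξ k‖ ^ (-s k)) := by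
        rw [integral_const_mul, integral_add hi0 (integrable_finsetSum _ fun k _ => hi k),
          integral_finsetSum _ fun k _ => hi k]
    _ ≤ A * (C₀ + ∑ k, C k) := by
        gcongr with k
        · exact h₀ Λ δ hΛ hδ
        · exact h k Λ δ hΛ hδ

end BoundaryLayer

/-! ### The case of bounded radial growth -/

section RadiallyBounded

variable {m : ℕ} {ξ : Fin m → ℂ} {b s : Fin m → ℝ}

/-- The pointwise majorant of `(log ‖f‖) Δφ` near the boundary, for the test function `φ`. -/
noncomputable def laplacianMajorant (ξ : Fin m → ℂ) (b s : Fin m → ℝ) (Λ δ : ℝ) (z : ℂ) : ℝ :=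
  deriv (rampSlope δ) (Real.exp (Λ * (1 - ‖z‖ ^ 2)) - 1) * ∏ k, ‖z - ξ k‖ ^ (-s k)
    + (∏ k, ‖z - ξ k‖ ^ (-s k)
      + ∑ k, b k * ∏ j, ‖z - ξ j‖ ^ (-(s j + if j = k then 1 else 0)))

lemma prod_rpow_neg_add_ite (hξ : ∀ k, ‖ξ k‖ = 1) {z : ℂ} (hz : ‖z‖ < 1) (k : Fin m) :
    ∏ j, ‖z - ξ j‖ ^ (-(s j + if j = k then 1 else 0))
      = (∏ j, ‖z - ξ j‖ ^ (-s j)) / ‖z - ξ k‖ := by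
  have h : ∀ j, ‖z - ξ j‖ ^ (-(s j + if j = k then 1 else 0))
      = ‖z - ξ j‖ ^ (-s j) * if j = k then ‖z - ξ k‖⁻¹ else 1 := by
    intro j
    have hj := norm_sub_pos_of_norm_lt (hξ j) hz
    split_ifs with hjk
    · subst hjk
      rw [neg_add, Real.rpow_add hj, Real.rpow_neg_one]
    · rw [add_zero, mul_one]
  rw [Finset.prod_congr rfl fun j _ => h j, Finset.prod_mul_distrib]
  simp [div_eq_mul_inv]

lemma laplacianMajorant_eq (hξ : ∀ k, ‖ξ k‖ = 1) {Λ δ : ℝ} {z : ℂ} (hz : ‖z‖ < 1) :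
    laplacianMajorant ξ b s Λ δ z = (∏ k, ‖z - ξ k‖ ^ (-s k)) *
      (deriv (rampSlope δ) (Real.exp (Λ * (1 - ‖z‖ ^ 2)) - 1) + 1 + ∑ k, b k / ‖z - ξ k‖) := by
  rw [laplacianMajorant, Finset.sum_congr rfl fun k _ => by
    rw [prod_rpow_neg_add_ite hξ hz k]]
  rw [mul_add, mul_add, Finset.mul_sum, mul_one, mul_comm (∏ k, _), add_assoc]
  congr 2
  exact Finset.sum_congr rfl fun k _ => by ring

lemma laplacianMajorant_nonneg (hb : ∀ k, 0 ≤ b k) {Λ δ : ℝ} (hδ : 0 < δ) (z : ℂ) :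
    0 ≤ laplacianMajorant ξ b s Λ δ z :=
  add_nonneg (mul_nonneg (deriv_rampSlope_nonneg hδ _) (prod_rpow_nonneg z))
    (add_nonneg (prod_rpow_nonneg z)
      (Finset.sum_nonneg fun k _ => mul_nonneg (hb k) (prod_rpow_nonneg z)))

lemma exists_integral_laplacianMajorant_le (hξ : ∀ k, ‖ξ k‖ = 1) (hinj : Function.Injective ξ)
    (b : Fin m → ℝ) (hs : ∀ k, 0 ≤ s k) (hs1 : ∀ k, s k < 1) :
    ∃ C : ℝ, 0 ≤ C ∧ ∀ Λ δ : ℝ, 1 ≤ Λ → 0 < δ →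
      IntegrableOn (laplacianMajorant ξ b s Λ δ) (ball (0 : ℂ) 1) ∧
      ∫ z in ball (0 : ℂ) 1, laplacianMajorant ξ b s Λ δ z ≤ C := by
  obtain ⟨C, hC, h⟩ := exists_integral_layer_prod_le hξ hinj hs hs1
  have hi : IntegrableOn (fun z => ∏ k, ‖z - ξ k‖ ^ (-s k)) (ball (0 : ℂ) 1) :=
    integrableOn_prod_rpow_neg hξ hinj hs fun k => by linarith [hs1 k]
  have hik : ∀ k, IntegrableOn (fun z => ∏ j, ‖z - ξ j‖ ^ (-(s j + if j = k then 1 else 0)))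
      (ball (0 : ℂ) 1) := fun k => by
    refine integrableOn_prod_rpow_neg hξ hinj (fun j => ?_) fun j => ?_
    · split_ifs <;> linarith [hs j]
    · split_ifs <;> linarith [hs1 j]
  have hi2 : IntegrableOn (fun z => ∏ k, ‖z - ξ k‖ ^ (-s k)
      + ∑ k, b k * ∏ j, ‖z - ξ j‖ ^ (-(s j + if j = k then 1 else 0))) (ball (0 : ℂ) 1) :=
    hi.add (integrable_finsetSum _ fun k _ => (hik k).const_mul _)
  set B := ∫ z in ball (0 : ℂ) 1, (∏ k, ‖z - ξ k‖ ^ (-s k)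
      + ∑ k, b k * ∏ j, ‖z - ξ j‖ ^ (-(s j + if j = k then 1 else 0))) with hB
  refine ⟨C + |B|, by positivity, fun Λ δ hΛ hδ => ?_⟩
  have hi1 := integrableOn_layer_mul (Λ := Λ) (δ := δ) hi
  refine ⟨hi1.add hi2, ?_⟩
  rw [show (∫ z in ball (0 : ℂ) 1, laplacianMajorant ξ b s Λ δ z)
    = _ + B from integral_add hi1 hi2]
  exact add_le_add (h Λ δ hΛ hδ) (le_abs_self B)

/-- The main estimate, before the width `δ` of the boundary layer tends to zero. -/
lemma exists_sum_order_mul_testFun_le (hξ : ∀ k, ‖ξ k‖ = 1) (hinj : Function.Injective ξ)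
    (hb : ∀ k, 0 ≤ b k) (hs : ∀ k, 0 ≤ s k) (hs1 : ∀ k, s k < 1) :
    ∃ C : ℝ, 0 ≤ C ∧ ∀ (f : ℂ → ℂ) (K : ℝ), AnalyticOnNhd ℂ f (ball 0 1) → ‖f 0‖ = 1 → 0 < K →
      (∀ z ∈ ball (0 : ℂ) 1, Real.log ‖f z‖ ≤ K * ∏ k, ‖z - ξ k‖ ^ (-(b k + s k))) →
      ∀ δ : ℝ, 0 < δ → ∀ S : Finset ℂ, (∀ ζ ∈ S, f ζ = 0) →
        ∑ ζ ∈ S, (analyticOrderNatAt f ζ : ℝ) * testFun ξ b (2 + ∑ k, b k) δ ζ ≤ C * K := by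
  obtain ⟨C, hC, h⟩ := exists_integral_laplacianMajorant_le hξ hinj b hs hs1
  set Λ := 2 + ∑ k, b k with hΛ
  have hSb : 0 ≤ ∑ k, b k := Finset.sum_nonneg fun k _ => hb k
  have hΛ1 : 1 ≤ Λ := by linarith
  have hΛ0 : 0 < Λ := by linarith
  set A := 4 * Λ ^ 2 * Real.exp Λ ^ 2 with hA
  set C₂ := (∏ k, (2 : ℝ) ^ b k) * (2 * Λ * (Λ * Real.exp Λ)) with hC₂
  have hC₂0 : 0 ≤ C₂ := mul_nonneg (Finset.prod_nonneg fun _ _ => by positivity) (by positivity)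
  set H₀ := ∏ k, (4 : ℝ) ^ (b k + s k) with hH₀
  have hH₀0 : 0 ≤ H₀ := Finset.prod_nonneg fun _ _ => by positivity
  set V := volume.real (ball (0 : ℂ) (3 / 4)) with hV
  refine ⟨A * C + C₂ * (H₀ * V), by positivity, fun f K hf h0 hK hu δ hδ S hS => ?_⟩
  obtain ⟨hGi, hG⟩ := h Λ δ hΛ1 hδ
  set G := laplacianMajorant ξ b s Λ δ with hGdef
  set φ := testFun ξ b Λ δ with hφ
  set u : ℂ → ℝ := fun z => Real.log ‖f z‖ with hudef
  have hq : ∀ k, 0 ≤ b k + s k := fun k => add_nonneg (hb k) (hs k)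
  -- on the disc of radius `3 / 4`, which contains `{‖z‖² < 1/2}`, the bound for `u` is uniform
  have hu34 : ∀ z ∈ ball (0 : ℂ) (3 / 4), u z ≤ K * H₀ := by
    intro z hz
    rw [mem_ball_zero_iff] at hz
    refine (hu z (mem_ball_zero_iff.2 (by linarith))).trans ?_
    refine mul_le_mul_of_nonneg_left (Finset.prod_le_prod (fun _ _ => by positivity)
      fun k _ => ?_) hK.le
    rw [Real.rpow_neg (norm_nonneg _), ← Real.inv_rpow (norm_nonneg _)]
    refine Real.rpow_le_rpow (by positivity) ?_ (hq k)
    have := one_sub_norm_le_norm_sub (hξ k) z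
    rw [inv_le_comm₀ (by linarith) (by norm_num)]
    linarith
  have hpt : ∀ z ∈ ball (0 : ℂ) 1, u z * Laplacian.laplacian φ z
      ≤ K * A * G z + (ball (0 : ℂ) (3 / 4)).indicator (fun z => C₂ * (K * H₀ - u z)) z := by
    intro z hz
    have hz' := mem_ball_zero_iff.1 hz
    have hG0 : 0 ≤ G z := laplacianMajorant_nonneg hb hδ z
    have hKA : 0 ≤ K * A * G z := by positivity
    -- a negative Laplacian occurs only in the small disc, where `K * H₀ - u` is nonnegative
    rcases le_or_gt 0 (Laplacian.laplacian φ z) with hL | hL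
    · have h1 := mul_le_mul_of_nonneg_right (hu z hz) hL
      have h2 := laplacian_testFun_le hξ hb hδ hΛ hz'
      have hP : ∏ k, ‖z - ξ k‖ ^ (-s k)
          = (∏ k, ‖z - ξ k‖ ^ (-(b k + s k))) * ∏ k, ‖z - ξ k‖ ^ b k := by
        rw [← Finset.prod_mul_distrib]
        refine Finset.prod_congr rfl fun k _ => ?_
        rw [← Real.rpow_add (norm_sub_pos_of_norm_lt (hξ k) hz')]
        congr 1; ring
      have h3 : K * (∏ k, ‖z - ξ k‖ ^ (-(b k + s k))) * Laplacian.laplacian φ z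
          ≤ K * A * G z := by
        rw [hGdef, laplacianMajorant_eq hξ hz', hP]
        refine (mul_le_mul_of_nonneg_left h2 (mul_nonneg hK.le (prod_rpow_nonneg z))).trans_eq ?_
        ring
      have h4 : 0 ≤ (ball (0 : ℂ) (3 / 4)).indicator (fun z => C₂ * (K * H₀ - u z)) z :=
        indicator_nonneg (fun w hw => mul_nonneg hC₂0 (by linarith [hu34 w hw])) z
      linarith
    · have hz34 : z ∈ ball (0 : ℂ) (3 / 4) := by
        rw [mem_ball_zero_iff]
        by_contra! hcon
        exact absurd (laplacian_testFun_nonneg hξ hb hδ hΛ hz' (by nlinarith)) (not_le.2 hL)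
      rw [indicator_of_mem hz34]
      have h1 := hu34 z hz34
      have h2 := mul_le_mul_of_nonneg_left (neg_le_laplacian_testFun hξ hb hδ hΛ hz')
        (sub_nonneg.2 h1)
      have h3 : K * H₀ * Laplacian.laplacian φ z ≤ 0 :=
        mul_nonpos_of_nonneg_of_nonpos (by positivity) hL.le
      change (K * H₀ - u z) * -C₂ ≤ (K * H₀ - u z) * Laplacian.laplacian φ z at h2
      linarith
  -- radii adapted to the support of the test function
  set t₀ := min (Real.log (1 + δ) / Λ) 1 with ht₀
  have ht₀0 : 0 < t₀ := lt_min (div_pos (Real.log_pos (by linarith)) hΛ0) one_pos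
  have ht₀1 : t₀ ≤ 1 := min_le_right _ _
  set R := 1 - t₀ / 2 with hR
  set R' := max (1 - t₀ / 4) (4 / 5) with hR'
  have hRR' : R < R' := lt_of_lt_of_le (by linarith) (le_max_left _ _)
  have hR'1 : R' < 1 := max_lt (by linarith) (by norm_num)
  have hR'34 : 3 / 4 ≤ R' := le_trans (by norm_num) (le_max_right _ _)
  have hφs : ∀ z, z ∉ ball (0 : ℂ) R → φ z = 0 := by
    intro z hz
    rw [mem_ball_zero_iff, not_lt] at hz
    refine testFun_eq_zero hδ hΛ0 (le_trans ?_ (min_le_left (Real.log (1 + δ) / Λ) 1))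
    rw [← ht₀]
    have h1 : 0 ≤ R := by linarith
    have h2 : R ^ 2 ≤ ‖z‖ ^ 2 := by gcongr
    nlinarith
  have hφ2 : ContDiff ℝ 2 φ := contDiff_testFun hξ hδ hΛ0
  refine (sum_order_mul_le_integral_log_norm_mul_laplacian hf h0 hRR' hR'1 hφ2
    (testFun_nonneg hδ) hφs S hS).trans ?_
  have hui : IntegrableOn u (ball 0 R') := integrableOn_log_norm hf h0 hR'1
  have hui34 : IntegrableOn u (ball 0 (3 / 4)) := integrableOn_log_norm hf h0 (by norm_num)
  have huL : IntegrableOn (fun z => u z * Laplacian.laplacian φ z) (ball 0 R') := by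
    obtain ⟨B, hB⟩ := (isCompact_closedBall (0 : ℂ) R').exists_bound_of_continuousOn
      (continuous_laplacian hφ2).continuousOn
    refine Integrable.mul_bdd (c := B) hui (continuous_laplacian hφ2).aestronglyMeasurable ?_
    exact (ae_restrict_iff' measurableSet_ball).2 (Eventually.of_forall fun z hz =>
      hB z (ball_subset_closedBall hz))
  have hi34c : IntegrableOn (fun _ => K * H₀) (ball (0 : ℂ) (3 / 4)) :=
    integrableOn_const measure_ball_lt_top.ne
  have hi34 : IntegrableOn (fun z => C₂ * (K * H₀ - u z)) (ball (0 : ℂ) (3 / 4)) :=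
    ((integrableOn_const measure_ball_lt_top.ne).sub hui34).const_mul C₂
  have hGi' : IntegrableOn (fun z => K * A * G z) (ball 0 R') :=
    (hGi.mono_set (ball_subset_ball hR'1.le)).const_mul _
  have hI : IntegrableOn ((ball (0 : ℂ) (3 / 4)).indicator (fun z => C₂ * (K * H₀ - u z)))
      (ball 0 R') := ((integrable_indicator_iff measurableSet_ball).2 hi34).integrableOn
  calc ∫ z in ball (0 : ℂ) R', u z * Laplacian.laplacian φ z
      ≤ ∫ z in ball (0 : ℂ) R', (K * A * G z
          + (ball (0 : ℂ) (3 / 4)).indicator (fun z => C₂ * (K * H₀ - u z)) z) :=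
        setIntegral_mono_on huL (hGi'.add hI) measurableSet_ball fun z hz =>
          hpt z (ball_subset_ball hR'1.le hz)
    _ = K * A * (∫ z in ball (0 : ℂ) R', G z)
          + C₂ * (K * H₀ * V - ∫ z in ball (0 : ℂ) (3 / 4), u z) := by
        rw [integral_add hGi' hI, integral_const_mul, setIntegral_indicator measurableSet_ball,
          inter_eq_self_of_subset_right (ball_subset_ball hR'34), integral_const_mul,
          integral_sub hi34c hui34, setIntegral_const,
          smul_eq_mul, mul_comm V]
    _ ≤ K * A * C + C₂ * (K * H₀ * V) := by
        have h1 : ∫ z in ball (0 : ℂ) R', G z ≤ C :=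
          (setIntegral_mono_set hGi
            (Eventually.of_forall fun z => laplacianMajorant_nonneg hb hδ z)
            (ball_subset_ball hR'1.le).eventuallyLE).trans hG
        have h2 : 0 ≤ ∫ z in ball (0 : ℂ) (3 / 4), u z :=
          setIntegral_log_norm_nonneg hf h0 (by norm_num)
        gcongr
        linarith
    _ = _ := by ring

lemma sub_mul_prod_le_testFun (hξ : ∀ k, ‖ξ k‖ = 1) {Λ δ : ℝ} (hδ : 0 < δ) (hΛ : 1 ≤ Λ) {z : ℂ}
    (hz : ‖z‖ < 1) :
    (1 - ‖z‖ - 2 * δ) * ∏ k, ‖z - ξ k‖ ^ b k ≤ testFun ξ b Λ δ z := by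
  rw [testFun, indicator_of_mem (mem_ball_zero_iff.2 hz), re_sq_add_im_sq, exp_re_logProd hξ hz]
  refine mul_le_mul_of_nonneg_right ?_ (prod_rpow_nonneg z)
  refine le_trans ?_ (sub_le_smoothRamp hδ _)
  have h1 := Real.add_one_le_exp (Λ * (1 - ‖z‖ ^ 2))
  have h2 : 1 - ‖z‖ ≤ 1 - ‖z‖ ^ 2 := by nlinarith [norm_nonneg z]
  have h3 : 1 * (1 - ‖z‖ ^ 2) ≤ Λ * (1 - ‖z‖ ^ 2) :=
    mul_le_mul_of_nonneg_right hΛ (by nlinarith [norm_nonneg z])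
  linarith

/-- The Blaschke-type condition for functions whose logarithm grows only near the points `ξ k`. -/
theorem exists_sum_order_mul_one_sub_norm_le (hξ : ∀ k, ‖ξ k‖ = 1) (hinj : Function.Injective ξ)
    (hb : ∀ k, 0 ≤ b k) (hs : ∀ k, 0 ≤ s k) (hs1 : ∀ k, s k < 1) :
    ∃ C : ℝ, 0 ≤ C ∧ ∀ (f : ℂ → ℂ) (K : ℝ), AnalyticOnNhd ℂ f (ball 0 1) → ‖f 0‖ = 1 → 0 < K →
      (∀ z ∈ ball (0 : ℂ) 1, Real.log ‖f z‖ ≤ K * ∏ k, ‖z - ξ k‖ ^ (-(b k + s k))) →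
      ∀ S : Finset ℂ, (∀ ζ ∈ S, ζ ∈ ball (0 : ℂ) 1 ∧ f ζ = 0) →
        ∑ ζ ∈ S, (analyticOrderNatAt f ζ : ℝ) * ((1 - ‖ζ‖) * ∏ k, ‖ζ - ξ k‖ ^ b k) ≤ C * K := by
  obtain ⟨C, hC, h⟩ := exists_sum_order_mul_testFun_le hξ hinj hb hs hs1
  refine ⟨C, hC, fun f K hf h0 hK hu S hS => ?_⟩
  have hSb : 0 ≤ ∑ k, b k := Finset.sum_nonneg fun k _ => hb k
  have hle : ∀ δ : ℝ, 0 < δ → ∑ ζ ∈ S, (analyticOrderNatAt f ζ : ℝ) *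
      ((1 - ‖ζ‖ - 2 * δ) * ∏ k, ‖ζ - ξ k‖ ^ b k) ≤ C * K := fun δ hδ => by
    refine le_trans (Finset.sum_le_sum fun ζ hζ => ?_)
      (h f K hf h0 hK hu δ hδ S fun ζ hζ => (hS ζ hζ).2)
    gcongr
    exact sub_mul_prod_le_testFun hξ hδ (by linarith) (mem_ball_zero_iff.1 (hS ζ hζ).1)
  have hlim : Tendsto (fun δ : ℝ => ∑ ζ ∈ S, (analyticOrderNatAt f ζ : ℝ) *
      ((1 - ‖ζ‖ - 2 * δ) * ∏ k, ‖ζ - ξ k‖ ^ b k)) (𝓝[>] 0)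
      (𝓝 (∑ ζ ∈ S, (analyticOrderNatAt f ζ : ℝ) *
        ((1 - ‖ζ‖ - 2 * 0) * ∏ k, ‖ζ - ξ k‖ ^ b k))) :=
    ((by fun_prop : Continuous fun δ : ℝ => ∑ ζ ∈ S, (analyticOrderNatAt f ζ : ℝ) *
      ((1 - ‖ζ‖ - 2 * δ) * ∏ k, ‖ζ - ξ k‖ ^ b k)).tendsto 0).mono_left nhdsWithin_le_nhds
  have := le_of_tendsto hlim (eventually_mem_nhdsWithin.mono fun δ hδ => hle δ hδ)
  simpa using this

end RadiallyBounded

/-! ### Self-maps of the disc close to the identity -/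

section Perturbation

variable {n : ℕ}

/-- The linear function `1 + t - w * conj x`, with `t ^ (1 - κ) = a`: it has positive real part on
the unit disc and is comparable to `t + ‖w - x‖`. -/
noncomputable def shiftedPole (x : ℂ) (κ a : ℝ) (w : ℂ) : ℂ :=
  1 + ((a ^ (1 / (1 - κ)) : ℝ) : ℂ) - w * (starRingEnd ℂ) x

/-- A holomorphic function with values in a sector, of size about `1 + ∑ ‖w - x j‖ ^ (-κ j)`
away from the points `x j`. -/
noncomputable def poleSum (x : Fin n → ℂ) (κ : Fin n → ℝ) (a : ℝ) (w : ℂ) : ℂ :=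
  1 + ∑ j, shiftedPole (x j) (κ j) a w ^ ((-κ j : ℝ) : ℂ)

/-- The sum of the norms of the terms of `poleSum`. -/
noncomputable def poleNormSum (x : Fin n → ℂ) (κ : Fin n → ℝ) (a : ℝ) (w : ℂ) : ℝ :=
  1 + ∑ j, ‖shiftedPole (x j) (κ j) a w‖ ^ (-κ j)

/-- A self-map of the unit disc that pushes every point inwards by about `a / poleNormSum`. -/
noncomputable def inwardMap (x : Fin n → ℂ) (κ : Fin n → ℝ) (a : ℝ) (w : ℂ) : ℂ :=
  w * Complex.exp (-((a : ℂ) / poleSum x κ a w))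

section Pole

variable {x : ℂ} {κ a : ℝ} {w : ℂ}

lemma lt_re_shiftedPole (hx : ‖x‖ = 1) (hw : ‖w‖ < 1) :
    a ^ (1 / (1 - κ)) < (shiftedPole x κ a w).re := by
  have := re_one_sub_mul_conj_pos hx hw
  simp only [shiftedPole, Complex.sub_re, Complex.add_re, Complex.one_re, Complex.ofReal_re] at *
  linarith

lemma re_shiftedPole_pos (hx : ‖x‖ = 1) (ha : 0 < a) (hw : ‖w‖ < 1) :
    0 < (shiftedPole x κ a w).re :=
  (Real.rpow_pos_of_pos ha _).trans (lt_re_shiftedPole hx hw)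

lemma norm_shiftedPole_pos (hx : ‖x‖ = 1) (ha : 0 < a) (hw : ‖w‖ < 1) :
    0 < ‖shiftedPole x κ a w‖ :=
  (re_shiftedPole_pos hx ha hw).trans_le (Complex.re_le_norm _)

lemma le_norm_shiftedPole (hx : ‖x‖ = 1) (hw : ‖w‖ < 1) :
    a ^ (1 / (1 - κ)) ≤ ‖shiftedPole x κ a w‖ :=
  (lt_re_shiftedPole hx hw).le.trans (Complex.re_le_norm _)

lemma norm_sub_le_norm_shiftedPole (hx : ‖x‖ = 1) (ha : 0 < a) (hw : ‖w‖ < 1) :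
    ‖w - x‖ ≤ ‖shiftedPole x κ a w‖ := by
  rw [← norm_one_sub_mul_conj hx w]
  refine (sq_le_sq₀ (norm_nonneg _) (norm_nonneg _)).1 ?_
  have h1 := re_one_sub_mul_conj_pos hx hw
  have h2 : shiftedPole x κ a w
      = (1 - w * (starRingEnd ℂ) x) + ((a ^ (1 / (1 - κ)) : ℝ) : ℂ) := by
    rw [shiftedPole]; ring
  have h3 := Real.rpow_pos_of_pos ha (1 / (1 - κ))
  rw [h2, Complex.sq_norm, Complex.sq_norm, Complex.normSq_apply, Complex.normSq_apply,
    Complex.add_re, Complex.add_im, Complex.ofReal_re, Complex.ofReal_im]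
  nlinarith

lemma norm_shiftedPole_le (hx : ‖x‖ = 1) (ha : 0 < a) :
    ‖shiftedPole x κ a w‖ ≤ ‖w - x‖ + a ^ (1 / (1 - κ)) := by
  have h2 : shiftedPole x κ a w
      = (1 - w * (starRingEnd ℂ) x) + ((a ^ (1 / (1 - κ)) : ℝ) : ℂ) := by
    rw [shiftedPole]; ring
  rw [h2, ← norm_one_sub_mul_conj hx w]
  refine (norm_add_le _ _).trans_eq ?_
  rw [Complex.norm_of_nonneg (Real.rpow_pos_of_pos ha _).le]

lemma norm_shiftedPole_le_three (hx : ‖x‖ = 1) (hκ : κ < 1) (ha : 0 < a) (ha1 : a ≤ 1)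
    (hw : ‖w‖ < 1) : ‖shiftedPole x κ a w‖ ≤ 3 := by
  have h1 := norm_shiftedPole_le (κ := κ) (w := w) hx ha
  have h2 := norm_sub_le_two hx hw
  have h3 : a ^ (1 / (1 - κ)) ≤ 1 := Real.rpow_le_one ha.le ha1 (by
    have : 0 < 1 - κ := by linarith
    positivity)
  linarith

lemma rpow_one_div_rpow (hκ : κ < 1) (ha : 0 < a) : (a ^ (1 / (1 - κ))) ^ (1 - κ) = a := by
  rw [← Real.rpow_mul ha.le, one_div_mul_cancel (by linarith), Real.rpow_one]

lemma mul_norm_rpow_neg_le_re {s : ℂ} (hs : 0 < s.re) {c : ℝ} (hκ : 0 ≤ κ) (hκ1 : κ < 1)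
    (hc : c ≤ Real.cos (κ * (π / 2))) : c * ‖s‖ ^ (-κ) ≤ (s ^ ((-κ : ℝ) : ℂ)).re := by
  rw [Complex.cpow_ofReal_re, mul_comm]
  refine mul_le_mul_of_nonneg_left (hc.trans ?_) (by positivity)
  have h1 : |s.arg| < π / 2 := Complex.abs_arg_lt_pi_div_two_iff.2 (Or.inl hs)
  rw [← Real.cos_abs (s.arg * -κ), abs_mul, abs_neg, abs_of_nonneg hκ]
  refine Real.cos_le_cos_of_nonneg_of_le_pi (by positivity) ?_ (by
    rw [mul_comm]; gcongr)
  nlinarith [Real.pi_pos]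

end Pole

/-- The terms of `poleSum` have arguments whose cosines are bounded below by a positive constant. -/
lemma exists_le_cos {κ : Fin n → ℝ} (hκ : ∀ j, 0 ≤ κ j) (hκ1 : ∀ j, κ j < 1) :
    ∃ c : ℝ, 0 < c ∧ c ≤ 1 ∧ ∀ j, c ≤ Real.cos (κ j * (π / 2)) := by
  obtain ⟨M, hM⟩ := Finite.exists_le fun j => (Real.cos (κ j * (π / 2)))⁻¹
  have hM1 : 1 ≤ max M 1 := le_max_right _ _
  refine ⟨(max M 1)⁻¹, inv_pos.2 (by linarith), inv_le_one_of_one_le₀ hM1, fun j => ?_⟩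
  refine inv_le_of_inv_le₀ (Real.cos_pos_of_mem_Ioo ⟨?_, ?_⟩) ((hM j).trans (le_max_left _ _))
  · nlinarith [Real.pi_pos, hκ j]
  · nlinarith [Real.pi_pos, hκ1 j]

variable {x : Fin n → ℂ} {κ : Fin n → ℝ} {a c : ℝ} {w : ℂ}

lemma one_le_poleNormSum : 1 ≤ poleNormSum x κ a w := by
  rw [poleNormSum]
  have : 0 ≤ ∑ j, ‖shiftedPole (x j) (κ j) a w‖ ^ (-κ j) :=
    Finset.sum_nonneg fun _ _ => by positivity
  linarith

lemma le_poleNormSum (j : Fin n) :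
    ‖shiftedPole (x j) (κ j) a w‖ ^ (-κ j) ≤ poleNormSum x κ a w := by
  rw [poleNormSum]
  have := Finset.single_le_sum (f := fun j => ‖shiftedPole (x j) (κ j) a w‖ ^ (-κ j))
    (fun _ _ => by positivity) (Finset.mem_univ j)
  linarith

lemma norm_poleSum_le : ‖poleSum x κ a w‖ ≤ poleNormSum x κ a w := by
  rw [poleSum, poleNormSum]
  refine (norm_add_le _ _).trans ?_
  rw [norm_one]
  gcongr
  refine (norm_sum_le _ _).trans (Finset.sum_le_sum fun j _ => ?_)
  rw [Complex.norm_cpow_real]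

lemma mul_poleNormSum_le_re (hx : ∀ j, ‖x j‖ = 1) (hκ : ∀ j, 0 ≤ κ j) (hκ1 : ∀ j, κ j < 1)
    (hc1 : c ≤ 1) (hc : ∀ j, c ≤ Real.cos (κ j * (π / 2))) (ha : 0 < a) (hw : ‖w‖ < 1) :
    c * poleNormSum x κ a w ≤ (poleSum x κ a w).re := by
  rw [poleSum, poleNormSum, Complex.add_re, Complex.one_re, Complex.re_sum, mul_add, mul_one,
    Finset.mul_sum]
  gcongr with j
  exact mul_norm_rpow_neg_le_re (re_shiftedPole_pos (hx j) ha hw) (hκ j) (hκ1 j) (hc j)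

/-- The standing assumptions on the data of `inwardMap`: `c` bounds from below the cosines of
the arguments of the terms of `poleSum`, and `a ≤ c` keeps the displacement small. -/
structure InwardData (x : Fin n → ℂ) (κ : Fin n → ℝ) (c a : ℝ) : Prop where
  norm_eq_one : ∀ j, ‖x j‖ = 1
  nonneg : ∀ j, 0 ≤ κ j
  lt_one : ∀ j, κ j < 1
  pos : 0 < c
  le_one : c ≤ 1
  le_cos : ∀ j, c ≤ Real.cos (κ j * (π / 2))
  a_pos : 0 < a
  a_le : a ≤ c

namespace InwardData

variable (h : InwardData x κ c a) (hw : ‖w‖ < 1)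
include h

lemma a_le_one : a ≤ 1 := h.a_le.trans h.le_one

lemma displacement_pos : 0 < a / poleNormSum x κ a w :=
  div_pos h.a_pos (one_pos.trans_le one_le_poleNormSum)

include hw

lemma mul_le_re_poleSum : c * poleNormSum x κ a w ≤ (poleSum x κ a w).re :=
  mul_poleNormSum_le_re h.norm_eq_one h.nonneg h.lt_one h.le_one h.le_cos h.a_pos hw

lemma re_poleSum_pos : 0 < (poleSum x κ a w).re :=
  (mul_pos h.pos (one_pos.trans_le one_le_poleNormSum)).trans_le (h.mul_le_re_poleSum hw)

lemma norm_div_poleSum_le : ‖(a : ℂ) / poleSum x κ a w‖ ≤ a / poleNormSum x κ a w / c := by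
  rw [norm_div, Complex.norm_of_nonneg h.a_pos.le, div_div]
  have h1 : 0 < poleNormSum x κ a w := one_pos.trans_le one_le_poleNormSum
  have h2 := h.pos
  refine div_le_div_of_nonneg_left h.a_pos.le (by positivity) ?_
  rw [mul_comm]
  exact (h.mul_le_re_poleSum hw).trans (Complex.re_le_norm _)

lemma le_re_div_poleSum :
    c * (a / poleNormSum x κ a w) ≤ ((a : ℂ) / poleSum x κ a w).re := by
  have h1 : 0 < poleNormSum x κ a w := one_pos.trans_le one_le_poleNormSum
  have h2 := h.re_poleSum_pos hw
  have h3 : 0 < ‖poleSum x κ a w‖ := h2.trans_le (Complex.re_le_norm _)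
  have h4 : ((a : ℂ) / poleSum x κ a w).re
      = a * (poleSum x κ a w).re / ‖poleSum x κ a w‖ ^ 2 := by
    rw [Complex.div_re, Complex.sq_norm]; simp
  rw [h4, ← mul_div_assoc, div_le_div_iff₀ h1 (by positivity)]
  have h5 : ‖poleSum x κ a w‖ ^ 2 ≤ poleNormSum x κ a w ^ 2 := by
    gcongr; exact norm_poleSum_le
  calc c * a * ‖poleSum x κ a w‖ ^ 2 ≤ c * a * poleNormSum x κ a w ^ 2 := by
        have := h.pos; have := h.a_pos; gcongr
    _ = a * (c * poleNormSum x κ a w) * poleNormSum x κ a w := by ring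
    _ ≤ a * (poleSum x κ a w).re * poleNormSum x κ a w := by
        have := h.a_pos; gcongr; exact h.mul_le_re_poleSum hw

lemma norm_inwardMap_sub_le :
    ‖inwardMap x κ a w - w‖ ≤ 2 / c * (a / poleNormSum x κ a w) := by
  have h1 := h.norm_div_poleSum_le hw
  have hc := h.pos
  have hT : 1 ≤ poleNormSum x κ a w := one_le_poleNormSum
  have h2 : a / poleNormSum x κ a w / c ≤ 1 := by
    rw [div_le_one hc]
    exact (div_le_self h.a_pos.le hT).trans h.a_le
  have h3 := Complex.norm_exp_sub_one_le (x := -((a : ℂ) / poleSum x κ a w))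
    (by rw [norm_neg]; exact h1.trans h2)
  rw [norm_neg] at h3
  rw [inwardMap, show ∀ e : ℂ, w * e - w = w * (e - 1) by intro e; ring, norm_mul]
  calc _ ≤ 1 * (2 * (a / poleNormSum x κ a w / c)) := by
        gcongr
        exact h3.trans (by gcongr)
    _ = _ := by ring

lemma le_one_sub_norm_inwardMap :
    c / 2 * (a / poleNormSum x κ a w) ≤ 1 - ‖inwardMap x κ a w‖ := by
  have hc := h.pos
  have hT : 1 ≤ poleNormSum x κ a w := one_le_poleNormSum
  have h0 := h.displacement_pos (w := w)
  have h1 := h.le_re_div_poleSum hw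
  set y := c * (a / poleNormSum x κ a w) with hy
  have hy0 : 0 < y := by positivity
  have hy1 : y ≤ 1 := mul_le_one₀ h.le_one h0.le
    ((div_le_self h.a_pos.le hT).trans h.a_le_one)
  have h2 : ‖inwardMap x κ a w‖ ≤ Real.exp (-y) := by
    rw [inwardMap, norm_mul, Complex.norm_exp, Complex.neg_re]
    calc _ ≤ 1 * Real.exp (-y) := by gcongr
      _ = _ := one_mul _
  -- `exp (-y) ≤ 1 - y / 2` on `[0, 1]`, from `(1 + y) exp (-y) ≤ 1`
  have h3 : Real.exp (-y) * (1 + y) ≤ 1 := by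
    calc Real.exp (-y) * (1 + y) ≤ Real.exp (-y) * Real.exp y := by
          gcongr; linarith [Real.add_one_le_exp y]
      _ = 1 := by rw [← Real.exp_add]; simp
  have h4 : c / 2 * (a / poleNormSum x κ a w) = y / 2 := by rw [hy]; ring
  rw [h4]
  have h5 := Real.exp_pos (-y)
  nlinarith

lemma norm_inwardMap_lt_one : ‖inwardMap x κ a w‖ < 1 := by
  have h1 := h.le_one_sub_norm_inwardMap hw
  have h2 := mul_pos (half_pos h.pos) (h.displacement_pos (w := w))
  linarith

/-- The displacement is at most of the order of each `shiftedPole`, which also bounds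
`‖w - x j‖`. -/
lemma norm_inwardMap_sub_le_shiftedPole (j : Fin n) :
    ‖inwardMap x κ a w - x j‖ ≤ (1 + 2 / c) * ‖shiftedPole (x j) (κ j) a w‖ := by
  have hc := h.pos
  have hs := norm_shiftedPole_pos (κ := κ j) (h.norm_eq_one j) h.a_pos hw
  set s := ‖shiftedPole (x j) (κ j) a w‖ with hsdef
  have h1 := h.norm_inwardMap_sub_le hw
  have h2 : a / poleNormSum x κ a w ≤ s := by
    have h3 : a ≤ s ^ (1 - κ j) := by
      conv_lhs => rw [← rpow_one_div_rpow (h.lt_one j) h.a_pos]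
      exact Real.rpow_le_rpow (Real.rpow_pos_of_pos h.a_pos _).le
        (le_norm_shiftedPole (h.norm_eq_one j) hw) (by linarith [h.lt_one j])
    rw [div_le_iff₀ (one_pos.trans_le one_le_poleNormSum)]
    calc a ≤ s ^ (1 - κ j) := h3
      _ = s * s ^ (-κ j) := by rw [sub_eq_add_neg, Real.rpow_add hs, Real.rpow_one]
      _ ≤ s * poleNormSum x κ a w := by gcongr; exact le_poleNormSum j
  calc ‖inwardMap x κ a w - x j‖ ≤ ‖inwardMap x κ a w - w‖ + ‖w - x j‖ :=
        norm_sub_le_norm_sub_add_norm_sub _ _ _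
    _ ≤ 2 / c * s + s := by
        gcongr
        · exact h1.trans (by gcongr)
        · exact norm_sub_le_norm_shiftedPole (h.norm_eq_one j) h.a_pos hw
    _ = _ := by ring

/-- Distances to points of the unit circle do not shrink by more than a constant factor. -/
lemma norm_sub_le_inwardMap {y : ℂ} (hy : ‖y‖ = 1) :
    ‖w - y‖ ≤ (1 + 4 / c ^ 2) * ‖inwardMap x κ a w - y‖ := by
  have hc := h.pos
  have h1 := h.norm_inwardMap_sub_le hw
  have h2 := h.le_one_sub_norm_inwardMap hw
  have h3 := one_sub_norm_le_norm_sub hy (inwardMap x κ a w)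
  have h4 : 2 / c * (a / poleNormSum x κ a w)
      = 4 / c ^ 2 * (c / 2 * (a / poleNormSum x κ a w)) := by
    field_simp; ring
  calc ‖w - y‖ ≤ ‖w - inwardMap x κ a w‖ + ‖inwardMap x κ a w - y‖ :=
        norm_sub_le_norm_sub_add_norm_sub _ _ _
    _ ≤ 4 / c ^ 2 * ‖inwardMap x κ a w - y‖ + ‖inwardMap x κ a w - y‖ := by
        gcongr
        rw [norm_sub_rev]
        refine h1.trans (h4.trans_le ?_)
        gcongr
        exact h2.trans h3
    _ = _ := by ring

lemma analyticAt_inwardMap : AnalyticAt ℂ (inwardMap x κ a) w := by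
  have h1 : ∀ j, AnalyticAt ℂ (fun w => shiftedPole (x j) (κ j) a w ^ ((-κ j : ℝ) : ℂ)) w := by
    intro j
    refine AnalyticAt.cpow ?_ analyticAt_const
      (Or.inl (re_shiftedPole_pos (h.norm_eq_one j) h.a_pos hw))
    unfold shiftedPole
    fun_prop
  have h2 : AnalyticAt ℂ (poleSum x κ a) w :=
    analyticAt_const.add (Finset.analyticAt_fun_sum _ fun j _ => h1 j)
  have h3 : poleSum x κ a w ≠ 0 := fun h0 => by
    have := h.re_poleSum_pos hw
    simp [h0] at this
  exact analyticAt_id.mul ((analyticAt_const.div h2 h3).neg.cexp)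

end InwardData

end Perturbation

/-! ### Zeros of the composition with an inward map -/

section Composition

variable {n m : ℕ} {x : Fin n → ℂ} {κ : Fin n → ℝ} {a c p : ℝ} {w ζ : ℂ} {ξ : Fin m → ℂ}
  {b s : Fin m → ℝ}

/-- The distance to the unit circle, enlarged near the points `x j`. -/
noncomputable def weightedDist (x : Fin n → ℂ) (κ : Fin n → ℝ) (ζ : ℂ) : ℝ :=
  (1 - ‖ζ‖) * (1 + ∑ j, ‖ζ - x j‖ ^ (-κ j))

/-- One of the terms of `weightedDist` is at least the average. -/
lemma exists_le_of_le_weightedDist {y : ℝ} (h : (n + 1) * y ≤ weightedDist x κ ζ) :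
    y ≤ 1 - ‖ζ‖ ∨ ∃ j, y ≤ (1 - ‖ζ‖) * ‖ζ - x j‖ ^ (-κ j) := by
  by_contra! hcon
  have h1 : ∑ j, (1 - ‖ζ‖) * ‖ζ - x j‖ ^ (-κ j) ≤ n * y := by
    have := Finset.sum_le_card_nsmul Finset.univ (fun j => (1 - ‖ζ‖) * ‖ζ - x j‖ ^ (-κ j)) y
      fun j _ => (hcon.2 j).le
    simpa using this
  rw [weightedDist, mul_add, Finset.mul_sum] at h
  linarith [hcon.1]

lemma norm_lt_one_of_norm_sub_le (hζ : ‖ζ‖ < 1) (hw : ‖w - ζ‖ ≤ (1 - ‖ζ‖) / 2) : ‖w‖ < 1 := by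
  have := norm_sub_norm_le w ζ
  linarith

namespace InwardData

variable (h : InwardData x κ c a)
include h

/-- Where `weightedDist` is large compared with `a`, the displacement is small compared with the
distance to the circle. -/
lemma le_mul_poleNormSum (hζ : ‖ζ‖ < 1) (hD : (n + 1) * (80 * a / c) ≤ weightedDist x κ ζ)
    (hw : ‖w - ζ‖ ≤ (1 - ‖ζ‖) / 2) : 32 * a / c ≤ (1 - ‖ζ‖) * poleNormSum x κ a w := by
  have hc := h.pos
  have ha := h.a_pos
  have hd : 0 < 1 - ‖ζ‖ := by linarith
  have hac : 0 < a / c := by positivity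
  have e32 : 32 * a / c = 32 * (a / c) := by ring
  have e80 : 80 * a / c = 80 * (a / c) := by ring
  rcases exists_le_of_le_weightedDist hD with h1 | ⟨j, hj⟩
  · have := mul_le_mul_of_nonneg_left (one_le_poleNormSum (x := x) (κ := κ) (a := a) (w := w)) hd.le
    linarith
  have hκ := h.nonneg j
  have hκ1 := h.lt_one j
  have hxj := h.norm_eq_one j
  set r := ‖ζ - x j‖ with hr
  have hr0 : 0 < r := norm_sub_pos_of_norm_lt hxj hζ
  have hdr : 1 - ‖ζ‖ ≤ r := one_sub_norm_le_norm_sub hxj ζ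
  have hat : a ^ (1 / (1 - κ j)) ≤ r := by
    have h2 : a ≤ r ^ (1 - κ j) := by
      calc a ≤ 80 * a / c := by
            rw [le_div_iff₀ hc]; nlinarith [h.le_one]
        _ ≤ (1 - ‖ζ‖) * r ^ (-κ j) := hj
        _ ≤ r * r ^ (-κ j) := by gcongr
        _ = r ^ (1 - κ j) := by rw [sub_eq_add_neg, Real.rpow_add hr0, Real.rpow_one]
    have h3 : 0 < 1 - κ j := by linarith
    calc a ^ (1 / (1 - κ j)) ≤ (r ^ (1 - κ j)) ^ (1 / (1 - κ j)) := by gcongr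
      _ = r := by rw [← Real.rpow_mul hr0.le, mul_one_div_cancel h3.ne', Real.rpow_one]
  have hs : ‖shiftedPole (x j) (κ j) a w‖ ≤ 5 / 2 * r := by
    have h2 := norm_shiftedPole_le (κ := κ j) (w := w) hxj ha
    have h3 : ‖w - x j‖ ≤ ‖w - ζ‖ + r := norm_sub_le_norm_sub_add_norm_sub _ _ _
    linarith
  have hs0 := norm_shiftedPole_pos (κ := κ j) hxj ha (norm_lt_one_of_norm_sub_le hζ hw)
  have hT : 2 / 5 * r ^ (-κ j) ≤ poleNormSum x κ a w := by
    refine le_trans ?_ (le_poleNormSum j)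
    refine le_trans ?_ (Real.rpow_le_rpow_of_nonpos hs0 hs (neg_nonpos.2 hκ))
    rw [Real.mul_rpow (by norm_num) hr0.le]
    gcongr
    calc (2 / 5 : ℝ) = (5 / 2) ^ (-1 : ℝ) := by rw [Real.rpow_neg_one]; norm_num
      _ ≤ (5 / 2) ^ (-κ j) := Real.rpow_le_rpow_of_exponent_le (by norm_num) (by linarith)
  have := mul_le_mul_of_nonneg_left hT hd.le
  linarith

/-- Rouché's argument in the form of the quantitative open mapping theorem. -/
lemma exists_inwardMap_eq (hζ : ‖ζ‖ < 1)
    (hD : (n + 1) * (80 * a / c) ≤ weightedDist x κ ζ) :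
    ∃ w, ‖w - ζ‖ ≤ (1 - ‖ζ‖) / 2 ∧ inwardMap x κ a w = ζ := by
  have hc := h.pos
  have ha := h.a_pos
  set ρ := (1 - ‖ζ‖) / 2 with hρ
  have hρ0 : 0 < ρ := by rw [hρ]; linarith
  have hlt : ∀ w, ‖w - ζ‖ ≤ ρ → ‖w‖ < 1 := fun w hw => norm_lt_one_of_norm_sub_le hζ hw
  have hdisp : ∀ w, ‖w - ζ‖ ≤ ρ → ‖inwardMap x κ a w - w‖ ≤ ρ / 8 := by
    intro w hw
    refine (h.norm_inwardMap_sub_le (hlt w hw)).trans ?_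
    have h1 := h.le_mul_poleNormSum hζ hD hw
    have hT : 0 < poleNormSum x κ a w := one_pos.trans_le one_le_poleNormSum
    have h2 : a / c / poleNormSum x κ a w ≤ ρ / 16 := by
      rw [div_le_iff₀ hT]
      have : 32 * a / c = 32 * (a / c) := by ring
      rw [hρ]; linarith
    calc 2 / c * (a / poleNormSum x κ a w) = 2 * (a / c / poleNormSum x κ a w) := by ring
      _ ≤ _ := by linarith
  have hζζ : ‖ζ - ζ‖ ≤ ρ := by simpa using hρ0.le
  have hsph : ∀ w ∈ sphere ζ ρ, 3 * ρ / 4 ≤ ‖inwardMap x κ a w - inwardMap x κ a ζ‖ := by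
    intro w hw
    rw [mem_sphere_iff_norm] at hw
    have h1 := hdisp w hw.le
    have h2 := hdisp ζ hζζ
    have h3 : ‖w - ζ‖ ≤ ‖w - inwardMap x κ a w‖ + ‖inwardMap x κ a w - inwardMap x κ a ζ‖
        + ‖inwardMap x κ a ζ - ζ‖ := by
      refine le_trans (le_of_eq ?_) (norm_add₃_le)
      congr 1; ring
    rw [norm_sub_rev w (inwardMap x κ a w)] at h3
    linarith
  have hana : AnalyticOnNhd ℂ (inwardMap x κ a) (ball 0 1) := fun w hw =>
    h.analyticAt_inwardMap (mem_ball_zero_iff.1 hw)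
  have hcl : closedBall ζ ρ ⊆ ball 0 1 := fun w hw =>
    mem_ball_zero_iff.2 (hlt w (mem_closedBall_iff_norm.1 hw))
  have hfreq : ∃ᶠ w in 𝓝 ζ, inwardMap x κ a w ≠ inwardMap x κ a ζ := by
    intro hcon
    simp only [not_not] at hcon
    have heq := hana.eqOn_of_preconnected_of_eventuallyEq analyticOnNhd_const
      (convex_ball (0 : ℂ) 1).isPreconnected (mem_ball_zero_iff.2 hζ) hcon
    have hmem : ζ + (ρ : ℂ) ∈ sphere ζ ρ := by
      simp [abs_of_pos hρ0]
    have h1 := hsph _ hmem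
    rw [heq (hcl (sphere_subset_closedBall hmem)), sub_self, norm_zero] at h1
    linarith
  have hball := DiffContOnCl.ball_subset_image_closedBall
    ((hana.mono hcl).differentiableOn.diffContOnCl_ball subset_rfl) hρ0 hsph hfreq
  have hmem : ζ ∈ ball (inwardMap x κ a ζ) (3 * ρ / 4 / 2) := by
    rw [mem_ball_iff_norm, norm_sub_rev]
    linarith [hdisp ζ hζζ]
  obtain ⟨w, hw, hwζ⟩ := hball hmem
  exact ⟨w, mem_closedBall_iff_norm.1 hw, hwζ⟩

lemma poleNormSum_mul_prod_le (hw : ‖w‖ < 1) :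
    poleNormSum x κ a w * ∏ j, ‖shiftedPole (x j) (κ j) a w‖ ^ κ j ≤ (n + 1) * 3 ^ n := by
  set σ := fun j => ‖shiftedPole (x j) (κ j) a w‖ with hσ
  have hσ0 : ∀ j, 0 < σ j := fun j => norm_shiftedPole_pos (h.norm_eq_one j) h.a_pos hw
  have hσ3 : ∀ j, σ j ^ κ j ≤ 3 := fun j => by
    have h1 : σ j ≤ 3 :=
      norm_shiftedPole_le_three (h.norm_eq_one j) (h.lt_one j) h.a_pos h.a_le_one hw
    calc σ j ^ κ j ≤ 3 ^ κ j := Real.rpow_le_rpow (hσ0 j).le h1 (h.nonneg j)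
      _ ≤ 3 ^ (1 : ℝ) := Real.rpow_le_rpow_of_exponent_le (by norm_num) (h.lt_one j).le
      _ = 3 := Real.rpow_one _
  have hprod : ∀ g : Fin n → ℝ, (∀ j, 0 ≤ g j) → (∀ j, g j ≤ 3) → ∏ j, g j ≤ 3 ^ n := by
    intro g hg0 hg
    have := Finset.prod_le_prod (s := Finset.univ) (fun j _ => hg0 j) fun j _ => hg j
    simpa using this
  have hterm : ∀ j, σ j ^ (-κ j) * ∏ i, σ i ^ κ i ≤ 3 ^ n := by
    intro j
    have h1 : σ j ^ (-κ j) * ∏ i, σ i ^ κ i = ∏ i, (if i = j then 1 else σ i ^ κ i) := by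
      have h2 : σ j ^ (-κ j) = ∏ i, (if i = j then σ j ^ (-κ j) else 1) := by simp
      rw [h2, ← Finset.prod_mul_distrib]
      refine Finset.prod_congr rfl fun i _ => ?_
      split_ifs with hij
      · rw [hij, ← Real.rpow_add (hσ0 j), neg_add_cancel, Real.rpow_zero]
      · rw [one_mul]
    rw [h1]
    refine hprod _ (fun i => ?_) fun i => ?_
    · have := hσ0 i; split_ifs <;> positivity
    · split_ifs
      · norm_num
      · exact hσ3 i
  rw [poleNormSum, add_mul, one_mul, Finset.sum_mul]
  have h1 := hprod (fun j => σ j ^ κ j) (fun j => by have := hσ0 j; positivity) hσ3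
  have h2 : ∑ j, σ j ^ (-κ j) * ∏ i, σ i ^ κ i ≤ n * 3 ^ n := by
    have := Finset.sum_le_card_nsmul Finset.univ (fun j => σ j ^ (-κ j) * ∏ i, σ i ^ κ i) _
      fun j _ => hterm j
    simpa using this
  have h3 : ((n : ℝ) + 1) * 3 ^ n = 3 ^ n + n * 3 ^ n := by ring
  rw [h3]
  exact add_le_add h1 h2

/-- Composition with `inwardMap` trades the radial growth, damped at the points `x j`, for the
constant factor `a ^ (-p)`. -/
lemma growth_comp_inwardMap_le (hξ : ∀ k, ‖ξ k‖ = 1) (hp : 0 ≤ p) {q : Fin m → ℝ}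
    (hq : ∀ k, 0 ≤ q k) (hw : ‖w‖ < 1) :
    (1 - ‖inwardMap x κ a w‖) ^ (-p) * ((∏ j, ‖inwardMap x κ a w - x j‖ ^ (p * κ j)) *
        ∏ k, ‖inwardMap x κ a w - ξ k‖ ^ (-q k))
      ≤ ((c / 2) ^ (-p) * (∏ j, (1 + 2 / c) ^ (p * κ j)) * ((n + 1) * 3 ^ n) ^ p *
          ∏ k, (1 + 4 / c ^ 2) ^ q k) * a ^ (-p) * ∏ k, ‖w - ξ k‖ ^ (-q k) := by
  have hc := h.pos
  have ha := h.a_pos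
  set ψ := inwardMap x κ a w with hψ
  have hψ1 : ‖ψ‖ < 1 := h.norm_inwardMap_lt_one hw
  set T := poleNormSum x κ a w with hT
  have hT0 : 0 < T := one_pos.trans_le one_le_poleNormSum
  set P := ∏ j, ‖shiftedPole (x j) (κ j) a w‖ ^ κ j with hP
  have hP0 : 0 ≤ P := Finset.prod_nonneg fun _ _ => by positivity
  have h1 : (1 - ‖ψ‖) ^ (-p) ≤ (c / 2) ^ (-p) * a ^ (-p) * T ^ p := by
    refine (Real.rpow_le_rpow_of_nonpos (by positivity) (h.le_one_sub_norm_inwardMap hw)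
      (neg_nonpos.2 hp)).trans_eq ?_
    rw [Real.mul_rpow (by positivity) (by positivity), Real.div_rpow ha.le hT0.le,
      Real.rpow_neg hT0.le, div_inv_eq_mul, mul_assoc]
  have h2 : ∏ j, ‖ψ - x j‖ ^ (p * κ j) ≤ (∏ j, (1 + 2 / c) ^ (p * κ j)) * P ^ p := by
    rw [hP, ← Real.finsetProd_rpow _ _ fun _ _ => by positivity, ← Finset.prod_mul_distrib]
    refine Finset.prod_le_prod (fun _ _ => by positivity) fun j _ => ?_
    have hpκ : 0 ≤ p * κ j := mul_nonneg hp (h.nonneg j)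
    refine (Real.rpow_le_rpow (norm_nonneg _) (h.norm_inwardMap_sub_le_shiftedPole hw j)
      hpκ).trans_eq ?_
    rw [Real.mul_rpow (by positivity) (norm_nonneg _), ← Real.rpow_mul (norm_nonneg _),
      mul_comm (κ j)]
  have h3 : ∏ k, ‖ψ - ξ k‖ ^ (-q k)
      ≤ (∏ k, (1 + 4 / c ^ 2) ^ q k) * ∏ k, ‖w - ξ k‖ ^ (-q k) := by
    rw [← Finset.prod_mul_distrib]
    refine Finset.prod_le_prod (fun _ _ => by positivity) fun k _ => ?_
    have hwk := norm_sub_pos_of_norm_lt (hξ k) hw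
    have h4 : ‖w - ξ k‖ / (1 + 4 / c ^ 2) ≤ ‖ψ - ξ k‖ := by
      rw [div_le_iff₀' (by positivity)]
      exact h.norm_sub_le_inwardMap hw (hξ k)
    refine (Real.rpow_le_rpow_of_nonpos (by positivity) h4 (neg_nonpos.2 (hq k))).trans_eq ?_
    rw [Real.div_rpow hwk.le (by positivity), Real.rpow_neg (x := 1 + 4 / c ^ 2) (by positivity),
      div_inv_eq_mul, mul_comm]
  have h4 : T ^ p * P ^ p ≤ ((n + 1) * 3 ^ n) ^ p := by
    rw [← Real.mul_rpow hT0.le hP0]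
    exact Real.rpow_le_rpow (by positivity) (h.poleNormSum_mul_prod_le hw) hp
  have hQ : 0 ≤ ∏ k, (1 + 4 / c ^ 2) ^ q k := Finset.prod_nonneg fun _ _ => by positivity
  have hR : 0 ≤ ∏ j, (1 + 2 / c) ^ (p * κ j) := Finset.prod_nonneg fun _ _ => by positivity
  have hW : 0 ≤ ∏ k, ‖w - ξ k‖ ^ (-q k) := Finset.prod_nonneg fun _ _ => by positivity
  have hψ0 : 0 ≤ 1 - ‖ψ‖ := by linarith
  calc _ ≤ ((c / 2) ^ (-p) * a ^ (-p) * T ^ p) * (((∏ j, (1 + 2 / c) ^ (p * κ j)) * P ^ p) *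
          ((∏ k, (1 + 4 / c ^ 2) ^ q k) * ∏ k, ‖w - ξ k‖ ^ (-q k))) := by
        refine mul_le_mul h1 (mul_le_mul h2 h3 ?_ ?_) ?_ ?_
        · exact Finset.prod_nonneg fun _ _ => by positivity
        · positivity
        · exact mul_nonneg (Finset.prod_nonneg fun _ _ => by positivity)
            (Finset.prod_nonneg fun _ _ => by positivity)
        · positivity
    _ = ((c / 2) ^ (-p) * (∏ j, (1 + 2 / c) ^ (p * κ j)) * (T ^ p * P ^ p) *
          ∏ k, (1 + 4 / c ^ 2) ^ q k) * a ^ (-p) * ∏ k, ‖w - ξ k‖ ^ (-q k) := by ring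
    _ ≤ _ := by gcongr

end InwardData

lemma analyticOrderNatAt_le_comp {f g : ℂ → ℂ} (hf : AnalyticAt ℂ f (g w)) (hg : AnalyticAt ℂ g w)
    (hfg : analyticOrderAt (f ∘ g) w ≠ ⊤) :
    analyticOrderNatAt f (g w) ≤ analyticOrderNatAt (f ∘ g) w := by
  refine ENat.toNat_le_toNat ?_ hfg
  rw [hf.analyticOrderAt_comp hg]
  have h1 : analyticOrderAt (g · - g w) w ≠ 0 :=
    (hg.sub analyticAt_const).analyticOrderAt_ne_zero.2 (sub_self _)
  exact le_mul_of_one_le_right' (Order.one_le_iff_ne_zero.2 h1)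

lemma mul_prod_le_of_norm_sub_le (hξ : ∀ k, ‖ξ k‖ = 1) (hb : ∀ k, 0 ≤ b k) (hζ : ‖ζ‖ < 1)
    (hw : ‖w - ζ‖ ≤ (1 - ‖ζ‖) / 2) :
    (1 - ‖ζ‖) * ∏ k, ‖ζ - ξ k‖ ^ b k
      ≤ (2 * ∏ k, (2 : ℝ) ^ b k) * ((1 - ‖w‖) * ∏ k, ‖w - ξ k‖ ^ b k) := by
  have h1 : 1 - ‖ζ‖ ≤ 2 * (1 - ‖w‖) := by
    have := norm_sub_norm_le w ζ
    linarith
  have h2 : ∏ k, ‖ζ - ξ k‖ ^ b k ≤ (∏ k, (2 : ℝ) ^ b k) * ∏ k, ‖w - ξ k‖ ^ b k := by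
    rw [← Finset.prod_mul_distrib]
    refine Finset.prod_le_prod (fun _ _ => by positivity) fun k _ => ?_
    rw [← Real.mul_rpow (by norm_num) (norm_nonneg _)]
    refine Real.rpow_le_rpow (norm_nonneg _) ?_ (hb k)
    have h3 := norm_sub_le_norm_sub_add_norm_sub ζ w (ξ k)
    have h4 := one_sub_norm_le_norm_sub (hξ k) ζ
    rw [norm_sub_rev ζ w] at h3
    linarith
  refine (mul_le_mul h1 h2 (prod_rpow_nonneg ζ) (by linarith)).trans_eq ?_
  ring

/-- The contribution of the zeros whose weighted distance to the circle is at least of order `a`. -/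
theorem exists_sum_order_le_of_le_weightedDist (hξ : ∀ k, ‖ξ k‖ = 1) (hinj : Function.Injective ξ)
    (hb : ∀ k, 0 ≤ b k) (hs : ∀ k, 0 ≤ s k) (hs1 : ∀ k, s k < 1) (hp : 0 ≤ p)
    (x : Fin n → ℂ) (κ : Fin n → ℝ) (c : ℝ) :
    ∃ C : ℝ, 0 ≤ C ∧ ∀ a, InwardData x κ c a → ∀ (f : ℂ → ℂ) (K : ℝ),
      AnalyticOnNhd ℂ f (ball 0 1) → ‖f 0‖ = 1 → 0 < K →
      (∀ z ∈ ball (0 : ℂ) 1, Real.log ‖f z‖ ≤ K * ((1 - ‖z‖) ^ (-p) *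
        ((∏ j, ‖z - x j‖ ^ (p * κ j)) * ∏ k, ‖z - ξ k‖ ^ (-(b k + s k))))) →
      ∀ S : Finset ℂ, (∀ ζ ∈ S, ζ ∈ ball (0 : ℂ) 1 ∧ f ζ = 0) →
        (∀ ζ ∈ S, (n + 1) * (80 * a / c) ≤ weightedDist x κ ζ) →
        ∑ ζ ∈ S, (analyticOrderNatAt f ζ : ℝ) * ((1 - ‖ζ‖) * ∏ k, ‖ζ - ξ k‖ ^ b k)
          ≤ C * K * a ^ (-p) := by
  obtain ⟨C, hC, hA⟩ := exists_sum_order_mul_one_sub_norm_le hξ hinj hb hs hs1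
  rcases le_or_gt c 0 with hc0 | hc0
  · exact ⟨0, le_rfl, fun a h => absurd h.pos (not_lt.2 hc0)⟩
  set B := (c / 2) ^ (-p) * (∏ j, (1 + 2 / c) ^ (p * κ j)) * ((n + 1) * 3 ^ n) ^ p *
          ∏ k, (1 + 4 / c ^ 2) ^ (b k + s k) with hB
  have hB0 : 0 < B := by
    refine mul_pos (mul_pos (mul_pos (by positivity) ?_) (by positivity)) ?_
    · exact Finset.prod_pos fun _ _ => by positivity
    · exact Finset.prod_pos fun _ _ => by positivity
  set G := 2 * ∏ k, (2 : ℝ) ^ b k with hG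
  have hG0 : 0 ≤ G := mul_nonneg (by norm_num) (Finset.prod_nonneg fun _ _ => by positivity)
  refine ⟨G * (C * B), by positivity, fun a h f K hf h0 hK hu S hS hSD => ?_⟩
  have ha := h.a_pos
  set ψ := inwardMap x κ a with hψ
  have hψball : ∀ w ∈ ball (0 : ℂ) 1, ψ w ∈ ball (0 : ℂ) 1 := fun w hw =>
    mem_ball_zero_iff.2 (h.norm_inwardMap_lt_one (mem_ball_zero_iff.1 hw))
  have hψan : ∀ w ∈ ball (0 : ℂ) 1, AnalyticAt ℂ ψ w := fun w hw =>
    h.analyticAt_inwardMap (mem_ball_zero_iff.1 hw)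
  have hfan : AnalyticOnNhd ℂ (f ∘ ψ) (ball 0 1) := fun w hw =>
    (hf _ (hψball w hw)).comp (hψan w hw)
  have hf0 : ‖(f ∘ ψ) 0‖ = 1 := by
    rw [Function.comp_apply, show ψ 0 = 0 by simp [hψ, inwardMap], h0]
  have htop : ∀ w ∈ ball (0 : ℂ) 1, analyticOrderAt (f ∘ ψ) w ≠ ⊤ := fun w hw =>
    hfan.analyticOrderAt_ne_top_of_isPreconnected (convex_ball (0 : ℂ) 1).isPreconnected
      (mem_ball_self one_pos) hw (by
        rw [(hfan 0 (mem_ball_self one_pos)).analyticOrderAt_eq_zero.2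
          (norm_ne_zero_iff.1 (by rw [hf0]; exact one_ne_zero))]
        exact ENat.zero_ne_top)
  have huψ : ∀ w ∈ ball (0 : ℂ) 1, Real.log ‖(f ∘ ψ) w‖
      ≤ (K * (B * a ^ (-p))) * ∏ k, ‖w - ξ k‖ ^ (-(b k + s k)) := by
    intro w hw
    refine (hu _ (hψball w hw)).trans ?_
    rw [mul_assoc K]
    refine mul_le_mul_of_nonneg_left ?_ hK.le
    exact h.growth_comp_inwardMap_le hξ hp (fun k => add_nonneg (hb k) (hs k))
      (mem_ball_zero_iff.1 hw)
  choose! g hg using fun ζ (hζ : ζ ∈ S) =>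
    h.exists_inwardMap_eq (mem_ball_zero_iff.1 (hS ζ hζ).1) (hSD ζ hζ)
  have hgball : ∀ ζ ∈ S, g ζ ∈ ball (0 : ℂ) 1 := fun ζ hζ => mem_ball_zero_iff.2
    (norm_lt_one_of_norm_sub_le (mem_ball_zero_iff.1 (hS ζ hζ).1) (hg ζ hζ).1)
  have hginj : Set.InjOn g S := fun ζ hζ ζ' hζ' he => by
    rw [← (hg ζ hζ).2, ← (hg ζ' hζ').2, he]
  have hsum := hA (f ∘ ψ) (K * (B * a ^ (-p))) hfan hf0 (by positivity) huψ (S.image g)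
    fun w hw => by
      obtain ⟨ζ, hζ, rfl⟩ := Finset.mem_image.1 hw
      refine ⟨hgball ζ hζ, ?_⟩
      rw [Function.comp_apply, hψ, (hg ζ hζ).2, (hS ζ hζ).2]
  rw [Finset.sum_image hginj] at hsum
  calc ∑ ζ ∈ S, (analyticOrderNatAt f ζ : ℝ) * ((1 - ‖ζ‖) * ∏ k, ‖ζ - ξ k‖ ^ b k)
      ≤ ∑ ζ ∈ S, G * ((analyticOrderNatAt (f ∘ ψ) (g ζ) : ℝ) *
          ((1 - ‖g ζ‖) * ∏ k, ‖g ζ - ξ k‖ ^ b k)) := by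
        refine Finset.sum_le_sum fun ζ hζ => ?_
        have hζ1 := mem_ball_zero_iff.1 (hS ζ hζ).1
        have hgζ := mem_ball_zero_iff.1 (hgball ζ hζ)
        have h1 := mul_prod_le_of_norm_sub_le hξ hb hζ1 (hg ζ hζ).1
        have h2 : analyticOrderNatAt f ζ ≤ analyticOrderNatAt (f ∘ ψ) (g ζ) := by
          have := analyticOrderNatAt_le_comp (hf _ (hψball _ (hgball ζ hζ)))
            (hψan _ (hgball ζ hζ)) (htop _ (hgball ζ hζ))
          rwa [hψ, (hg ζ hζ).2] at this
        have h3 : (analyticOrderNatAt f ζ : ℝ) ≤ analyticOrderNatAt (f ∘ ψ) (g ζ) := by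
          exact_mod_cast h2
        refine (mul_le_mul h3 h1 (mul_nonneg (by linarith) (prod_rpow_nonneg ζ))
          (Nat.cast_nonneg _)).trans_eq ?_
        ring
    _ ≤ G * (C * (K * (B * a ^ (-p)))) := by
        rw [← Finset.mul_sum]
        exact mul_le_mul_of_nonneg_left hsum hG0
    _ = _ := by ring

end Composition

/-! ### Summation over dyadic scales -/

section Dyadic

variable {n m : ℕ} {x : Fin n → ℂ} {κ : Fin n → ℝ} {p ε : ℝ} {ζ : ℂ} {ξ : Fin m → ℂ}
  {b s : Fin m → ℝ}

lemma one_sub_norm_le_weightedDist (hζ : ‖ζ‖ < 1) : 1 - ‖ζ‖ ≤ weightedDist x κ ζ := by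
  rw [weightedDist]
  have : 0 ≤ ∑ j, ‖ζ - x j‖ ^ (-κ j) := Finset.sum_nonneg fun _ _ => by positivity
  nlinarith

lemma weightedDist_le (hx : ∀ j, ‖x j‖ = 1) (hκ : ∀ j, 0 ≤ κ j) (hκ1 : ∀ j, κ j < 1)
    (hζ : ‖ζ‖ < 1) : weightedDist x κ ζ ≤ 1 + n * 2 := by
  rw [weightedDist, mul_add, mul_one, Finset.mul_sum]
  have h1 : ∀ j, (1 - ‖ζ‖) * ‖ζ - x j‖ ^ (-κ j) ≤ 2 := fun j => by
    have h0 := norm_sub_pos_of_norm_lt (hx j) hζ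
    have h3 : 0 ≤ 1 - κ j := by linarith [hκ1 j]
    calc (1 - ‖ζ‖) * ‖ζ - x j‖ ^ (-κ j) ≤ ‖ζ - x j‖ * ‖ζ - x j‖ ^ (-κ j) := by
          gcongr; exact one_sub_norm_le_norm_sub (hx j) ζ
      _ = ‖ζ - x j‖ ^ (1 - κ j) := by
          rw [sub_eq_add_neg 1, Real.rpow_add h0, Real.rpow_one]
      _ ≤ 2 ^ (1 - κ j) := by gcongr; exact norm_sub_le_two (hx j) hζ
      _ ≤ 2 ^ (1 : ℝ) := Real.rpow_le_rpow_of_exponent_le (by norm_num) (by linarith [hκ j])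
      _ = 2 := Real.rpow_one _
  have h2 := Finset.sum_le_card_nsmul Finset.univ (fun j => (1 - ‖ζ‖) * ‖ζ - x j‖ ^ (-κ j)) 2
    fun j _ => h1 j
  simp only [Finset.card_univ, Fintype.card_fin, nsmul_eq_mul] at h2
  linarith [norm_nonneg ζ]

/-- The Blaschke-type condition with the weight expressed through `weightedDist`. -/
theorem exists_sum_order_mul_weightedDist_le (hξ : ∀ k, ‖ξ k‖ = 1) (hinj : Function.Injective ξ)
    (hb : ∀ k, 0 ≤ b k) (hs : ∀ k, 0 ≤ s k) (hs1 : ∀ k, s k < 1) (hp : 0 ≤ p)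
    (hx : ∀ j, ‖x j‖ = 1) (hκ : ∀ j, 0 ≤ κ j) (hκ1 : ∀ j, κ j < 1) (hε : 0 < ε) :
    ∃ C : ℝ, 0 ≤ C ∧ ∀ (f : ℂ → ℂ) (K : ℝ),
      AnalyticOnNhd ℂ f (ball 0 1) → ‖f 0‖ = 1 → 0 < K →
      (∀ z ∈ ball (0 : ℂ) 1, Real.log ‖f z‖ ≤ K * ((1 - ‖z‖) ^ (-p) *
        ((∏ j, ‖z - x j‖ ^ (p * κ j)) * ∏ k, ‖z - ξ k‖ ^ (-(b k + s k))))) →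
      ∀ S : Finset ℂ, (∀ ζ ∈ S, ζ ∈ ball (0 : ℂ) 1 ∧ f ζ = 0) →
        ∑ ζ ∈ S, (analyticOrderNatAt f ζ : ℝ) *
          (((1 - ‖ζ‖) * ∏ k, ‖ζ - ξ k‖ ^ b k) * weightedDist x κ ζ ^ (p + ε)) ≤ C * K := by
  obtain ⟨c, hc, hc1, hcos⟩ := exists_le_cos hκ hκ1
  obtain ⟨C, hC, hmain⟩ := exists_sum_order_le_of_le_weightedDist hξ hinj hb hs hs1 hp x κ c
  set N : ℝ := 80 * (n + 1) with hN
  have hN0 : 0 < N := by positivity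
  set θ : ℝ := (1 / 2) ^ ε with hθ
  have hθ0 : 0 ≤ θ := by positivity
  have hθ1 : θ < 1 := Real.rpow_lt_one (by norm_num) (by norm_num) hε
  -- `weightedDist` is at most `1 + 2 n ≤ N`, so at every zero it lies in `[N α / c, 2 N α / c]` for
  -- one of the following scales `α`
  set α : ℕ → ℝ := fun l => c * (1 / 2) ^ (l + 1) with hα
  have hα0 : ∀ l, 0 < α l := fun l => by positivity
  have hαl : ∀ l, α l ≤ (1 / 2) ^ l := fun l => by
    rw [hα]
    calc c * (1 / 2) ^ (l + 1) ≤ 1 * (1 / 2) ^ (l + 1) := by gcongr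
      _ ≤ (1 / 2) ^ l := by
          rw [one_mul, pow_succ]
          linarith [show (0 : ℝ) < (1 / 2) ^ l by positivity]
  have hdata : ∀ l, InwardData x κ c (α l) := fun l =>
    ⟨hx, hκ, hκ1, hc, hc1, hcos, hα0 l, mul_le_of_le_one_right hc.le
      (pow_le_one₀ (by norm_num) (by norm_num))⟩
  set E := (2 * N / c) ^ (p + ε) with hE
  have hE0 : 0 ≤ E := by positivity
  refine ⟨E * (C * (1 - θ)⁻¹), by have := sub_pos.2 hθ1; positivity,
    fun f K hf h0 hK hu S hS => ?_⟩
  have hlev : ∀ ζ ∈ S, ∃ l : ℕ, (n + 1) * (80 * α l / c) ≤ weightedDist x κ ζ ∧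
      weightedDist x κ ζ ≤ 2 * N / c * α l := by
    intro ζ hζ
    have hζ1 := mem_ball_zero_iff.1 (hS ζ hζ).1
    have h1 := weightedDist_le hx hκ hκ1 hζ1
    have h2 : 0 < weightedDist x κ ζ :=
      lt_of_lt_of_le (by linarith) (one_sub_norm_le_weightedDist hζ1)
    obtain ⟨l, hl1, hl2⟩ := exists_nat_pow_near_of_lt_one (x := weightedDist x κ ζ / N)
      (by positivity) (by rw [div_le_one hN0, hN]; linarith [Nat.cast_nonneg (α := ℝ) n])
      (y := 1 / 2) (by norm_num) (by norm_num)
    rw [lt_div_iff₀ hN0] at hl1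
    rw [div_le_iff₀ hN0] at hl2
    refine ⟨l, ?_, ?_⟩
    · refine le_trans (le_of_eq ?_) hl1.le
      rw [hα, hN]; field_simp
    · refine hl2.trans_eq ?_
      simp only [hα, pow_succ]; field_simp
  choose! lev hlev1 hlev2 using hlev
  set A : ℂ → ℝ := fun ζ =>
    (analyticOrderNatAt f ζ : ℝ) * ((1 - ‖ζ‖) * ∏ k, ‖ζ - ξ k‖ ^ b k) with hA
  have hA0 : ∀ ζ ∈ S, 0 ≤ A ζ := fun ζ hζ => mul_nonneg (Nat.cast_nonneg _) (mul_nonneg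
    (by linarith [mem_ball_zero_iff.1 (hS ζ hζ).1]) (prod_rpow_nonneg ζ))
  have hpε : 0 ≤ p + ε := by linarith
  calc ∑ ζ ∈ S, (analyticOrderNatAt f ζ : ℝ) *
          (((1 - ‖ζ‖) * ∏ k, ‖ζ - ξ k‖ ^ b k) * weightedDist x κ ζ ^ (p + ε))
      ≤ ∑ ζ ∈ S, E * (A ζ * α (lev ζ) ^ (p + ε)) := by
        refine Finset.sum_le_sum fun ζ hζ => ?_
        have hζ1 := mem_ball_zero_iff.1 (hS ζ hζ).1
        have h1 : weightedDist x κ ζ ^ (p + ε) ≤ E * α (lev ζ) ^ (p + ε) := by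
          rw [hE, ← Real.mul_rpow (by positivity) (hα0 _).le]
          exact Real.rpow_le_rpow (by linarith [one_sub_norm_le_weightedDist (x := x) (κ := κ) hζ1])
            (hlev2 ζ hζ) hpε
        rw [← mul_assoc]
        refine (mul_le_mul_of_nonneg_left h1 (hA0 ζ hζ)).trans_eq ?_
        ring
    _ = E * ∑ l ∈ S.image lev, ∑ ζ ∈ S with lev ζ = l, A ζ * α (lev ζ) ^ (p + ε) := by
        rw [← Finset.mul_sum, Finset.sum_fiberwise_of_maps_to
          fun ζ hζ => Finset.mem_image_of_mem lev hζ]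
    _ ≤ E * ∑ l ∈ S.image lev, C * K * θ ^ l := by
        refine mul_le_mul_of_nonneg_left (Finset.sum_le_sum fun l _ => ?_) hE0
        have h1 : ∑ ζ ∈ S with lev ζ = l, A ζ * α (lev ζ) ^ (p + ε)
            = (∑ ζ ∈ S with lev ζ = l, A ζ) * α l ^ (p + ε) := by
          rw [Finset.sum_mul]
          refine Finset.sum_congr rfl fun ζ hζ => ?_
          rw [(Finset.mem_filter.1 hζ).2]
        have h2 := hmain (α l) (hdata l) f K hf h0 hK hu (S.filter fun ζ => lev ζ = l)
          (fun ζ hζ => hS ζ (Finset.mem_filter.1 hζ).1) fun ζ hζ => by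
            have := hlev1 ζ (Finset.mem_filter.1 hζ).1
            rwa [(Finset.mem_filter.1 hζ).2] at this
        have h3 : α l ^ ε ≤ θ ^ l := by
          rw [hθ, ← Real.rpow_natCast, ← Real.rpow_mul (by norm_num), mul_comm,
            Real.rpow_mul (by norm_num), Real.rpow_natCast]
          exact Real.rpow_le_rpow (hα0 l).le (hαl l) hε.le
        rw [h1]
        calc _ ≤ C * K * α l ^ (-p) * α l ^ (p + ε) := by
              have := hα0 l
              gcongr
          _ = C * K * α l ^ ε := by
              rw [mul_assoc, ← Real.rpow_add (hα0 l)]; congr 2; ring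
          _ ≤ _ := by gcongr
    _ ≤ E * (C * K * (1 - θ)⁻¹) := by
        rw [← Finset.mul_sum, ← tsum_geometric_of_lt_one hθ0 hθ1]
        gcongr
        exact (summable_geometric_of_lt_one hθ0 hθ1).sum_le_tsum _ fun _ _ => by positivity
    _ = _ := by ring

end Dyadic

/-! ### Comparison of weights -/

section Weights

variable {n m : ℕ} {x : Fin n → ℂ} {ξ : Fin m → ℂ} {z : ℂ}

lemma prod_rpow_le_mul_prod_rpow (hx : ∀ j, ‖x j‖ = 1) {e e' : Fin n → ℝ} (he : ∀ j, e j ≤ e' j)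
    (hz : ‖z‖ < 1) :
    ∏ j, ‖z - x j‖ ^ e' j ≤ (∏ j, (2 : ℝ) ^ (e' j - e j)) * ∏ j, ‖z - x j‖ ^ e j := by
  rw [← Finset.prod_mul_distrib]
  refine Finset.prod_le_prod (fun _ _ => by positivity) fun j _ => ?_
  have h0 := norm_sub_pos_of_norm_lt (hx j) hz
  calc ‖z - x j‖ ^ e' j = ‖z - x j‖ ^ (e' j - e j) * ‖z - x j‖ ^ e j := by
        rw [← Real.rpow_add h0, sub_add_cancel]
    _ ≤ _ := by
        have h1 := sub_nonneg.2 (he j)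
        gcongr
        exact norm_sub_le_two (hx j) hz

lemma growth_le_growth (hx : ∀ j, ‖x j‖ = 1) {p K : ℝ} (hK : 0 < K) {κ r : Fin n → ℝ}
    (hr : ∀ j, p * κ j ≤ r j) (q : Fin m → ℝ) (hz : ‖z‖ < 1) :
    K / (1 - ‖z‖) ^ p * ((∏ j, ‖z - x j‖ ^ r j) / ∏ k, ‖z - ξ k‖ ^ q k)
      ≤ (K * ∏ j, (2 : ℝ) ^ (r j - p * κ j)) * ((1 - ‖z‖) ^ (-p) *
        ((∏ j, ‖z - x j‖ ^ (p * κ j)) * ∏ k, ‖z - ξ k‖ ^ (-q k))) := by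
  have h1 := prod_rpow_le_mul_prod_rpow hx hr hz
  have h2 : (∏ k, ‖z - ξ k‖ ^ q k)⁻¹ = ∏ k, ‖z - ξ k‖ ^ (-q k) := by
    rw [← Finset.prod_inv_distrib]
    exact Finset.prod_congr rfl fun k _ => (Real.rpow_neg (norm_nonneg _) _).symm
  have h3 : 0 ≤ 1 - ‖z‖ := by linarith
  rw [div_eq_mul_inv, div_eq_mul_inv, h2, ← Real.rpow_neg h3]
  have h4 : 0 ≤ ∏ k, ‖z - ξ k‖ ^ (-q k) := Finset.prod_nonneg fun _ _ => by positivity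
  calc _ ≤ K * (1 - ‖z‖) ^ (-p) * (((∏ j, (2 : ℝ) ^ (r j - p * κ j)) *
        ∏ j, ‖z - x j‖ ^ (p * κ j)) * ∏ k, ‖z - ξ k‖ ^ (-q k)) := by gcongr
    _ = _ := by ring

lemma rpow_mul_rpow_neg_le_weightedDist (hx : ∀ j, ‖x j‖ = 1) {κ : Fin n → ℝ} {p ε : ℝ}
    (hp : 0 ≤ p) (hε : 0 < ε) {j : Fin n} {e : ℝ} (he0 : p * κ j ≤ e)
    (he : e ≤ p * κ j + ε / 2) (hz : ‖z‖ < 1) :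
    (1 - ‖z‖) ^ (p + ε) * ‖z - x j‖ ^ (-e) ≤ weightedDist x κ z ^ (p + ε / 2) := by
  have hd : 0 < 1 - ‖z‖ := by linarith
  have hj := norm_sub_pos_of_norm_lt (hx j) hz
  have h1 : ‖z - x j‖ ^ (-e) ≤ ‖z - x j‖ ^ (-(p * κ j)) * (1 - ‖z‖) ^ (-(e - p * κ j)) := by
    rw [show -e = -(p * κ j) + -(e - p * κ j) by ring, Real.rpow_add hj]
    refine mul_le_mul_of_nonneg_left ?_ (by positivity)
    exact Real.rpow_le_rpow_of_nonpos hd (one_sub_norm_le_norm_sub (hx j) z) (by linarith)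
  set T := 1 + ∑ j, ‖z - x j‖ ^ (-κ j) with hT
  have hsum : 0 ≤ ∑ j, ‖z - x j‖ ^ (-κ j) := Finset.sum_nonneg fun _ _ => by positivity
  have hT1 : 1 ≤ T := by linarith
  have h2 : ‖z - x j‖ ^ (-(p * κ j)) ≤ T ^ (p + ε / 2) := by
    rw [show -(p * κ j) = -κ j * p by ring, Real.rpow_mul hj.le]
    calc (‖z - x j‖ ^ (-κ j)) ^ p ≤ T ^ p := by
          gcongr
          have := Finset.single_le_sum (f := fun j => ‖z - x j‖ ^ (-κ j))
            (fun _ _ => by positivity) (Finset.mem_univ j)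
          linarith
      _ ≤ T ^ (p + ε / 2) := Real.rpow_le_rpow_of_exponent_le hT1 (by linarith)
  calc _ ≤ (1 - ‖z‖) ^ (p + ε) * (T ^ (p + ε / 2) * (1 - ‖z‖) ^ (-(e - p * κ j))) := by
        gcongr
        exact h1.trans (by gcongr)
    _ = (1 - ‖z‖) ^ (p + ε + -(e - p * κ j)) * T ^ (p + ε / 2) := by
        rw [Real.rpow_add hd (p + ε)]; ring
    _ ≤ (1 - ‖z‖) ^ (p + ε / 2) * T ^ (p + ε / 2) := by
        refine mul_le_mul_of_nonneg_right ?_ (by positivity)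
        exact Real.rpow_le_rpow_of_exponent_ge hd (by linarith [norm_nonneg z]) (by linarith)
    _ = _ := by rw [weightedDist, Real.mul_rpow hd.le (by linarith)]

/-- Comparison of the weights at the points `x j`; the exponents `p * κ j` may fall short of `e j`
by `ε / 2`. -/
lemma exists_weight_le (hx : ∀ j, ‖x j‖ = 1) (hinj : Function.Injective x) {κ e : Fin n → ℝ}
    {p ε : ℝ} (hp : 0 ≤ p) (hε : 0 < ε) (he : ∀ j, 0 ≤ e j) (he0 : ∀ j, p * κ j ≤ e j)
    (he1 : ∀ j, e j ≤ p * κ j + ε / 2) :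
    ∃ C : ℝ, 0 < C ∧ ∀ z : ℂ, ‖z‖ < 1 →
      (1 - ‖z‖) ^ (p + ε) / ∏ j, ‖z - x j‖ ^ e j ≤ C * weightedDist x κ z ^ (p + ε / 2) := by
  obtain ⟨C, hC, h⟩ := exists_prod_rpow_neg_le hx hinj he
  refine ⟨C * (1 + n), by positivity, fun z hz => ?_⟩
  have hd : 0 < 1 - ‖z‖ := by linarith
  have h2 : (∏ j, ‖z - x j‖ ^ e j)⁻¹ = ∏ j, ‖z - x j‖ ^ (-e j) := by
    rw [← Finset.prod_inv_distrib]
    exact Finset.prod_congr rfl fun k _ => (Real.rpow_neg (norm_nonneg _) _).symm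
  have h3 : (1 - ‖z‖) ^ (p + ε) ≤ weightedDist x κ z ^ (p + ε / 2) :=
    calc (1 - ‖z‖) ^ (p + ε) ≤ (1 - ‖z‖) ^ (p + ε / 2) :=
          Real.rpow_le_rpow_of_exponent_ge hd (by linarith [norm_nonneg z]) (by linarith)
      _ ≤ _ := Real.rpow_le_rpow hd.le (one_sub_norm_le_weightedDist hz) (by linarith)
  have h4 := Finset.sum_le_card_nsmul Finset.univ
    (fun j => (1 - ‖z‖) ^ (p + ε) * ‖z - x j‖ ^ (-e j)) _
    fun j _ => rpow_mul_rpow_neg_le_weightedDist hx hp hε (he0 j) (he1 j) hz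
  simp only [Finset.card_univ, Fintype.card_fin, nsmul_eq_mul] at h4
  rw [div_eq_mul_inv, h2]
  calc _ ≤ (1 - ‖z‖) ^ (p + ε) * (C * (1 + ∑ j, ‖z - x j‖ ^ (-e j))) := by
        gcongr; exact h z hz
    _ = C * ((1 - ‖z‖) ^ (p + ε) + ∑ j, (1 - ‖z‖) ^ (p + ε) * ‖z - x j‖ ^ (-e j)) := by
        rw [← Finset.mul_sum]; ring
    _ ≤ C * (weightedDist x κ z ^ (p + ε / 2) + n * weightedDist x κ z ^ (p + ε / 2)) := by
        gcongr
    _ = _ := by ring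

end Weights

/-! ### From finite sets of zeros to `diskZeroSum` -/

lemma diskZeroSum_le_of_forall_finset {f : ℂ → ℂ} (hf : AnalyticOnNhd ℂ f (ball 0 1))
    (h0 : ‖f 0‖ = 1) {w : ℂ → ℝ} (hw : ∀ z ∈ ball (0 : ℂ) 1, 0 ≤ w z) {B : ℝ}
    (hB : ∀ S : Finset ℂ, (∀ ζ ∈ S, ζ ∈ ball (0 : ℂ) 1 ∧ f ζ = 0) →
      ∑ ζ ∈ S, (analyticOrderNatAt f ζ : ℝ) * w ζ ≤ B) :
    diskZeroSum f w ≤ ENNReal.ofReal B := by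
  rw [diskZeroSum, ENNReal.tsum_eq_iSup_sum]
  refine iSup_le fun S => ?_
  have hterm : ∀ ζ : {z : ℂ // z ∈ ball (0 : ℂ) 1 ∧ f z = 0},
      ((analyticOrderAt f (ζ : ℂ) : ℕ∞) : ℝ≥0∞) * ENNReal.ofReal (w ζ)
        = ENNReal.ofReal ((analyticOrderNatAt f ζ : ℝ) * w ζ) := by
    intro ζ
    have htop : analyticOrderAt f (ζ : ℂ) ≠ ⊤ :=
      hf.analyticOrderAt_ne_top_of_isPreconnected (convex_ball (0 : ℂ) 1).isPreconnected
        (mem_ball_self one_pos) ζ.2.1 (by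
          rw [(hf 0 (mem_ball_self one_pos)).analyticOrderAt_eq_zero.2
            (norm_ne_zero_iff.1 (by rw [h0]; exact one_ne_zero))]
          exact ENat.zero_ne_top)
    rw [ENNReal.ofReal_mul (Nat.cast_nonneg _), ENNReal.ofReal_natCast,
      ← Nat.cast_analyticOrderNatAt htop, ENat.toENNReal_coe]
  have h1 := hB (S.map (Function.Embedding.subtype _)) fun ζ hζ => by
    obtain ⟨ζ', _, rfl⟩ := Finset.mem_map.1 hζ
    exact ζ'.2
  rw [Finset.sum_map] at h1
  have h2 : ∀ ζ ∈ S, 0 ≤ (analyticOrderNatAt f (ζ : ℂ) : ℝ) * w ζ := fun ζ _ =>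
    mul_nonneg (Nat.cast_nonneg _) (hw _ ζ.2.1)
  rw [Finset.sum_congr rfl fun ζ _ => hterm ζ, ← ENNReal.ofReal_sum_of_nonneg h2]
  exact ENNReal.ofReal_le_ofReal h1

/-! ### The two cases -/

section Cases

variable {n m : ℕ} {ζ₀ : Fin n → ℂ} {ξ : Fin m → ℂ} {r : Fin n → ℝ} {q : Fin m → ℝ} {ε : ℝ}

/-- The exponents `max (q k - 1 + ε) 0` may be replaced by those for a smaller `ε`. -/
lemma max_sub_one_add_min_le (q ε : ℝ) : max (q - 1 + min ε 1) 0 ≤ max (q - 1 + ε) 0 :=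
  max_le_max (by linarith [min_le_left ε 1]) le_rfl

lemma sub_max_nonneg {q : ℝ} (hq : 0 ≤ q) (ε : ℝ) : 0 ≤ q - max (q - 1 + min ε 1) 0 :=
  sub_nonneg.2 (max_le (by linarith [min_le_right ε 1]) hq)

lemma sub_max_lt_one (q : ℝ) {ε : ℝ} (hε : 0 < ε) : q - max (q - 1 + min ε 1) 0 < 1 := by
  have h1 := le_max_left (q - 1 + min ε 1) 0
  have h2 : 0 < min ε 1 := lt_min hε one_pos
  linarith

lemma exists_sum_order_mul_le_of_radially_bounded (hζ₀ : ∀ j, ‖ζ₀ j‖ = 1) (hξ : ∀ k, ‖ξ k‖ = 1)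
    (hinj : Function.Injective ξ) (hr : ∀ j, 0 ≤ r j) (hq : ∀ k, 0 ≤ q k) (hε : 0 < ε) :
    ∃ C : ℝ, 0 ≤ C ∧ ∀ (f : ℂ → ℂ) (K : ℝ), AnalyticOnNhd ℂ f (ball 0 1) → ‖f 0‖ = 1 → 0 < K →
      (∀ z ∈ ball (0 : ℂ) 1, Real.log ‖f z‖ ≤ K / (1 - ‖z‖) ^ (0 : ℝ) *
        ((∏ j, ‖z - ζ₀ j‖ ^ r j) / ∏ k, ‖z - ξ k‖ ^ q k)) →
      ∀ S : Finset ℂ, (∀ ζ ∈ S, ζ ∈ ball (0 : ℂ) 1 ∧ f ζ = 0) →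
        ∑ ζ ∈ S, (analyticOrderNatAt f ζ : ℝ) * ((1 - ‖ζ‖) *
          ((∏ k, ‖ζ - ξ k‖ ^ max (q k - 1 + ε) 0) / ∏ j, ‖ζ - ζ₀ j‖ ^ min 0 (r j))) ≤ C * K := by
  set b : Fin m → ℝ := fun k => max (q k - 1 + min ε 1) 0 with hb
  obtain ⟨C, hC, h⟩ := exists_sum_order_mul_one_sub_norm_le hξ hinj (b := b)
    (s := fun k => q k - b k) (fun k => le_max_right _ _) (fun k => sub_max_nonneg (hq k) ε)
    fun k => sub_max_lt_one (q k) hε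
  set R := ∏ j, (2 : ℝ) ^ (r j - 0 * 0) with hR
  have hR0 : 0 < R := Finset.prod_pos fun _ _ => by positivity
  set B := ∏ k, (2 : ℝ) ^ (max (q k - 1 + ε) 0 - b k) with hB
  have hB0 : 0 < B := Finset.prod_pos fun _ _ => by positivity
  refine ⟨B * (C * R), by positivity, fun f K hf h0 hK hu S hS => ?_⟩
  have hu' : ∀ z ∈ ball (0 : ℂ) 1,
      Real.log ‖f z‖ ≤ (K * R) * ∏ k, ‖z - ξ k‖ ^ (-(b k + (q k - b k))) := fun z hz => by
    have h1 := (hu z hz).trans (growth_le_growth (ξ := ξ) hζ₀ hK (p := 0) (κ := fun _ => 0)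
      (fun j => by simpa using hr j) q (mem_ball_zero_iff.1 hz))
    simpa [hR] using h1
  calc _ ≤ ∑ ζ ∈ S, B * ((analyticOrderNatAt f ζ : ℝ) * ((1 - ‖ζ‖) * ∏ k, ‖ζ - ξ k‖ ^ b k)) := by
        refine Finset.sum_le_sum fun ζ hζ => ?_
        have hζ1 := mem_ball_zero_iff.1 (hS ζ hζ).1
        have h1 := prod_rpow_le_mul_prod_rpow hξ (fun k => max_sub_one_add_min_le (q k) ε) hζ1
        have h2 : ∏ j, ‖ζ - ζ₀ j‖ ^ min 0 (r j) = 1 :=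
          Finset.prod_eq_one fun j _ => by rw [min_eq_left (hr j), Real.rpow_zero]
        have h3 : 0 ≤ (analyticOrderNatAt f ζ : ℝ) * (1 - ‖ζ‖) :=
          mul_nonneg (Nat.cast_nonneg _) (by linarith)
        rw [h2, div_one, ← mul_assoc]
        refine (mul_le_mul_of_nonneg_left h1 h3).trans_eq ?_
        ring
    _ ≤ B * (C * (K * R)) := by
        rw [← Finset.mul_sum]
        exact mul_le_mul_of_nonneg_left (h f (K * R) hf h0 (by positivity) hu' S hS) hB0.le
    _ = _ := by ring

lemma exists_sum_order_mul_le_of_pos (hζ₀ : ∀ j, ‖ζ₀ j‖ = 1) (hξ : ∀ k, ‖ξ k‖ = 1)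
    (hζ₀_inj : Function.Injective ζ₀) (hinj : Function.Injective ξ) {p : ℝ} (hp : 0 < p)
    (hr : ∀ j, 0 ≤ r j) (hq : ∀ k, 0 ≤ q k) (hε : 0 < ε) :
    ∃ C : ℝ, 0 ≤ C ∧ ∀ (f : ℂ → ℂ) (K : ℝ), AnalyticOnNhd ℂ f (ball 0 1) → ‖f 0‖ = 1 → 0 < K →
      (∀ z ∈ ball (0 : ℂ) 1, Real.log ‖f z‖ ≤ K / (1 - ‖z‖) ^ p *
        ((∏ j, ‖z - ζ₀ j‖ ^ r j) / ∏ k, ‖z - ξ k‖ ^ q k)) →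
      ∀ S : Finset ℂ, (∀ ζ ∈ S, ζ ∈ ball (0 : ℂ) 1 ∧ f ζ = 0) →
        ∑ ζ ∈ S, (analyticOrderNatAt f ζ : ℝ) * ((1 - ‖ζ‖) ^ (p + 1 + ε) *
          ((∏ k, ‖ζ - ξ k‖ ^ max (q k - 1 + ε) 0) / ∏ j, ‖ζ - ζ₀ j‖ ^ min p (r j))) ≤ C * K := by
  set b : Fin m → ℝ := fun k => max (q k - 1 + min ε 1) 0 with hb
  -- lowering the exponents by `ε / 2` makes all `κ j` smaller than `1`
  set κ : Fin n → ℝ := fun j => max (min p (r j) - ε / 2) 0 / p with hκ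
  have hpκ : ∀ j, p * κ j = max (min p (r j) - ε / 2) 0 := fun j => mul_div_cancel₀ _ hp.ne'
  have hκ0 : ∀ j, 0 ≤ κ j := fun j => div_nonneg (le_max_right _ _) hp.le
  have hκ1 : ∀ j, κ j < 1 := fun j =>
    (div_lt_one hp).2 (max_lt (by linarith [min_le_left p (r j)]) hp)
  have hmin : ∀ j, 0 ≤ min p (r j) := fun j => le_min hp.le (hr j)
  have hκe : ∀ j, p * κ j ≤ min p (r j) := fun j => by
    rw [hpκ]; exact max_le (by linarith) (hmin j)
  have hκe' : ∀ j, min p (r j) ≤ p * κ j + ε / 2 := fun j => by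
    rw [hpκ]; linarith [le_max_left (min p (r j) - ε / 2) 0]
  obtain ⟨C, hC, h⟩ := exists_sum_order_mul_weightedDist_le hξ hinj (b := b)
    (s := fun k => q k - b k) (fun k => le_max_right _ _) (fun k => sub_max_nonneg (hq k) ε)
    (fun k => sub_max_lt_one (q k) hε) hp.le hζ₀ hκ0 hκ1 (half_pos hε)
  obtain ⟨A, hA, hAle⟩ := exists_weight_le hζ₀ hζ₀_inj hp.le hε hmin hκe hκe'
  set R := ∏ j, (2 : ℝ) ^ (r j - p * κ j) with hR
  have hR0 : 0 < R := Finset.prod_pos fun _ _ => by positivity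
  set B := ∏ k, (2 : ℝ) ^ (max (q k - 1 + ε) 0 - b k) with hB
  have hB0 : 0 < B := Finset.prod_pos fun _ _ => by positivity
  refine ⟨A * B * (C * R), by positivity, fun f K hf h0 hK hu S hS => ?_⟩
  have hu' : ∀ z ∈ ball (0 : ℂ) 1, Real.log ‖f z‖ ≤ (K * R) * ((1 - ‖z‖) ^ (-p) *
        ((∏ j, ‖z - ζ₀ j‖ ^ (p * κ j)) * ∏ k, ‖z - ξ k‖ ^ (-(b k + (q k - b k))))) :=
    fun z hz => by
      simp only [add_sub_cancel]
      exact (hu z hz).trans (growth_le_growth hζ₀ hK (fun j => (hκe j).trans (min_le_right _ _)) q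
        (mem_ball_zero_iff.1 hz))
  calc _ ≤ ∑ ζ ∈ S, A * B * ((analyticOrderNatAt f ζ : ℝ) *
          (((1 - ‖ζ‖) * ∏ k, ‖ζ - ξ k‖ ^ b k) * weightedDist ζ₀ κ ζ ^ (p + ε / 2))) := by
        refine Finset.sum_le_sum fun ζ hζ => ?_
        have hζ1 := mem_ball_zero_iff.1 (hS ζ hζ).1
        have hd : 0 < 1 - ‖ζ‖ := by linarith
        have h1 := prod_rpow_le_mul_prod_rpow hξ (fun k => max_sub_one_add_min_le (q k) ε) hζ1
        have h2 := hAle ζ hζ1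
        have h3 : 0 ≤ (analyticOrderNatAt f ζ : ℝ) * (1 - ‖ζ‖) :=
          mul_nonneg (Nat.cast_nonneg _) hd.le
        have h4 : 0 ≤ (1 - ‖ζ‖) ^ (p + ε) / ∏ j, ‖ζ - ζ₀ j‖ ^ min p (r j) :=
          div_nonneg (by positivity) (prod_rpow_nonneg ζ)
        rw [show p + 1 + ε = 1 + (p + ε) by ring, Real.rpow_add hd, Real.rpow_one]
        calc _ = (analyticOrderNatAt f ζ : ℝ) * (1 - ‖ζ‖) *
              ((∏ k, ‖ζ - ξ k‖ ^ max (q k - 1 + ε) 0) *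
                ((1 - ‖ζ‖) ^ (p + ε) / ∏ j, ‖ζ - ζ₀ j‖ ^ min p (r j))) := by ring
          _ ≤ (analyticOrderNatAt f ζ : ℝ) * (1 - ‖ζ‖) *
              ((B * ∏ k, ‖ζ - ξ k‖ ^ b k) * (A * weightedDist ζ₀ κ ζ ^ (p + ε / 2))) :=
            mul_le_mul_of_nonneg_left (mul_le_mul h1 h2 h4
              (mul_nonneg hB0.le (prod_rpow_nonneg ζ))) h3
          _ = _ := by ring
    _ ≤ A * B * (C * (K * R)) := by
        rw [← Finset.mul_sum]
        exact mul_le_mul_of_nonneg_left (h f (K * R) hf h0 (by positivity) hu' S hS)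
          (by positivity)
    _ = _ := by ring

lemma weight_nonneg {a e : ℝ} (ha : 0 ≤ a) {u : Fin m → ℝ} {v : Fin n → ℝ} (z : ℂ) :
    0 ≤ a ^ e * ((∏ k, ‖z - ξ k‖ ^ u k) / ∏ j, ‖z - ζ₀ j‖ ^ v j) :=
  mul_nonneg (by positivity) (div_nonneg (prod_rpow_nonneg z) (prod_rpow_nonneg z))

end Cases

end BlaschkeCondition

theorem theorem0p2 (n m : ℕ) (ζ₀ : Fin n → ℂ) (ξ : Fin m → ℂ)
    (hζ₀ : ∀ j, ‖ζ₀ j‖ = 1) (hξ : ∀ k, ‖ξ k‖ = 1)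
    (hζ₀_inj : Function.Injective ζ₀) (hξ_inj : Function.Injective ξ)
    (hdisj : ∀ j k, ζ₀ j ≠ ξ k)
    (p : ℝ) (hp : 0 ≤ p) (r : Fin n → ℝ) (hr : ∀ j, 0 ≤ r j)
    (q : Fin m → ℝ) (hq : ∀ k, 0 ≤ q k) (ε : ℝ) (hε : 0 < ε) :
    ∃ C : ℝ, 0 < C ∧
      ∀ (f : ℂ → ℂ) (K : ℝ), AnalyticOnNhd ℂ f (Metric.ball (0 : ℂ) 1) → ‖f 0‖ = 1 → 0 < K →
        (∀ z ∈ Metric.ball (0 : ℂ) 1,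
          Real.log ‖f z‖ ≤ K / (1 - ‖z‖) ^ p *
            ((∏ j, ‖z - ζ₀ j‖ ^ r j) / ∏ k, ‖z - ξ k‖ ^ q k)) →
        diskZeroSum f (fun ζ => (1 - ‖ζ‖) ^ (p + 1 + ε) *
            ((∏ k, ‖ζ - ξ k‖ ^ max (q k - 1 + ε) 0) / ∏ j, ‖ζ - ζ₀ j‖ ^ min p (r j)))
          ≤ ENNReal.ofReal (C * K) ∧
        (p = 0 →
          diskZeroSum f (fun ζ => (1 - ‖ζ‖) *
              ((∏ k, ‖ζ - ξ k‖ ^ max (q k - 1 + ε) 0) / ∏ j, ‖ζ - ζ₀ j‖ ^ min p (r j)))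
            ≤ ENNReal.ofReal (C * K)) := by
  have hd : ∀ z ∈ Metric.ball (0 : ℂ) 1, 0 ≤ 1 - ‖z‖ := fun z hz => by
    linarith [mem_ball_zero_iff.1 hz]
  rcases hp.eq_or_lt with rfl | hp
  · obtain ⟨C, hC, h⟩ := exists_sum_order_mul_le_of_radially_bounded hζ₀ hξ hξ_inj hr hq hε
    refine ⟨C + 1, by positivity, fun f K hf h0 hK hu => ?_⟩
    have hle : diskZeroSum f (fun ζ => (1 - ‖ζ‖) *
              ((∏ k, ‖ζ - ξ k‖ ^ max (q k - 1 + ε) 0) / ∏ j, ‖ζ - ζ₀ j‖ ^ min 0 (r j)))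
            ≤ ENNReal.ofReal ((C + 1) * K) := by
      refine (diskZeroSum_le_of_forall_finset hf h0 (fun z hz => ?_) (h f K hf h0 hK hu)).trans
        (ENNReal.ofReal_le_ofReal (by gcongr; linarith))
      simpa using weight_nonneg (ζ₀ := ζ₀) (ξ := ξ) (e := 1) (hd z hz) z
    refine ⟨le_trans (ENNReal.tsum_le_tsum fun ζ => ?_) hle, fun _ => hle⟩
    gcongr
    refine mul_le_mul_of_nonneg_right ?_ (div_nonneg (prod_rpow_nonneg _) (prod_rpow_nonneg _))
    have h1 : 0 < 1 - ‖(ζ : ℂ)‖ := by linarith [mem_ball_zero_iff.1 ζ.2.1]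
    calc (1 - ‖(ζ : ℂ)‖) ^ (0 + 1 + ε) ≤ (1 - ‖(ζ : ℂ)‖) ^ (1 : ℝ) :=
          Real.rpow_le_rpow_of_exponent_ge h1 (by linarith [norm_nonneg (ζ : ℂ)]) (by linarith)
      _ = _ := Real.rpow_one _
  · obtain ⟨C, hC, h⟩ := exists_sum_order_mul_le_of_pos hζ₀ hξ hζ₀_inj hξ_inj hp hr hq hε
    refine ⟨C + 1, by positivity, fun f K hf h0 hK hu => ⟨?_, fun h => absurd h hp.ne'⟩⟩
    exact (diskZeroSum_le_of_forall_finset hf h0 (fun z hz => weight_nonneg (hd z hz) z)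
      (h f K hf h0 hK hu)).trans (ENNReal.ofReal_le_ofReal (by gcongr; linarith))
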